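/- Let $\theta\in(0,\pi/2)$ and let $$\Omega_\theta=\Big\{(x_1,x_2)\in\mathbb R^2:\ x_1\tan\theta<|x_2|<\Big(x_1+\frac{\pi}{\sin\theta}\Big)\tan\theta\Big\}$$ be the broken guide of half-opening $\theta$. Let $A=\Delta^{\mathsf{Dir}}_{\Omega_\theta}$ be the positive Dirichlet Laplacian on $L^2(\Omega_\theta)=L^2(\Omega_\theta;\mathbb C)$, that is, $A\psi=-\Delta\psi$ (in the sense of distributions) with domain $\mathrm{Dom}(A)=\{\psi\in H^1_0(\Omega_\theta):\ \Delta\psi\in L^2(\Omega_\theta)\}$. Its essential spectrum is the set $\sigma_{\mathsf{ess}}(A)$ of the real $\mu$ for which $A-\mu$ is not Fredholm from $\mathrm{Dom}(A)$ into $L^2(\Omega_\theta)$ (finite-dimensional kernel, closed range of finite codimension). For $j\ge1$ let $$\lambda_j=\inf_{\substack{u_1,\dots,u_j\in\mathrm{Dom}(A)\\ \text{independent}}}\ \ \sup_{0\neq u\in\mathrm{span}(u_1,\dots,u_j)}\ \frac{\langle Au,u\rangle}{\langle u,u\rangle}$$ be the $j$-th Rayleigh quotient of $A$, and let $\mathcal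 N(A,1)$ be the largest index $j\ge1$ with $\lambda_j<1$ ($0$ if there is none, $\infty$ if there are arbitrarily large ones). Then $\mathcal N(A,1)$ is finite and nonzero. Moreover, the set of the eigenvalues of $A$ lying strictly below $\sigma_{\mathsf{ess}}(A)$ coincides with the set of the eigenvalues of $A$ that are $<1$; it is finite and nonempty, each of these eigenvalues has finite multiplicity, and $\mathcal N(A,1)$ is the sum of their multiplicities. In particular, the number of bound states (eigenvalues below the essential spectrum, counted with multiplicity) is nonzero and finite. -/

import Mathlib

open MeasureTheory Filter Topology
open scoped ContDiff ENNReal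

noncomputable section

namespace Waveguide

/-! ### Unbounded operators on a complex Hilbert space -/

section Operators

variable {H : Type*} [NormedAddCommGroup H] [InnerProductSpace ℂ H]

/-- The linear map `A - z` from the domain of `A` into `H`. -/
def shift (A : H →ₗ.[ℂ] H) (z : ℂ) : A.domain →ₗ[ℂ] H :=
  A.toFun - z • A.domain.subtype

/-- The space of all `u` in the domain of `A` with `A u = z u`. -/
def eigenspace (A : H →ₗ.[ℂ] H) (z : ℂ) : Submodule ℂ A.domain :=
  LinearMap.ker (shift A z)

/-- A linear map defined on a subspace of `H` is Fredholm if its kernel is finite dimensional and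
its range is closed and of finite codimension. -/
def IsFredholmOn {D : Submodule ℂ H} (T : D →ₗ[ℂ] H) : Prop :=
  FiniteDimensional ℂ (LinearMap.ker T) ∧
    IsClosed (LinearMap.range T : Set H) ∧
    FiniteDimensional ℂ (H ⧸ LinearMap.range T)

/-- The (real) essential spectrum: those `μ` for which `A - μ`, from the domain of `A` into `H`,
is not Fredholm. -/
def essentialSpectrum (A : H →ₗ.[ℂ] H) : Set ℝ :=
  {μ | ¬ IsFredholmOn (shift A (μ : ℂ))}

/-- The real eigenvalues lying strictly below the whole essential spectrum. -/
def eigenvaluesBelowEss (A : H →ₗ.[ℂ] H) : Set ℝ :=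
  {r | eigenspace A (r : ℂ) ≠ ⊥ ∧ ∀ μ ∈ essentialSpectrum A, r < μ}

/-- The `j`-th Rayleigh quotient (meaningful for `j ≥ 1`): the infimum, over independent
`u₁, …, uⱼ` in the domain of `A`, of the supremum of `⟨A w, w⟩ / ⟨w, w⟩` over the nonzero `w` in
the span of `u₁, …, uⱼ`. Infimum and supremum are taken in the extended reals. -/
def rayleighQuotient (A : H →ₗ.[ℂ] H) (j : ℕ) : EReal :=
  ⨅ (u : Fin j → A.domain) (_ : LinearIndependent ℂ u),
    ⨆ (w : A.domain) (_ : w ∈ Submodule.span ℂ (Set.range u)) (_ : w ≠ 0),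
      (((inner ℂ (A w) (w : H)).re / ‖(w : H)‖ ^ 2 : ℝ) : EReal)

/-- The largest index `j ≥ 1` such that the `j`-th Rayleigh quotient of `A` is `< r`: it is `0` if
there is no such index, and `⊤` if there are arbitrarily large ones. -/
def countBelow (A : H →ₗ.[ℂ] H) (r : ℝ) : ℕ∞ :=
  ⨆ (j : ℕ) (_ : 1 ≤ j ∧ rayleighQuotient A j < (r : EReal)), (j : ℕ∞)

end Operators

/-! ### The Dirichlet Laplacian on an open subset of the plane

The plane is `ℝ × ℝ` with its Lebesgue (product) measure. Only partial derivatives are used, so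
the choice of a norm on `ℝ × ℝ` plays no role. -/

/-- The derivative of `φ` in the direction `v`. -/
def dirDeriv (v : ℝ × ℝ) (φ : ℝ × ℝ → ℂ) : ℝ × ℝ → ℂ :=
  fun x => fderiv ℝ φ x v

/-- The Laplacian `∂₁² φ + ∂₂² φ`. -/
def laplacian (φ : ℝ × ℝ → ℂ) : ℝ × ℝ → ℂ :=
  fun x => dirDeriv (1, 0) (dirDeriv (1, 0) φ) x + dirDeriv (0, 1) (dirDeriv (0, 1) φ) x

/-- Smooth functions with compact support in `Ω`. -/
structure IsTest (Ω : TopologicalSpace.Opens (ℝ × ℝ)) (φ : ℝ × ℝ → ℂ) : Prop where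
  smooth : ContDiff ℝ ∞ φ
  compact : HasCompactSupport φ
  support : tsupport φ ⊆ (Ω : Set (ℝ × ℝ))

/-- The complex Hilbert space `L²(Ω)`. -/
abbrev L2 (Ω : TopologicalSpace.Opens (ℝ × ℝ)) : Type :=
  Lp ℂ 2 ((volume : Measure (ℝ × ℝ)).restrict (Ω : Set (ℝ × ℝ)))

/-- `g` is the weak derivative of `u` in the direction `v`. -/
def HasWeakDeriv {Ω : TopologicalSpace.Opens (ℝ × ℝ)} (v : ℝ × ℝ) (u g : L2 Ω) : Prop :=
  ∀ φ, IsTest Ω φ → ∫ x in (Ω : Set (ℝ × ℝ)), u x * dirDeriv v φ x =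
    -∫ x in (Ω : Set (ℝ × ℝ)), g x * φ x

/-- `f` is the Laplacian of `u` in the sense of distributions on `Ω`. -/
def HasWeakLaplacian {Ω : TopologicalSpace.Opens (ℝ × ℝ)} (u f : L2 Ω) : Prop :=
  ∀ φ, IsTest Ω φ → ∫ x in (Ω : Set (ℝ × ℝ)), u x * laplacian φ x =
    ∫ x in (Ω : Set (ℝ × ℝ)), f x * φ x

/-- Convergence in `L²(Ω)` of a sequence of functions on the plane. -/
def TendstoL2 {Ω : TopologicalSpace.Opens (ℝ × ℝ)} (φ : ℕ → ℝ × ℝ → ℂ) (u : L2 Ω) : Prop :=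
  Tendsto (fun n => eLpNorm (fun x => φ n x - u x) 2
    ((volume : Measure (ℝ × ℝ)).restrict (Ω : Set (ℝ × ℝ)))) atTop (𝓝 0)

/-- Membership in `H¹₀(Ω)`, the closure of the test functions in `H¹(Ω)`: the function `u` of
`L²(Ω)` has weak first derivatives in `L²(Ω)`, and some sequence of test functions converges to
`u` in `L²(Ω)` together with its first derivatives. -/
def MemH10 {Ω : TopologicalSpace.Opens (ℝ × ℝ)} (u : L2 Ω) : Prop :=
  ∃ g₁ g₂ : L2 Ω, HasWeakDeriv (1, 0) u g₁ ∧ HasWeakDeriv (0, 1) u g₂ ∧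
    ∃ φ : ℕ → ℝ × ℝ → ℂ, (∀ n, IsTest Ω (φ n)) ∧ TendstoL2 φ u ∧
      TendstoL2 (fun n => dirDeriv (1, 0) (φ n)) g₁ ∧
      TendstoL2 (fun n => dirDeriv (0, 1) (φ n)) g₂

variable {Ω : TopologicalSpace.Opens (ℝ × ℝ)}

theorem IsTest.zero : IsTest Ω (fun _ => 0) :=
  ⟨contDiff_const, HasCompactSupport.zero, by
    have : tsupport (fun _ : ℝ × ℝ => (0 : ℂ)) = ∅ := tsupport_eq_empty_iff.2 rfl
    simp [this]⟩

theorem IsTest.add {φ ψ : ℝ × ℝ → ℂ} (hφ : IsTest Ω φ) (hψ : IsTest Ω ψ) :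
    IsTest Ω (fun x => φ x + ψ x) :=
  ⟨hφ.smooth.add hψ.smooth, hφ.compact.add hψ.compact,
    (tsupport_add φ ψ).trans (Set.union_subset hφ.support hψ.support)⟩

theorem IsTest.const_mul {φ : ℝ × ℝ → ℂ} (hφ : IsTest Ω φ) (c : ℂ) :
    IsTest Ω (fun x => c * φ x) :=
  ⟨contDiff_const.mul hφ.smooth, hφ.compact.mul_left,
    (tsupport_mul_subset_right (f := fun _ => c) (g := φ)).trans hφ.support⟩

theorem IsTest.dirDeriv {φ : ℝ × ℝ → ℂ} (hφ : IsTest Ω φ) (v : ℝ × ℝ) :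
    IsTest Ω (dirDeriv v φ) where
  smooth := (hφ.smooth.fderiv_right (m := ∞) (by simp)).clm_apply contDiff_const
  compact := hφ.compact.fderiv_apply ℝ v
  support := (tsupport_fderiv_apply_subset ℝ v).trans hφ.support

theorem IsTest.laplacian {φ : ℝ × ℝ → ℂ} (hφ : IsTest Ω φ) : IsTest Ω (laplacian φ) :=
  ((hφ.dirDeriv _).dirDeriv _).add ((hφ.dirDeriv _).dirDeriv _)

theorem IsTest.memLp {φ : ℝ × ℝ → ℂ} (hφ : IsTest Ω φ) (p : ℝ≥0∞) :
    MemLp φ p ((volume : Measure (ℝ × ℝ)).restrict (Ω : Set (ℝ × ℝ))) :=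
  hφ.smooth.continuous.memLp_of_hasCompactSupport hφ.compact

theorem IsTest.integrable_mul {φ : ℝ × ℝ → ℂ} (hφ : IsTest Ω φ) (u : L2 Ω) :
    IntegrableOn (fun x => u x * φ x) (Ω : Set (ℝ × ℝ)) :=
  (Lp.memLp u).integrable_mul (hφ.memLp 2)

theorem integral_add_mul {φ : ℝ × ℝ → ℂ} (hφ : IsTest Ω φ) (u v : L2 Ω) :
    ∫ x in (Ω : Set (ℝ × ℝ)), (u + v : L2 Ω) x * φ x =
      (∫ x in (Ω : Set (ℝ × ℝ)), u x * φ x) + ∫ x in (Ω : Set (ℝ × ℝ)), v x * φ x := by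
  rw [← integral_add (hφ.integrable_mul u) (hφ.integrable_mul v)]
  refine integral_congr_ae ?_
  filter_upwards [Lp.coeFn_add u v] with x hx
  rw [hx, Pi.add_apply, add_mul]

theorem integral_smul_mul (φ : ℝ × ℝ → ℂ) (c : ℂ) (u : L2 Ω) :
    ∫ x in (Ω : Set (ℝ × ℝ)), (c • u : L2 Ω) x * φ x =
      c * ∫ x in (Ω : Set (ℝ × ℝ)), u x * φ x := by
  rw [← integral_const_mul]
  refine integral_congr_ae ?_
  filter_upwards [Lp.coeFn_smul c u] with x hx
  rw [hx, Pi.smul_apply, smul_eq_mul, mul_assoc]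

theorem integral_zero_mul (φ : ℝ × ℝ → ℂ) :
    ∫ x in (Ω : Set (ℝ × ℝ)), (0 : L2 Ω) x * φ x = 0 := by
  have := integral_smul_mul φ 0 (0 : L2 Ω)
  simpa using this

theorem HasWeakDeriv.add {v : ℝ × ℝ} {u u' g g' : L2 Ω} (h : HasWeakDeriv v u g)
    (h' : HasWeakDeriv v u' g') : HasWeakDeriv v (u + u') (g + g') := fun φ hφ => by
  rw [integral_add_mul (hφ.dirDeriv v), integral_add_mul hφ, h φ hφ, h' φ hφ, neg_add]

theorem HasWeakDeriv.smul {v : ℝ × ℝ} {u g : L2 Ω} (c : ℂ) (h : HasWeakDeriv v u g) :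
    HasWeakDeriv v (c • u) (c • g) := fun φ hφ => by
  rw [integral_smul_mul, integral_smul_mul, h φ hφ, mul_neg]

theorem HasWeakLaplacian.add {u u' f f' : L2 Ω} (h : HasWeakLaplacian u f)
    (h' : HasWeakLaplacian u' f') : HasWeakLaplacian (u + u') (f + f') := fun φ hφ => by
  rw [integral_add_mul hφ.laplacian, integral_add_mul hφ, h φ hφ, h' φ hφ]

theorem HasWeakLaplacian.smul {u f : L2 Ω} (c : ℂ) (h : HasWeakLaplacian u f) :
    HasWeakLaplacian (c • u) (c • f) := fun φ hφ => by
  rw [integral_smul_mul, integral_smul_mul, h φ hφ]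

/-- The distributional Laplacian is unique. -/
theorem HasWeakLaplacian.unique {u f f' : L2 Ω} (h : HasWeakLaplacian u f)
    (h' : HasWeakLaplacian u f') : f = f' := by
  have hloc : ∀ w : L2 Ω, LocallyIntegrableOn (fun x => w x) (Ω : Set (ℝ × ℝ)) := fun w =>
    locallyIntegrableOn_of_locallyIntegrable_restrict
      ((Lp.memLp w).locallyIntegrable (by norm_num))
  have key := Ω.isOpen.ae_eq_zero_of_integral_contDiff_smul_eq_zero
    ((hloc f).sub (hloc f')) (fun g hg hgc hgs => by
      have ht : IsTest Ω (fun x => (g x : ℂ)) :=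
        ⟨Complex.ofRealCLM.contDiff.comp hg, hgc.comp_left (g := fun r : ℝ => (r : ℂ)) rfl,
          (tsupport_comp_subset (g := fun r : ℝ => (r : ℂ)) rfl g).trans hgs⟩
      have e : ∫ x in (Ω : Set (ℝ × ℝ)), (f x * (g x : ℂ) - f' x * (g x : ℂ)) = 0 := by
        rw [integral_sub (ht.integrable_mul f) (ht.integrable_mul f'), ← h _ ht, ← h' _ ht,
          sub_self]
      rw [← setIntegral_eq_integral_of_forall_compl_eq_zero (s := (Ω : Set (ℝ × ℝ)))
        (fun x hx => by
          rw [image_eq_zero_of_notMem_tsupport (fun hx' => hx (hgs hx')), zero_smul]), ← e]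
      refine integral_congr_ae (Eventually.of_forall fun x => ?_)
      simp only [Pi.sub_apply, Complex.real_smul]
      ring)
  refine Lp.ext ?_
  rw [Filter.EventuallyEq, ae_restrict_iff' Ω.isOpen.measurableSet]
  filter_upwards [key] with x hx hxΩ
  exact sub_eq_zero.1 (hx hxΩ)

theorem TendstoL2.add {φ ψ : ℕ → ℝ × ℝ → ℂ} {u v : L2 Ω} (hφ : ∀ n, IsTest Ω (φ n))
    (hψ : ∀ n, IsTest Ω (ψ n)) (h : TendstoL2 φ u) (h' : TendstoL2 ψ v) :
    TendstoL2 (fun n x => φ n x + ψ n x) (u + v) := by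
  have hs := Tendsto.add h h'
  rw [add_zero] at hs
  refine tendsto_of_tendsto_of_tendsto_of_le_of_le tendsto_const_nhds hs
    (fun _ => bot_le) fun n => ?_
  refine le_trans (le_of_eq (eLpNorm_congr_ae ?_)) (eLpNorm_add_le
    (((hφ n).memLp 2).sub (Lp.memLp u)).aestronglyMeasurable
    (((hψ n).memLp 2).sub (Lp.memLp v)).aestronglyMeasurable (by norm_num))
  filter_upwards [Lp.coeFn_add u v] with x hx
  simp only [hx, Pi.add_apply]
  ring

theorem TendstoL2.smul {φ : ℕ → ℝ × ℝ → ℂ} {u : L2 Ω} (c : ℂ) (h : TendstoL2 φ u) :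
    TendstoL2 (fun n x => c * φ n x) (c • u) := by
  have hs := ENNReal.Tendsto.const_mul (a := ‖c‖ₑ) h (Or.inr enorm_ne_top)
  rw [mul_zero] at hs
  refine hs.congr fun n => ?_
  rw [← eLpNorm_const_smul]
  refine eLpNorm_congr_ae ?_
  filter_upwards [Lp.coeFn_smul c u] with x hx
  simp only [hx, Pi.smul_apply, smul_eq_mul]
  ring

theorem dirDeriv_add {φ ψ : ℝ × ℝ → ℂ} (hφ : IsTest Ω φ) (hψ : IsTest Ω ψ) (v : ℝ × ℝ) :
    dirDeriv v (fun x => φ x + ψ x) = fun x => dirDeriv v φ x + dirDeriv v ψ x := by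
  funext x
  have h1 := hφ.smooth.differentiable (by simp) x
  have h2 := hψ.smooth.differentiable (by simp) x
  simp only [dirDeriv]
  rw [fderiv_fun_add h1 h2]
  rfl

theorem dirDeriv_const_mul {φ : ℝ × ℝ → ℂ} (hφ : IsTest Ω φ) (c : ℂ) (v : ℝ × ℝ) :
    dirDeriv v (fun x => c * φ x) = fun x => c * dirDeriv v φ x := by
  funext x
  have h1 := hφ.smooth.differentiable (by simp) x
  simp only [dirDeriv]
  rw [fderiv_const_mul h1]
  rfl

theorem MemH10.add {u u' : L2 Ω} (h : MemH10 u) (h' : MemH10 u') : MemH10 (u + u') := by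
  obtain ⟨g₁, g₂, hg₁, hg₂, φ, hφ, hu, hu₁, hu₂⟩ := h
  obtain ⟨k₁, k₂, hk₁, hk₂, ψ, hψ, hv, hv₁, hv₂⟩ := h'
  refine ⟨g₁ + k₁, g₂ + k₂, hg₁.add hk₁, hg₂.add hk₂, fun n x => φ n x + ψ n x,
    fun n => (hφ n).add (hψ n), hu.add hφ hψ hv, ?_, ?_⟩
  · simp only [dirDeriv_add (hφ _) (hψ _)]
    exact hu₁.add (fun n => (hφ n).dirDeriv _) (fun n => (hψ n).dirDeriv _) hv₁
  · simp only [dirDeriv_add (hφ _) (hψ _)]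
    exact hu₂.add (fun n => (hφ n).dirDeriv _) (fun n => (hψ n).dirDeriv _) hv₂

theorem MemH10.smul {u : L2 Ω} (c : ℂ) (h : MemH10 u) : MemH10 (c • u) := by
  obtain ⟨g₁, g₂, hg₁, hg₂, φ, hφ, hu, hu₁, hu₂⟩ := h
  refine ⟨c • g₁, c • g₂, hg₁.smul c, hg₂.smul c, fun n x => c * φ n x,
    fun n => (hφ n).const_mul c, hu.smul c, ?_, ?_⟩
  · simp only [dirDeriv_const_mul (hφ _)]
    exact hu₁.smul c
  · simp only [dirDeriv_const_mul (hφ _)]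
    exact hu₂.smul c

theorem MemH10.zero : MemH10 (0 : L2 Ω) := by
  have hd : ∀ v : ℝ × ℝ, HasWeakDeriv v (0 : L2 Ω) 0 := fun v φ _ => by
    rw [integral_zero_mul, integral_zero_mul, neg_zero]
  have ht : TendstoL2 (fun _ _ => (0 : ℂ)) (0 : L2 Ω) := by
    refine tendsto_const_nhds.congr fun n => ?_
    rw [eq_comm, ← eLpNorm_zero (ε := ℂ) (p := 2)
      (μ := (volume : Measure (ℝ × ℝ)).restrict (Ω : Set (ℝ × ℝ)))]
    refine eLpNorm_congr_ae ?_
    filter_upwards [Lp.coeFn_zero ℂ 2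
      ((volume : Measure (ℝ × ℝ)).restrict (Ω : Set (ℝ × ℝ)))] with x hx
    rw [hx]
    simp
  have h0 : ∀ v : ℝ × ℝ, dirDeriv v (fun _ => (0 : ℂ)) = fun _ => 0 := fun v => by
    funext x
    simp [dirDeriv]
  refine ⟨0, 0, hd _, hd _, fun _ _ => 0, fun _ => IsTest.zero, ht, ?_, ?_⟩
  · simpa only [h0] using ht
  · simpa only [h0] using ht

/-- The domain of the Dirichlet Laplacian: the `u` in `H¹₀(Ω)` with `Δ u` in `L²(Ω)`. -/
def dirichletDomain (Ω : TopologicalSpace.Opens (ℝ × ℝ)) : Submodule ℂ (L2 Ω) where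
  carrier := {u | MemH10 u ∧ ∃ f : L2 Ω, HasWeakLaplacian u f}
  add_mem' := fun ⟨h, f, hf⟩ ⟨h', f', hf'⟩ => ⟨h.add h', f + f', hf.add hf'⟩
  zero_mem' := ⟨MemH10.zero, 0, fun φ _ => by rw [integral_zero_mul, integral_zero_mul]⟩
  smul_mem' := fun c _ ⟨h, f, hf⟩ => ⟨h.smul c, c • f, hf.smul c⟩

/-- The positive Dirichlet Laplacian on `Ω`, as an unbounded operator of `L²(Ω)`: it sends `u` to
`-Δ u`. -/
def dirichletLaplacian (Ω : TopologicalSpace.Opens (ℝ × ℝ)) : L2 Ω →ₗ.[ℂ] L2 Ω where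
  domain := dirichletDomain Ω
  toFun :=
    { toFun := fun u => -u.2.2.choose
      map_add' := fun u v => by
        rw [← neg_add]
        exact congrArg _ ((u + v).2.2.choose_spec.unique
          (u.2.2.choose_spec.add v.2.2.choose_spec))
      map_smul' := fun c u => by
        rw [RingHom.id_apply, smul_neg]
        exact congrArg _ ((c • u).2.2.choose_spec.unique (u.2.2.choose_spec.smul c)) }

/-- The broken guide with half-opening `θ`. -/
def brokenGuide (θ : ℝ) : TopologicalSpace.Opens (ℝ × ℝ) where
  carrier := {x | x.1 * Real.tan θ < |x.2| ∧ |x.2| < (x.1 + Real.pi / Real.sin θ) * Real.tan θ}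
  is_open' := by
    have h₁ : IsOpen {x : ℝ × ℝ | x.1 * Real.tan θ < |x.2|} :=
      isOpen_lt (by fun_prop) (by fun_prop)
    have h₂ : IsOpen {x : ℝ × ℝ | |x.2| < (x.1 + Real.pi / Real.sin θ) * Real.tan θ} :=
      isOpen_lt (by fun_prop) (by fun_prop)
    exact h₁.inter h₂

end Waveguide

end

/-!
Outside a bounded kite, the guide consists of two half-strips of width `π`. Wirtinger's inequality
for the transverse coordinate bounds the form of `A` on them below by the squared norm. On the kite,
cut into finitely many small convex cells, Poincaré's inequality does so for functions with mean
zero on every cell. Thus `⟨A u, u⟩ ≥ ‖u‖²` on the orthogonal complement of finitely many functions,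
which leaves only finitely many eigenvalues below `1`, and no essential spectrum. Test functions
placed far away in the arms have Rayleigh quotients close to `1`; being mutually orthogonal, they
give `λ_j ≤ 1` for all `j`, and therefore `1` belongs to the essential spectrum.

A bound state is found by perturbing the threshold resonance `sin` of the transverse coordinate. A
long plateau in the direction of the guide costs arbitrarily little energy above `1`, and bending
it in the corner gains a first order term, so that some Rayleigh quotient is smaller than `1`.
-/

noncomputable section

namespace Waveguide

section LinearAlgebra

theorem exists_finset_of_mem_biSup {R M ι : Type*} [Semiring R] [AddCommMonoid M] [Module R M]
    {p : ι → Submodule R M} {s : Set ι} {x : M} (hx : x ∈ ⨆ i ∈ s, p i) :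
    ∃ t : Finset ι, ↑t ⊆ s ∧ x ∈ ⨆ i ∈ t, p i := by
  classical
  rw [iSup_subtype', Submodule.mem_iSup_iff_exists_finset] at hx
  obtain ⟨t, ht⟩ := hx
  refine ⟨t.image Subtype.val, by simp, ?_⟩
  rwa [Finset.iSup_finset_image]

theorem exists_mem_ne_zero_orthogonal {𝕜 V : Type*} [RCLike 𝕜] [NormedAddCommGroup V]
    [InnerProductSpace 𝕜 V] {E W : Submodule 𝕜 V} [FiniteDimensional 𝕜 E] [FiniteDimensional 𝕜 W]
    (h : Module.finrank 𝕜 E < Module.finrank 𝕜 W) : ∃ w ∈ W, w ≠ 0 ∧ w ∈ Eᗮ := by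
  let f : W →ₗ[𝕜] E := (E.orthogonalProjectionOnto : V →ₗ[𝕜] E).domRestrict W
  obtain ⟨w, hw, hw0⟩ := (Submodule.ne_bot_iff _).1 (LinearMap.ker_ne_bot_of_finrank_lt (f := f) h)
  exact ⟨w, w.2, by simpa using hw0, Submodule.orthogonalProjectionOnto_eq_zero_iff.1 hw⟩

variable {K V ι : Type*} [Field K] [AddCommGroup V] [Module K V] {p : ι → Submodule K V}

theorem finite_ne_bot_of_le (hp : iSupIndep p) (E : Submodule K V) [FiniteDimensional K E] :
    {i | p i ≠ ⊥ ∧ p i ≤ E}.Finite := by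
  have hex (i : {i // p i ≠ ⊥ ∧ p i ≤ E}) : ∃ x : V, x ∈ p i ∧ x ≠ 0 :=
    (Submodule.ne_bot_iff _).1 i.2.1
  choose v hv hv0 using hex
  have hli : LinearIndependent K v :=
    (hp.comp Subtype.val_injective).linearIndependent _ hv hv0
  have hliE : LinearIndependent K fun i => (⟨v i, i.2.2 (hv i)⟩ : E) :=
    LinearIndependent.of_comp E.subtype hli
  exact Set.finite_coe_iff.1 hliE.finite

theorem finrank_biSup_finset (hp : iSupIndep p) (s : Finset ι)
    (hfd : ∀ i ∈ s, FiniteDimensional K (p i)) :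
    Module.finrank K (⨆ i ∈ s, p i : Submodule K V) = ∑ i ∈ s, Module.finrank K (p i) := by
  classical
  induction s using Finset.induction_on with
  | empty =>
    have hbot : ⨆ i ∈ (∅ : Finset ι), p i = ⊥ := by simp
    rw [hbot, finrank_bot, Finset.sum_empty]
  | insert a s ha ih =>
    have hfds : ∀ i ∈ s, FiniteDimensional K (p i) := fun i hi =>
      hfd i (Finset.mem_insert_of_mem hi)
    have := hfd a (Finset.mem_insert_self a s)
    have : FiniteDimensional K (⨆ i ∈ s, p i : Submodule K V) :=
      Module.Finite.of_fg (Submodule.fg_biSup s p fun i hi => Module.Finite.iff_fg.1 (hfds i hi))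
    have hdisj : p a ⊓ (⨆ i ∈ s, p i) = ⊥ :=
      (hp.disjoint_biSup (x := a) (y := (s : Set ι)) (by simpa using ha)).eq_bot
    have hsum := Submodule.finrank_sup_add_finrank_inf_eq (p a) (⨆ i ∈ s, p i)
    rw [hdisj, finrank_bot, add_zero] at hsum
    rw [Finset.iSup_insert, Finset.sum_insert ha, hsum, ih hfds]

theorem biSup_ne_bot (p : ι → Submodule K V) (s : Set ι) :
    ⨆ i ∈ {i | p i ≠ ⊥ ∧ i ∈ s}, p i = ⨆ i ∈ s, p i := by
  refine le_antisymm (biSup_mono fun _ hi => hi.2) (iSup₂_le fun i hi => ?_)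
  rcases eq_or_ne (p i) ⊥ with h | h
  · exact h.trans_le bot_le
  · exact le_iSup₂_of_le i ⟨h, hi⟩ le_rfl

theorem finite_ne_bot_of_biSup (hp : iSupIndep p) (s : Set ι)
    [FiniteDimensional K (⨆ i ∈ s, p i : Submodule K V)] : {i | p i ≠ ⊥ ∧ i ∈ s}.Finite :=
  (finite_ne_bot_of_le hp (⨆ i ∈ s, p i)).subset fun _ hi => ⟨hi.1, le_biSup p hi.2⟩

theorem finrank_biSup (hp : iSupIndep p) (s : Set ι)
    [FiniteDimensional K (⨆ i ∈ s, p i : Submodule K V)] :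
    Module.finrank K (⨆ i ∈ s, p i : Submodule K V) =
      ∑ᶠ i ∈ {i | p i ≠ ⊥ ∧ i ∈ s}, Module.finrank K (p i) := by
  have hfin := finite_ne_bot_of_biSup hp s
  have hmem : ⨆ i ∈ hfin.toFinset, p i = ⨆ i ∈ {i | p i ≠ ⊥ ∧ i ∈ s}, p i := by
    simp only [Set.Finite.mem_toFinset]
  rw [finsum_mem_eq_finite_toFinset_sum _ hfin, ← finrank_biSup_finset hp, hmem, biSup_ne_bot]
  · exact fun i hi => Submodule.finiteDimensional_of_le (le_biSup p (hfin.mem_toFinset.1 hi).2)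

end LinearAlgebra

section ClosedGraph

variable {𝕜 V E F : Type*} [NontriviallyNormedField 𝕜] [AddCommGroup V] [Module 𝕜 V]
  [NormedAddCommGroup E] [NormedSpace 𝕜 E] [CompleteSpace E]
  [NormedAddCommGroup F] [NormedSpace 𝕜 F] [CompleteSpace F]

theorem isClosed_range_iff_of_isClosed_graph {j : V →ₗ[𝕜] E} {T : V →ₗ[𝕜] F}
    (hgraph : IsClosed (LinearMap.range (j.prod T) : Set (E × F)))
    (hT : LinearMap.ker T = ⊥) :
    IsClosed (LinearMap.range T : Set F) ↔ ∃ c > 0, ∀ v, c * ‖j v‖ ≤ ‖T v‖ := by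
  let G := LinearMap.range (j.prod T)
  let f : G →L[𝕜] F := (ContinuousLinearMap.snd 𝕜 E F).comp G.subtypeL
  have : CompleteSpace G := hgraph.completeSpace_coe
  have hrange : Set.range f = LinearMap.range T := by
    ext y
    constructor
    · rintro ⟨⟨_, v, rfl⟩, rfl⟩
      exact ⟨v, rfl⟩
    · rintro ⟨v, rfl⟩
      exact ⟨⟨_, v, rfl⟩, rfl⟩
  have hinj : Function.Injective f := by
    refine (injective_iff_map_eq_zero f).2 ?_
    rintro ⟨_, v, rfl⟩ hv
    have hv0 : v = 0 := LinearMap.ker_eq_bot'.1 hT v hv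
    ext <;> simp [hv0]
  rw [← hrange, ContinuousLinearMap.isClosed_range_iff_antilipschitz_of_injective f hinj]
  constructor
  · rintro ⟨C, hC⟩
    refine ⟨((C : ℝ) + 1)⁻¹, by positivity, fun v => ?_⟩
    have hv : ‖(j.prod T) v‖ ≤ C * ‖T v‖ := hC.le_mul_norm (x := ⟨_, v, rfl⟩) (map_zero f)
    rw [inv_mul_le_iff₀ (by positivity)]
    calc ‖j v‖ ≤ ‖(j.prod T) v‖ := norm_fst_le (E := E) (F := F) ((j.prod T) v)
      _ ≤ C * ‖T v‖ := hv
      _ ≤ (C + 1) * ‖T v‖ := by gcongr; linarith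
  · rintro ⟨c, hc, hle⟩
    refine ⟨⟨max c⁻¹ 1, by positivity⟩, f.antilipschitz_of_bound ?_⟩
    rintro ⟨_, v, rfl⟩
    refine norm_prod_le_iff.2 ⟨?_, ?_⟩
    · calc ‖j v‖ ≤ c⁻¹ * ‖T v‖ := by rw [inv_mul_eq_div, le_div_iff₀' hc]; exact hle v
        _ ≤ max c⁻¹ 1 * ‖T v‖ := by gcongr; exact le_max_left _ _
    · exact le_mul_of_one_le_left (norm_nonneg _) (le_max_right _ _)

end ClosedGraph

/-! ### Spectrum below a threshold -/

section Operators

variable {H : Type*} [NormedAddCommGroup H] [InnerProductSpace ℂ H] {A : H →ₗ.[ℂ] H}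

/-- A nonnegative symmetric operator `A` such that `A + 1` is onto; by von Neumann's criterion this
is a nonnegative self-adjoint operator. -/
structure IsNonnegSelfAdjoint (A : H →ₗ.[ℂ] H) : Prop where
  symm : ∀ u v : A.domain, inner ℂ (A u) (v : H) = inner ℂ (u : H) (A v)
  surj : ∀ f : H, ∃ u : A.domain, A u + (u : H) = f
  nonneg : ∀ u : A.domain, 0 ≤ (inner ℂ (A u) (u : H)).re

/-- The quadratic form `⟨A u, u⟩` of `A`, of which only the real part is recorded since `A` is
meant to be symmetric. -/
def quad (A : H →ₗ.[ℂ] H) (u : A.domain) : ℝ :=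
  (inner ℂ (A u) (u : H)).re

/-- The quadratic form of `A` is at least `b` times the squared norm on the part of the domain
that is orthogonal to `F`. -/
def BoundedBelowOn (A : H →ₗ.[ℂ] H) (b : ℝ) (F : Submodule ℂ H) : Prop :=
  ∀ u : A.domain, (u : H) ∈ Fᗮ → b * ‖(u : H)‖ ^ 2 ≤ quad A u

theorem shift_apply (A : H →ₗ.[ℂ] H) (z : ℂ) (u : A.domain) :
    shift A z u = A u - z • (u : H) := rfl

theorem mem_eigenspace {z : ℂ} {u : A.domain} : u ∈ eigenspace A z ↔ A u = z • (u : H) := by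
  rw [eigenspace, LinearMap.mem_ker, shift_apply, sub_eq_zero]

theorem re_inner_self (x : H) : (inner ℂ x x).re = ‖x‖ ^ 2 :=
  (norm_sq_eq_re_inner (𝕜 := ℂ) x).symm

theorem re_inner_shift_self (m : ℝ) (u : A.domain) :
    (inner ℂ (shift A m u) (u : H)).re = quad A u - m * ‖(u : H)‖ ^ 2 := by
  rw [shift_apply, inner_sub_left, inner_smul_left, Complex.conj_ofReal, Complex.sub_re,
    Complex.re_ofReal_mul, re_inner_self, quad]

namespace IsNonnegSelfAdjoint

variable (hA : IsNonnegSelfAdjoint A)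
include hA

theorem inner_shift (m : ℝ) (u v : A.domain) :
    inner ℂ (shift A m u) (v : H) = inner ℂ (u : H) (shift A m v) := by
  rw [shift_apply, shift_apply, inner_sub_left, inner_sub_right, hA.symm, inner_smul_left,
    inner_smul_right, Complex.conj_ofReal]

theorem mem_graph_iff {x y : H} :
    (x, y) ∈ A.graph ↔ ∀ v : A.domain, inner ℂ (A v) x = inner ℂ (v : H) y := by
  rw [LinearPMap.mem_graph_iff]
  refine ⟨by rintro ⟨w, rfl, rfl⟩ v; exact hA.symm v w, fun hxy => ?_⟩
  obtain ⟨w, hw⟩ := hA.surj (y + x)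
  have hwx : (w : H) = x := by
    obtain ⟨v, hv⟩ := hA.surj (w - x)
    have hself : inner ℂ ((w : H) - x) ((w : H) - x) = 0 := by
      calc inner ℂ ((w : H) - x) ((w : H) - x) = inner ℂ (A v + (v : H)) ((w : H) - x) := by rw [hv]
        _ = inner ℂ (v : H) (A w + w) - inner ℂ (v : H) (y + x) := by
            simp only [inner_sub_right, inner_add_left, inner_add_right, hA.symm v w, hxy v]
        _ = 0 := by rw [hw, sub_self]
    exact sub_eq_zero.1 (inner_self_eq_zero.1 hself)
  exact ⟨w, hwx, by rw [← hwx] at hw; exact add_right_cancel hw⟩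

theorem isClosed : A.IsClosed := by
  have hset : (A.graph : Set (H × H)) =
      ⋂ v : A.domain, {x | inner ℂ (A v) x.1 = inner ℂ (v : H) x.2} := by
    ext x
    simp only [Set.mem_iInter, Set.mem_ofPred_eq, ← hA.mem_graph_iff, SetLike.mem_coe]
  rw [LinearPMap.IsClosed, hset]
  exact isClosed_iInter fun v => isClosed_eq (by fun_prop) (by fun_prop)

theorem orthogonal_range_shift (m : ℝ) :
    (LinearMap.range (shift A m))ᗮ = (eigenspace A m).map A.domain.subtype := by
  ext y
  calc y ∈ (LinearMap.range (shift A m))ᗮ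
      ↔ ∀ v : A.domain, inner ℂ (A v) y = inner ℂ (v : H) ((m : ℂ) • y) := by
        simp only [Submodule.mem_orthogonal, LinearMap.mem_range, forall_exists_index,
          forall_apply_eq_imp_iff, shift_apply, inner_sub_left, inner_smul_left, inner_smul_right,
          Complex.conj_ofReal, sub_eq_zero]
    _ ↔ (y, (m : ℂ) • y) ∈ A.graph := hA.mem_graph_iff.symm
    _ ↔ y ∈ (eigenspace A m).map A.domain.subtype := by
        rw [LinearPMap.mem_graph_iff, Submodule.mem_map]
        exact ⟨fun ⟨w, hwy, hw⟩ => ⟨w, mem_eigenspace.2 (by rw [hw, hwy]), hwy⟩,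
          fun ⟨w, hw, hwy⟩ => ⟨w, hwy, by rw [mem_eigenspace.1 hw, ← hwy]; rfl⟩⟩

theorem orthogonalFamily_eigenspace :
    OrthogonalFamily ℂ (fun r : ℝ => eigenspace A (r : ℂ))
      (fun r => (eigenspace A (r : ℂ)).subtypeₗᵢ) := by
  intro r s hrs u v
  have h := hA.symm (u : A.domain) (v : A.domain)
  rw [mem_eigenspace.1 u.2, mem_eigenspace.1 v.2, inner_smul_left, inner_smul_right,
    Complex.conj_ofReal, ← sub_eq_zero, ← sub_mul] at h
  exact (mul_eq_zero.1 h).resolve_left (sub_ne_zero.2 (Complex.ofReal_injective.ne hrs))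

end IsNonnegSelfAdjoint

section Fredholm

theorem isClosed_range_prod_shift (hA : A.IsClosed) (z : ℂ) {K : Submodule ℂ H}
    (hK : IsClosed (K : Set H)) :
    IsClosed (LinearMap.range ((A.domain.subtype.domRestrict (K.comap A.domain.subtype)).prod
      ((shift A z).domRestrict (K.comap A.domain.subtype))) : Set (H × H)) := by
  have hset : (LinearMap.range ((A.domain.subtype.domRestrict (K.comap A.domain.subtype)).prod
      ((shift A z).domRestrict (K.comap A.domain.subtype))) : Set (H × H)) =
      {x | x.1 ∈ K} ∩ (fun x : H × H => (x.1, x.2 + z • x.1)) ⁻¹' A.graph := by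
    ext ⟨x, y⟩
    constructor
    · rintro ⟨u, hu⟩
      obtain ⟨rfl, rfl⟩ := Prod.ext_iff.1 hu
      refine ⟨u.2, (LinearPMap.mem_graph_iff A).2 ⟨u, rfl, ?_⟩⟩
      exact (sub_add_cancel _ _).symm
    · rintro ⟨hx, hxy⟩
      obtain ⟨u, rfl, hu⟩ := (LinearPMap.mem_graph_iff A).1 hxy
      exact ⟨⟨u, hx⟩, Prod.ext rfl (sub_eq_of_eq_add hu)⟩
  rw [hset]
  exact (hK.preimage continuous_fst).inter (IsClosed.preimage (by fun_prop) hA)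

theorem isClosed_map_shift_iff [CompleteSpace H] (hA : A.IsClosed) (z : ℂ) {K : Submodule ℂ H}
    (hK : IsClosed (K : Set H)) (hdisj : Disjoint (K.comap A.domain.subtype) (eigenspace A z)) :
    IsClosed ((K.comap A.domain.subtype).map (shift A z) : Set H) ↔
      ∃ c > 0, ∀ u : A.domain, (u : H) ∈ K → c * ‖(u : H)‖ ≤ ‖shift A z u‖ := by
  have hker : LinearMap.ker ((shift A z).domRestrict (K.comap A.domain.subtype)) = ⊥ :=
    LinearMap.ker_eq_bot'.2 fun u hu => Subtype.ext (Submodule.disjoint_def.1 hdisj u u.2 hu)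
  rw [← LinearMap.range_domRestrict,
    isClosed_range_iff_of_isClosed_graph (isClosed_range_prod_shift hA z hK) hker]
  simp only [Subtype.forall (p := (· ∈ K.comap A.domain.subtype)), Submodule.mem_comap,
    Submodule.subtype_apply, LinearMap.domRestrict_apply]

theorem cofg_comap_orthogonal (D F : Submodule ℂ H) [FiniteDimensional ℂ F] :
    (Fᗮ.comap D.subtype).CoFG := by
  have hker : Fᗮ.comap D.subtype =
      LinearMap.ker ((F.orthogonalProjectionOnto : H →ₗ[ℂ] F) ∘ₗ D.subtype) := by
    ext u
    simp
  rw [hker]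
  exact Submodule.CoFG.ker _

namespace BoundedBelowOn

variable {b m : ℝ} {F : Submodule ℂ H} (hF : BoundedBelowOn A b F)
include hF

theorem sub_mul_norm_le_norm_shift (m : ℝ) {u : A.domain} (hu : (u : H) ∈ Fᗮ) :
    (b - m) * ‖(u : H)‖ ≤ ‖shift A m u‖ := by
  rcases eq_or_ne (u : H) 0 with h0 | h0
  · simp [h0]
  refine le_of_mul_le_mul_right ?_ (norm_pos_iff.2 h0)
  calc (b - m) * ‖(u : H)‖ * ‖(u : H)‖ ≤ quad A u - m * ‖(u : H)‖ ^ 2 := by linarith [hF u hu]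
    _ = (inner ℂ (shift A m u) (u : H)).re := (re_inner_shift_self m u).symm
    _ ≤ ‖inner ℂ (shift A m u) (u : H)‖ := Complex.re_le_norm _
    _ ≤ ‖shift A m u‖ * ‖(u : H)‖ := norm_inner_le_norm _ _

theorem disjoint_eigenspace (hm : m < b) :
    Disjoint (Fᗮ.comap A.domain.subtype) (eigenspace A m) := by
  rw [Submodule.disjoint_def]
  intro u hu hu'
  have h := hF.sub_mul_norm_le_norm_shift m hu
  rw [LinearMap.mem_ker.1 hu', norm_zero] at h
  exact Subtype.ext (norm_le_zero_iff.1 (nonpos_of_mul_nonpos_right h (sub_pos.2 hm)))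

theorem isFredholmOn_shift [CompleteSpace H] [FiniteDimensional ℂ F] (hA : IsNonnegSelfAdjoint A)
    (hm : m < b) : IsFredholmOn (shift A m) := by
  have hco := cofg_comap_orthogonal A.domain F
  have hker : FiniteDimensional ℂ (eigenspace A m) :=
    Module.Finite.of_fg (hco.fg_of_disjoint (hF.disjoint_eigenspace hm).symm)
  have hclosed : IsClosed (LinearMap.range (shift A m) : Set H) :=
    LinearMap.isClosed_range_of_isClosed_map_of_finiteDimensional_quotient
      (s := Fᗮ.comap A.domain.subtype)
      ((isClosed_map_shift_iff hA.isClosed m F.isClosed_orthogonal (hF.disjoint_eigenspace hm)).2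
        ⟨b - m, sub_pos.2 hm, fun _ => hF.sub_mul_norm_le_norm_shift m⟩)
  have : CompleteSpace (LinearMap.range (shift A m)) := hclosed.completeSpace_coe
  have : FiniteDimensional ℂ (LinearMap.range (shift A m))ᗮ := by
    rw [hA.orthogonal_range_shift]
    infer_instance
  exact ⟨hker, hclosed, Module.Finite.equiv
    (Submodule.quotientEquivOfIsCompl _ _ (Submodule.isCompl_orthogonal _)).symm⟩

end BoundedBelowOn

end Fredholm

section Gap

/-- A subspace of the domain of `A` that `A` maps into itself. -/
def Stable (A : H →ₗ.[ℂ] H) (E : Submodule ℂ A.domain) : Prop :=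
  E.map A.toFun ≤ E.map A.domain.subtype

theorem stable_eigenspace (z : ℂ) : Stable A (eigenspace A z) := by
  rintro _ ⟨u, hu, rfl⟩
  exact ⟨z • u, Submodule.smul_mem _ z hu, (mem_eigenspace.1 hu).symm⟩

theorem Stable.iSup {ι : Sort*} {E : ι → Submodule ℂ A.domain} (hE : ∀ i, Stable A (E i)) :
    Stable A (⨆ i, E i) := by
  rw [Stable, Submodule.map_iSup, Submodule.map_iSup]
  exact iSup_mono hE

theorem Stable.sup {E E' : Submodule ℂ A.domain} (hE : Stable A E) (hE' : Stable A E') :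
    Stable A (E ⊔ E') := by
  rw [Stable, Submodule.map_sup, Submodule.map_sup]
  exact sup_le_sup hE hE'

theorem Stable.map_shift_le {E : Submodule ℂ A.domain} (hE : Stable A E) (z : ℂ) :
    E.map (shift A z) ≤ E.map A.domain.subtype := by
  rintro _ ⟨e, he, rfl⟩
  exact Submodule.sub_mem _ (hE ⟨e, he, rfl⟩) (Submodule.smul_mem _ z ⟨e, he, rfl⟩)

theorem comap_orthogonal_map_subtype {D : Submodule ℂ H} (E : Submodule ℂ D) :
    (E.map D.subtype)ᗮ.comap D.subtype = Eᗮ := by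
  ext u
  simp [Submodule.mem_orthogonal]

theorem map_shift_orthogonal [CompleteSpace H] (hA : IsNonnegSelfAdjoint A)
    {E : Submodule ℂ A.domain} [FiniteDimensional ℂ E] (hE : Stable A E) {m : ℝ}
    (hm : eigenspace A m ≤ E) (hcl : IsClosed (LinearMap.range (shift A m) : Set H)) :
    Eᗮ.map (shift A m) = (E.map A.domain.subtype)ᗮ := by
  have hmaps : ∀ g ∈ Eᗮ, shift A m g ∈ (E.map A.domain.subtype)ᗮ := by
    intro g hg
    rw [← comap_orthogonal_map_subtype] at hg
    rw [Submodule.mem_orthogonal]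
    rintro _ ⟨e, he, rfl⟩
    rw [Submodule.subtype_apply, ← hA.inner_shift]
    exact (Submodule.mem_orthogonal _ _).1 hg _ (hE.map_shift_le m ⟨e, he, rfl⟩)
  refine le_antisymm (Submodule.map_le_iff_le_comap.2 hmaps) fun y hy => ?_
  have : CompleteSpace (LinearMap.range (shift A m)) := hcl.completeSpace_coe
  obtain ⟨u, rfl⟩ : y ∈ LinearMap.range (shift A m) := by
    rw [← Submodule.orthogonal_orthogonal (LinearMap.range (shift A m)), hA.orthogonal_range_shift]
    exact Submodule.orthogonal_le (Submodule.map_mono hm) hy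
  obtain ⟨e, he, g, hg, rfl⟩ : ∃ e ∈ E, ∃ g ∈ Eᗮ, e + g = u :=
    Submodule.mem_sup.1 (by
      rw [Submodule.sup_orthogonal_of_hasOrthogonalProjection]
      exact Submodule.mem_top)
  have he0 : shift A m e = 0 := by
    refine Submodule.disjoint_def.1 (Submodule.orthogonal_disjoint (E.map A.domain.subtype)) _
      (hE.map_shift_le m ⟨e, he, rfl⟩) ?_
    rw [map_add] at hy
    exact (Submodule.add_mem_iff_left _ (hmaps g hg)).1 hy
  exact ⟨g, hg, by rw [map_add, he0, zero_add]⟩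

theorem re_inner_shift_sub_smul (hA : IsNonnegSelfAdjoint A) (m c : ℝ) (u g : A.domain) :
    (inner ℂ (shift A m (u - (c : ℂ) • g)) ((u - (c : ℂ) • g : A.domain) : H)).re =
      (inner ℂ (shift A m u) (u : H)).re - 2 * c * (inner ℂ (shift A m g) (u : H)).re +
        c ^ 2 * (inner ℂ (shift A m g) (g : H)).re := by
  have hsymm : (inner ℂ (shift A m u) (g : H)).re = (inner ℂ (shift A m g) (u : H)).re := by
    rw [hA.inner_shift, ← inner_conj_symm, Complex.conj_re]
  simp only [map_sub, map_smul, Submodule.coe_sub, Submodule.coe_smul, inner_sub_left,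
    inner_sub_right, inner_smul_left, inner_smul_right, Complex.conj_ofReal, Complex.sub_re,
    Complex.re_ofReal_mul, hsymm]
  ring

theorem exists_gap [CompleteSpace H] (hA : IsNonnegSelfAdjoint A) {E : Submodule ℂ A.domain}
    [FiniteDimensional ℂ E] (hE : Stable A E) {m : ℝ} (hm : eigenspace A m ≤ E)
    (hcl : IsClosed (LinearMap.range (shift A m) : Set H))
    (hlow : ∀ u ∈ Eᗮ, m * ‖(u : H)‖ ^ 2 ≤ quad A u) :
    ∃ c > 0, ∀ u ∈ Eᗮ, (m + c) * ‖(u : H)‖ ^ 2 ≤ quad A u := by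
  have honto := map_shift_orthogonal hA hE hm hcl
  have hdisj : Disjoint Eᗮ (eigenspace A m) := E.orthogonal_disjoint.symm.mono_right hm
  obtain ⟨c, hc, hle⟩ := (isClosed_map_shift_iff hA.isClosed m
    (E.map A.domain.subtype).isClosed_orthogonal (by rwa [comap_orthogonal_map_subtype])).1 (by
      rw [comap_orthogonal_map_subtype, honto]
      exact Submodule.isClosed_orthogonal _)
  have hmem (u : A.domain) : u ∈ Eᗮ ↔ (u : H) ∈ (E.map A.domain.subtype)ᗮ := by
    rw [← comap_orthogonal_map_subtype, Submodule.mem_comap, Submodule.subtype_apply]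
  refine ⟨c, hc, fun u hu => ?_⟩
  obtain ⟨g, hg, hgu⟩ : (u : H) ∈ Eᗮ.map (shift A m) := by rwa [honto, ← hmem]
  have hinner : c * (inner ℂ (u : H) (g : H)).re ≤ ‖(u : H)‖ ^ 2 := by
    calc c * (inner ℂ (u : H) (g : H)).re ≤ c * (‖(u : H)‖ * ‖(g : H)‖) :=
          mul_le_mul_of_nonneg_left ((Complex.re_le_norm _).trans (norm_inner_le_norm _ _)) hc.le
      _ = ‖(u : H)‖ * (c * ‖(g : H)‖) := by ring
      _ ≤ ‖(u : H)‖ * ‖(u : H)‖ := by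
          gcongr
          exact hgu ▸ hle g ((hmem g).1 hg)
      _ = ‖(u : H)‖ ^ 2 := (sq _).symm
  -- the form of `A - m` is nonnegative at `u - c g`, where `g` is the preimage of `u`
  have hpos := hlow (u - (c : ℂ) • g) (Eᗮ.sub_mem hu (Eᗮ.smul_mem _ hg))
  rw [← sub_nonneg, ← re_inner_shift_self, re_inner_shift_sub_smul hA, hgu, re_inner_self,
    re_inner_shift_self] at hpos
  nlinarith

end Gap

end Operators

section MinMax

variable {H : Type*} [NormedAddCommGroup H] [InnerProductSpace ℂ H] {A : H →ₗ.[ℂ] H}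

theorem norm_coe_sq_pos {D : Submodule ℂ H} {u : D} (hu : u ≠ 0) : 0 < ‖(u : H)‖ ^ 2 := by
  have : (u : H) ≠ 0 := by simpa using hu
  positivity

theorem rayleighQuotient_le (A : H →ₗ.[ℂ] H) {E : Submodule ℂ A.domain} {j : ℕ} {c : ℝ}
    (hj : j ≤ Module.finrank ℂ E) (hE : ∀ w ∈ E, quad A w ≤ c * ‖(w : H)‖ ^ 2) :
    rayleighQuotient A j ≤ c := by
  obtain ⟨u, hu⟩ := exists_linearIndependent_of_le_finrank hj
  refine iInf₂_le_of_le _ (hu.map' E.subtype E.ker_subtype) (iSup_le fun w => iSup₂_le ?_)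
  intro hw hw0
  have hwE : w ∈ E := Submodule.span_le.2 (by rintro _ ⟨i, rfl⟩; exact (u i).2) hw
  exact EReal.coe_le_coe_iff.2 ((div_le_iff₀ (norm_coe_sq_pos hw0)).2 (hE w hwE))

theorem le_rayleighQuotient {E : Submodule ℂ A.domain} [FiniteDimensional ℂ E] {j : ℕ} {c : ℝ}
    (hj : Module.finrank ℂ E < j) (hE : ∀ w ∈ Eᗮ, c * ‖(w : H)‖ ^ 2 ≤ quad A w) :
    c ≤ rayleighQuotient A j := by
  refine le_iInf₂ fun u hu => ?_
  have : FiniteDimensional ℂ (Submodule.span ℂ (Set.range u)) :=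
    FiniteDimensional.span_of_finite ℂ (Set.finite_range u)
  obtain ⟨w, hw, hw0, hwE⟩ := exists_mem_ne_zero_orthogonal (E := E)
    (W := Submodule.span ℂ (Set.range u)) (by rwa [finrank_span_eq_card hu, Fintype.card_fin])
  refine le_iSup_of_le w (le_iSup₂_of_le hw hw0 ?_)
  exact EReal.coe_le_coe_iff.2 ((le_div_iff₀ (norm_coe_sq_pos hw0)).2 (hE w hwE))

theorem norm_sum_smul_sq {N : ℕ} {D : Submodule ℂ H} {u : Fin N → D}
    (horth : ∀ i k, i ≠ k → inner ℂ (u i : H) (u k : H) = 0) (a : Fin N → ℂ) :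
    ‖((∑ i, a i • u i : D) : H)‖ ^ 2 = ∑ i, ‖a i‖ ^ 2 * ‖(u i : H)‖ ^ 2 := by
  rw [← re_inner_self, Submodule.coe_sum, sum_inner, Complex.re_sum]
  refine Finset.sum_congr rfl fun i _ => ?_
  rw [inner_sum, Finset.sum_eq_single_of_mem i (Finset.mem_univ i)]
  · rw [re_inner_self, Submodule.coe_smul, norm_smul, mul_pow]
  · intro k _ hk
    rw [Submodule.coe_smul, Submodule.coe_smul, inner_smul_left, inner_smul_right,
      horth i k hk.symm, mul_zero, mul_zero]

theorem quad_sum_smul {N : ℕ} {u : Fin N → A.domain}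
    (horth : ∀ i k, i ≠ k → inner ℂ (A (u i)) (u k : H) = 0) (a : Fin N → ℂ) :
    quad A (∑ i, a i • u i) = ∑ i, ‖a i‖ ^ 2 * quad A (u i) := by
  have hA : A (∑ i, a i • u i) = ∑ i, a i • A (u i) := by
    simp only [← LinearPMap.toFun_eq_coe, map_sum, map_smul]
  rw [quad, hA, Submodule.coe_sum, sum_inner, Complex.re_sum]
  refine Finset.sum_congr rfl fun i _ => ?_
  rw [inner_sum, Finset.sum_eq_single_of_mem i (Finset.mem_univ i)]
  · rw [Submodule.coe_smul, inner_smul_left, inner_smul_right, ← mul_assoc, Complex.conj_mul',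
      ← Complex.ofReal_pow, Complex.re_ofReal_mul, quad]
  · intro k _ hk
    rw [Submodule.coe_smul, inner_smul_left, inner_smul_right, horth i k hk.symm, mul_zero,
      mul_zero]

theorem rayleighQuotient_le_of_orthogonal {N : ℕ} {u : Fin N → A.domain} {c : ℝ}
    (hu : ∀ i, u i ≠ 0) (horth : ∀ i k, i ≠ k → inner ℂ (u i : H) (u k : H) = 0)
    (hAorth : ∀ i k, i ≠ k → inner ℂ (A (u i)) (u k : H) = 0)
    (hle : ∀ i, quad A (u i) ≤ c * ‖(u i : H)‖ ^ 2) : rayleighQuotient A N ≤ c := by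
  have hli : LinearIndependent ℂ u :=
    linearIndependent_of_ne_zero_of_inner_eq_zero hu fun i k hik => horth i k hik
  refine rayleighQuotient_le A (E := Submodule.span ℂ (Set.range u)) ?_ fun w hw => ?_
  · rw [finrank_span_eq_card hli, Fintype.card_fin]
  · obtain ⟨a, rfl⟩ := (Submodule.mem_span_range_iff_exists_fun ℂ).1 hw
    rw [quad_sum_smul hAorth, norm_sum_smul_sq horth, Finset.mul_sum]
    refine Finset.sum_le_sum fun i _ => ?_
    calc ‖a i‖ ^ 2 * quad A (u i) ≤ ‖a i‖ ^ 2 * (c * ‖(u i : H)‖ ^ 2) := by gcongr; exact hle i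
      _ = c * (‖a i‖ ^ 2 * ‖(u i : H)‖ ^ 2) := by ring

end MinMax

section LowSpace

variable {H : Type*} [NormedAddCommGroup H] [InnerProductSpace ℂ H] {A : H →ₗ.[ℂ] H} {b : ℝ}

/-- The algebraic span of the eigenspaces of `A` for the eigenvalues `< b`, standing in for the
range of the spectral projection on `(-∞, b)`. -/
def lowSpace (A : H →ₗ.[ℂ] H) (b : ℝ) : Submodule ℂ A.domain :=
  ⨆ r ∈ Set.Iio b, eigenspace A (r : ℂ)

theorem stable_lowSpace : Stable A (lowSpace A b) :=
  .iSup fun r => .iSup fun _ => stable_eigenspace (r : ℂ)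

theorem eigenspace_le_lowSpace {r : ℝ} (hr : r < b) : eigenspace A (r : ℂ) ≤ lowSpace A b :=
  le_biSup (fun r : ℝ => eigenspace A (r : ℂ)) hr

theorem nonempty_eigenvalues_lt (h : lowSpace A b ≠ ⊥) :
    {r : ℝ | eigenspace A (r : ℂ) ≠ ⊥ ∧ r < b}.Nonempty := by
  contrapose! h
  refine iSup₂_eq_bot.2 fun r hr => ?_
  by_contra hne
  exact h.subset ⟨hne, hr⟩

namespace IsNonnegSelfAdjoint

variable (hA : IsNonnegSelfAdjoint A)
include hA

theorem quad_le_of_mem_biSup_eigenspace {t : Finset ℝ} {ρ : ℝ} (ht : ∀ r ∈ t, r ≤ ρ)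
    {w : A.domain} (hw : w ∈ ⨆ r ∈ t, eigenspace A (r : ℂ)) :
    quad A w ≤ ρ * ‖(w : H)‖ ^ 2 := by
  obtain ⟨f, rfl⟩ := (Submodule.mem_iSup_finset_iff_exists_sum _ _).1 hw
  have hshift : shift A ρ (∑ r ∈ t, (f r : A.domain)) =
      ((∑ r ∈ t, (((r - ρ : ℝ) : ℂ) • f r : eigenspace A (r : ℂ)) : A.domain) : H) := by
    rw [map_sum, Submodule.coe_sum]
    refine Finset.sum_congr rfl fun r _ => ?_
    rw [shift_apply, mem_eigenspace.1 (f r).2, ← sub_smul, ← Complex.ofReal_sub]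
    rfl
  have hinner := hA.orthogonalFamily_eigenspace.inner_sum (fun r => ((r - ρ : ℝ) : ℂ) • f r) f t
  rw [← sub_nonpos, ← re_inner_shift_self, hshift]
  refine (congrArg Complex.re hinner).trans_le ?_
  rw [Complex.re_sum]
  refine Finset.sum_nonpos fun r hr => ?_
  refine (congrArg Complex.re (inner_smul_left (f r) (f r) _)).trans_le ?_
  rw [Complex.conj_ofReal, Complex.re_ofReal_mul]
  exact mul_nonpos_of_nonpos_of_nonneg (sub_nonpos.2 (ht r hr))
    (inner_self_nonneg (𝕜 := ℂ) (x := f r))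

theorem exists_lt_forall_quad_le {t : Finset ℝ} (ht : ∀ r ∈ t, r < b) :
    ∃ ρ < b, ∀ w ∈ ⨆ r ∈ t, eigenspace A (r : ℂ), quad A w ≤ ρ * ‖(w : H)‖ ^ 2 := by
  rcases t.eq_empty_or_nonempty with rfl | hne
  · exact ⟨b - 1, sub_one_lt b, fun w hw => hA.quad_le_of_mem_biSup_eigenspace (by simp) hw⟩
  · exact ⟨t.max' hne, ht _ (t.max'_mem hne), fun w hw =>
      hA.quad_le_of_mem_biSup_eigenspace (fun r hr => t.le_max' r hr) hw⟩

theorem quad_lt_of_mem_lowSpace {w : A.domain} (hw : w ∈ lowSpace A b) (hw0 : w ≠ 0) :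
    quad A w < b * ‖(w : H)‖ ^ 2 := by
  obtain ⟨t, ht, hwt⟩ := exists_finset_of_mem_biSup hw
  obtain ⟨ρ, hρ, hle⟩ := hA.exists_lt_forall_quad_le (b := b) ht
  exact (hle w hwt).trans_lt (mul_lt_mul_of_pos_right hρ (norm_coe_sq_pos hw0))

theorem finite_eigenvalues_lt [hfd : FiniteDimensional ℂ (lowSpace A b)] :
    {r : ℝ | eigenspace A (r : ℂ) ≠ ⊥ ∧ r < b}.Finite := by
  rw [lowSpace] at hfd
  exact finite_ne_bot_of_biSup hA.orthogonalFamily_eigenspace.independent (Set.Iio b)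

theorem finrank_lowSpace [hfd : FiniteDimensional ℂ (lowSpace A b)] :
    Module.finrank ℂ (lowSpace A b) =
      ∑ᶠ r ∈ {r : ℝ | eigenspace A (r : ℂ) ≠ ⊥ ∧ r < b},
        Module.finrank ℂ (eigenspace A (r : ℂ)) := by
  rw [lowSpace] at hfd
  exact finrank_biSup hA.orthogonalFamily_eigenspace.independent (Set.Iio b)

theorem exists_lt_forall_mem_lowSpace_quad_le [FiniteDimensional ℂ (lowSpace A b)] :
    ∃ ρ < b, ∀ w ∈ lowSpace A b, quad A w ≤ ρ * ‖(w : H)‖ ^ 2 := by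
  have hfin := hA.finite_eigenvalues_lt (b := b)
  have hlow : lowSpace A b = ⨆ r ∈ hfin.toFinset, eigenspace A (r : ℂ) := by
    simp only [Set.Finite.mem_toFinset]
    exact (biSup_ne_bot (fun r : ℝ => eigenspace A (r : ℂ)) (Set.Iio b)).symm
  rw [hlow]
  exact hA.exists_lt_forall_quad_le fun r hr => (hfin.mem_toFinset.1 hr).2

end IsNonnegSelfAdjoint

namespace BoundedBelowOn

variable {F : Submodule ℂ H} [FiniteDimensional ℂ F]

theorem finiteDimensional_lowSpace (hF : BoundedBelowOn A b F) (hA : IsNonnegSelfAdjoint A) :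
    FiniteDimensional ℂ (lowSpace A b) := by
  refine Module.Finite.of_fg ((cofg_comap_orthogonal A.domain F).fg_of_disjoint ?_)
  rw [Submodule.disjoint_def]
  intro u hu hu'
  by_contra h0
  exact (hF u hu').not_gt (hA.quad_lt_of_mem_lowSpace hu h0)

theorem le_quad_of_mem_orthogonal_lowSpace [CompleteSpace H] (hF : BoundedBelowOn A b F)
    (hA : IsNonnegSelfAdjoint A) {u : A.domain} (hu : u ∈ (lowSpace A b)ᗮ) :
    b * ‖(u : H)‖ ^ 2 ≤ quad A u := by
  have := hF.finiteDimensional_lowSpace hA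
  -- a best lower bound `< b` of the form on the complement would be improved by `exists_gap`
  set R : Set ℝ := {m | ∀ v ∈ (lowSpace A b)ᗮ, m * ‖(v : H)‖ ^ 2 ≤ quad A v}
  by_contra! hlt
  have hu0 : u ≠ 0 := by
    rintro rfl
    simp [quad] at hlt
  have hbdd : BddAbove R := ⟨quad A u / ‖(u : H)‖ ^ 2, fun m hm =>
    (le_div_iff₀ (norm_coe_sq_pos hu0)).2 (hm u hu)⟩
  have hne : R.Nonempty := ⟨0, fun v _ => by rw [zero_mul]; exact hA.nonneg v⟩
  have hsup : sSup R ∈ R := by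
    intro v hv
    rcases eq_or_ne v 0 with rfl | hv0
    · simp [quad]
    · exact (le_div_iff₀ (norm_coe_sq_pos hv0)).1 (csSup_le hne fun m hm =>
        (le_div_iff₀ (norm_coe_sq_pos hv0)).2 (hm v hv))
  have hsup_lt : sSup R < b :=
    lt_of_mul_lt_mul_right ((hsup u hu).trans_lt hlt) (sq_nonneg _)
  obtain ⟨c, hc, hle⟩ := exists_gap hA stable_lowSpace (eigenspace_le_lowSpace hsup_lt)
    (hF.isFredholmOn_shift hA hsup_lt).2.1 hsup
  linarith [le_csSup hbdd (show sSup R + c ∈ R from hle)]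

theorem countBelow_eq_finrank_lowSpace [CompleteSpace H] (hF : BoundedBelowOn A b F)
    (hA : IsNonnegSelfAdjoint A) : countBelow A b = Module.finrank ℂ (lowSpace A b) := by
  have := hF.finiteDimensional_lowSpace hA
  refine le_antisymm (iSup₂_le fun j hj => ?_) ?_
  · by_contra! hlt
    exact hj.2.not_ge (le_rayleighQuotient (by exact_mod_cast hlt)
      fun w => hF.le_quad_of_mem_orthogonal_lowSpace hA)
  · obtain ⟨ρ, hρ, hle⟩ := hA.exists_lt_forall_mem_lowSpace_quad_le (b := b)
    rcases Nat.eq_zero_or_pos (Module.finrank ℂ (lowSpace A b)) with h0 | h0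
    · exact h0 ▸ bot_le
    · exact le_iSup₂_of_le (Module.finrank ℂ (lowSpace A b))
        ⟨h0, (rayleighQuotient_le A le_rfl hle).trans_lt (EReal.coe_lt_coe_iff.2 hρ)⟩ le_rfl

theorem mem_essentialSpectrum [CompleteSpace H] (hF : BoundedBelowOn A b F)
    (hA : IsNonnegSelfAdjoint A) (hle : ∀ j, rayleighQuotient A j ≤ b) :
    b ∈ essentialSpectrum A := by
  intro hfred
  have := hF.finiteDimensional_lowSpace hA
  have : FiniteDimensional ℂ (eigenspace A (b : ℂ)) := hfred.1
  obtain ⟨c, hc, hgap⟩ := exists_gap hA (stable_lowSpace.sup (stable_eigenspace (b : ℂ)))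
    le_sup_right hfred.2.1 fun u hu =>
      hF.le_quad_of_mem_orthogonal_lowSpace hA (Submodule.orthogonal_le le_sup_left hu)
  have h := (le_rayleighQuotient (Nat.lt_succ_self _) hgap).trans (hle _)
  linarith [EReal.coe_le_coe_iff.1 h]

theorem eigenvaluesBelowEss_eq [CompleteSpace H] (hF : BoundedBelowOn A b F)
    (hA : IsNonnegSelfAdjoint A) (hb : b ∈ essentialSpectrum A) :
    eigenvaluesBelowEss A = {r : ℝ | eigenspace A (r : ℂ) ≠ ⊥ ∧ r < b} := by
  ext r
  refine ⟨fun h => ⟨h.1, h.2 b hb⟩, fun h => ⟨h.1, fun μ hμ => ?_⟩⟩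
  by_contra! hle
  exact hμ (hF.isFredholmOn_shift hA (hle.trans_lt h.2))

theorem lowSpace_ne_bot [CompleteSpace H] (hF : BoundedBelowOn A b F)
    (hA : IsNonnegSelfAdjoint A) {u : A.domain} (hu : quad A u < b * ‖(u : H)‖ ^ 2) :
    lowSpace A b ≠ ⊥ := by
  intro hbot
  refine hu.not_ge (hF.le_quad_of_mem_orthogonal_lowSpace hA ?_)
  rw [hbot, Submodule.bot_orthogonal_eq_top]
  exact Submodule.mem_top

end BoundedBelowOn

end LowSpace

/-! ### The form of the Dirichlet Laplacian -/

section Form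

variable {Ω : TopologicalSpace.Opens (ℝ × ℝ)} {φ ψ : ℝ × ℝ → ℂ}

/-- A test function as an element of `L²(Ω)`. -/
def IsTest.toL2 (hφ : IsTest Ω φ) : L2 Ω := (hφ.memLp 2).toLp φ

theorem IsTest.coeFn_toL2 (hφ : IsTest Ω φ) :
    hφ.toL2 =ᵐ[(volume : Measure (ℝ × ℝ)).restrict (Ω : Set (ℝ × ℝ))] φ :=
  MemLp.coeFn_toLp _

theorem tendstoL2_iff {φ : ℕ → ℝ × ℝ → ℂ} (hφ : ∀ n, IsTest Ω (φ n)) (u : L2 Ω) :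
    TendstoL2 φ u ↔ Tendsto (fun n => (hφ n).toL2) atTop (𝓝 u) := by
  rw [Lp.tendsto_Lp_iff_tendsto_eLpNorm', TendstoL2]
  refine tendsto_congr fun n => eLpNorm_congr_ae ?_
  filter_upwards [(hφ n).coeFn_toL2] with x hx
  simp [hx]

theorem IsTest.conj (hφ : IsTest Ω φ) : IsTest Ω (fun x => (starRingEnd ℂ) (φ x)) where
  smooth := Complex.conjCLE.contDiff.comp hφ.smooth
  compact := hφ.compact.comp_left (g := fun z : ℂ => (starRingEnd ℂ) z) (map_zero _)
  support := (tsupport_comp_subset (g := fun z : ℂ => (starRingEnd ℂ) z) (map_zero _) φ).trans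
    hφ.support

theorem dirDeriv_conj (hφ : IsTest Ω φ) (v : ℝ × ℝ) :
    dirDeriv v (fun x => (starRingEnd ℂ) (φ x)) = fun x => (starRingEnd ℂ) (dirDeriv v φ x) := by
  funext x
  have h := (Complex.conjCLE.toContinuousLinearMap.hasFDerivAt (x := φ x)).comp x
    (hφ.smooth.differentiable (by simp) x).hasFDerivAt
  have h' : HasFDerivAt (fun x => (starRingEnd ℂ) (φ x))
    (Complex.conjCLE.toContinuousLinearMap.comp (fderiv ℝ φ x)) x := h
  rw [dirDeriv, h'.fderiv]
  rfl

theorem laplacian_conj (hφ : IsTest Ω φ) :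
    laplacian (fun x => (starRingEnd ℂ) (φ x)) = fun x => (starRingEnd ℂ) (laplacian φ x) := by
  funext x
  simp only [laplacian, dirDeriv_conj hφ, dirDeriv_conj (hφ.dirDeriv _), map_add]

theorem integral_mul_eq_inner (hφ : IsTest Ω φ) (u : L2 Ω) :
    ∫ x in (Ω : Set (ℝ × ℝ)), u x * (starRingEnd ℂ) (φ x) = inner ℂ hφ.toL2 u := by
  rw [L2.inner_def]
  refine integral_congr_ae ?_
  filter_upwards [hφ.coeFn_toL2] with x hx
  rw [hx, RCLike.inner_apply]

theorem hasWeakDeriv_iff {v : ℝ × ℝ} {u g : L2 Ω} :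
    HasWeakDeriv v u g ↔ ∀ φ, ∀ hφ : IsTest Ω φ,
      inner ℂ (hφ.dirDeriv v).toL2 u = -inner ℂ hφ.toL2 g := by
  constructor
  · intro h φ hφ
    have := h _ hφ.conj
    rw [dirDeriv_conj hφ, integral_mul_eq_inner (hφ.dirDeriv v), integral_mul_eq_inner hφ] at this
    exact this
  · intro h φ hφ
    have := h _ hφ.conj
    rw [← integral_mul_eq_inner, ← integral_mul_eq_inner, dirDeriv_conj hφ] at this
    simpa using this

theorem hasWeakLaplacian_iff {u f : L2 Ω} :
    HasWeakLaplacian u f ↔ ∀ φ, ∀ hφ : IsTest Ω φ,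
      inner ℂ hφ.laplacian.toL2 u = inner ℂ hφ.toL2 f := by
  constructor
  · intro h φ hφ
    have := h _ hφ.conj
    rw [laplacian_conj hφ, integral_mul_eq_inner hφ.laplacian, integral_mul_eq_inner hφ] at this
    exact this
  · intro h φ hφ
    have := h _ hφ.conj
    rw [← integral_mul_eq_inner, ← integral_mul_eq_inner, laplacian_conj hφ] at this
    simpa using this

theorem IsTest.toL2_laplacian (hφ : IsTest Ω φ) :
    hφ.laplacian.toL2 = ((hφ.dirDeriv (1, 0)).dirDeriv (1, 0)).toL2 +
      ((hφ.dirDeriv (0, 1)).dirDeriv (0, 1)).toL2 :=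
  MemLp.toLp_add _ _

theorem IsTest.eq_zero_of_notMem (hφ : IsTest Ω φ) {x : ℝ × ℝ} (hx : x ∉ (Ω : Set (ℝ × ℝ))) :
    φ x = 0 := image_eq_zero_of_notMem_tsupport fun h => hx (hφ.support h)

theorem IsTest.integrable_mul_test (hφ : IsTest Ω φ) (hψ : IsTest Ω ψ) :
    Integrable (fun x => φ x * ψ x) :=
  (hφ.smooth.continuous.mul hψ.smooth.continuous).integrable_of_hasCompactSupport
    hφ.compact.mul_right

theorem IsTest.inner_toL2 (hφ : IsTest Ω φ) (hψ : IsTest Ω ψ) :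
    inner ℂ hφ.toL2 hψ.toL2 = ∫ x, ψ x * (starRingEnd ℂ) (φ x) := by
  rw [← integral_mul_eq_inner hφ, ← setIntegral_eq_integral_of_forall_compl_eq_zero
    (s := (Ω : Set (ℝ × ℝ))) (f := fun x => ψ x * (starRingEnd ℂ) (φ x))
    (fun x hx => by rw [hψ.eq_zero_of_notMem hx, zero_mul])]
  refine integral_congr_ae ?_
  filter_upwards [hψ.coeFn_toL2] with x hx
  rw [hx]

theorem IsTest.norm_toL2_sq (hφ : IsTest Ω φ) : ‖hφ.toL2‖ ^ 2 = ∫ x, ‖φ x‖ ^ 2 := by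
  rw [← re_inner_self, hφ.inner_toL2 hφ, ← Complex.ofReal_re (∫ x, ‖φ x‖ ^ 2),
    ← integral_complex_ofReal]
  simp only [Complex.mul_conj, Complex.normSq_eq_norm_sq]

theorem IsTest.inner_toL2_eq_zero (hφ : IsTest Ω φ) (hψ : IsTest Ω ψ)
    (h : ∀ x, φ x = 0 ∨ ψ x = 0) : inner ℂ hφ.toL2 hψ.toL2 = 0 := by
  rw [hφ.inner_toL2 hψ]
  refine integral_eq_zero_of_ae (ae_of_all _ fun x => ?_)
  rcases h x with h | h <;> simp [h]

theorem IsTest.inner_dirDeriv (hφ : IsTest Ω φ) (hψ : IsTest Ω ψ) (v : ℝ × ℝ) :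
    inner ℂ (hψ.dirDeriv v).toL2 hφ.toL2 = -inner ℂ hψ.toL2 (hφ.dirDeriv v).toL2 := by
  rw [(hψ.dirDeriv v).inner_toL2 hφ, hψ.inner_toL2 (hφ.dirDeriv v)]
  have hconj (x : ℝ × ℝ) : (starRingEnd ℂ) (Waveguide.dirDeriv v ψ x) =
      fderiv ℝ (fun x => (starRingEnd ℂ) (ψ x)) x v := (congrFun (dirDeriv_conj hψ v) x).symm
  simp only [hconj]
  exact integral_mul_fderiv_eq_neg_fderiv_mul_of_integrable
    ((hφ.dirDeriv v).integrable_mul_test hψ.conj) (hφ.integrable_mul_test (hψ.conj.dirDeriv v))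
    (hφ.integrable_mul_test hψ.conj)
    (fun x _ => hφ.smooth.differentiable (by simp) x)
    (fun x _ => hψ.conj.smooth.differentiable (by simp) x)

/-- `(g₁, g₂)` is the gradient of the element `u` of `H¹₀(Ω)`. -/
def IsGrad (u g₁ g₂ : L2 Ω) : Prop :=
  ∃ φ : ℕ → ℝ × ℝ → ℂ, ∃ hφ : ∀ n, IsTest Ω (φ n),
    Tendsto (fun n => (hφ n).toL2) atTop (𝓝 u) ∧
    Tendsto (fun n => ((hφ n).dirDeriv (1, 0)).toL2) atTop (𝓝 g₁) ∧
    Tendsto (fun n => ((hφ n).dirDeriv (0, 1)).toL2) atTop (𝓝 g₂)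

theorem hasWeakDeriv_of_tendsto {v : ℝ × ℝ} {u g : L2 Ω} {φ : ℕ → ℝ × ℝ → ℂ}
    (hφ : ∀ n, IsTest Ω (φ n)) (hu : Tendsto (fun n => (hφ n).toL2) atTop (𝓝 u))
    (hg : Tendsto (fun n => ((hφ n).dirDeriv v).toL2) atTop (𝓝 g)) : HasWeakDeriv v u g := by
  rw [hasWeakDeriv_iff]
  intro ψ hψ
  refine tendsto_nhds_unique (tendsto_const_nhds.inner hu) ?_
  refine (tendsto_const_nhds.inner hg).neg.congr fun n => ?_
  rw [(hφ n).inner_dirDeriv hψ]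

theorem IsGrad.hasWeakDeriv {u g₁ g₂ : L2 Ω} (h : IsGrad u g₁ g₂) :
    HasWeakDeriv (1, 0) u g₁ ∧ HasWeakDeriv (0, 1) u g₂ := by
  obtain ⟨φ, hφ, h0, h1, h2⟩ := h
  exact ⟨hasWeakDeriv_of_tendsto hφ h0 h1, hasWeakDeriv_of_tendsto hφ h0 h2⟩

theorem memH10_iff {u : L2 Ω} : MemH10 u ↔ ∃ g₁ g₂, IsGrad u g₁ g₂ := by
  constructor
  · rintro ⟨g₁, g₂, -, -, φ, hφ, h0, h1, h2⟩
    exact ⟨g₁, g₂, φ, hφ, (tendstoL2_iff hφ _).1 h0,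
      (tendstoL2_iff (fun n => (hφ n).dirDeriv _) _).1 h1,
      (tendstoL2_iff (fun n => (hφ n).dirDeriv _) _).1 h2⟩
  · rintro ⟨g₁, g₂, h⟩
    obtain ⟨φ, hφ, h0, h1, h2⟩ := id h
    exact ⟨g₁, g₂, h.hasWeakDeriv.1, h.hasWeakDeriv.2, φ, hφ, (tendstoL2_iff hφ _).2 h0,
      (tendstoL2_iff (fun n => (hφ n).dirDeriv _) _).2 h1,
      (tendstoL2_iff (fun n => (hφ n).dirDeriv _) _).2 h2⟩

theorem IsGrad.inner_laplacian {u g₁ g₂ : L2 Ω} (h : IsGrad u g₁ g₂) (hψ : IsTest Ω ψ) :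
    inner ℂ hψ.laplacian.toL2 u = -(inner ℂ (hψ.dirDeriv (1, 0)).toL2 g₁ +
      inner ℂ (hψ.dirDeriv (0, 1)).toL2 g₂) := by
  rw [hψ.toL2_laplacian, inner_add_left, hasWeakDeriv_iff.1 h.hasWeakDeriv.1 _ (hψ.dirDeriv _),
    hasWeakDeriv_iff.1 h.hasWeakDeriv.2 _ (hψ.dirDeriv _)]
  ring

theorem hasWeakLaplacian_neg (u : (dirichletLaplacian Ω).domain) :
    HasWeakLaplacian (u : L2 Ω) (-(dirichletLaplacian Ω u)) := by
  have : dirichletLaplacian Ω u = -u.2.2.choose := rfl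
  rw [this, neg_neg]
  exact u.2.2.choose_spec

theorem apply_eq_of_hasWeakLaplacian {u : (dirichletLaplacian Ω).domain} {f : L2 Ω}
    (h : HasWeakLaplacian (u : L2 Ω) f) : dirichletLaplacian Ω u = -f := by
  rw [h.unique (hasWeakLaplacian_neg u), neg_neg]

theorem IsGrad.inner_apply {u : (dirichletLaplacian Ω).domain} {v g₁ g₂ h₁ h₂ : L2 Ω}
    (hu : IsGrad (u : L2 Ω) g₁ g₂) (hv : IsGrad v h₁ h₂) :
    inner ℂ v (dirichletLaplacian Ω u) = inner ℂ h₁ g₁ + inner ℂ h₂ g₂ := by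
  obtain ⟨φ, hφ, h0, h1, h2⟩ := hv
  refine tendsto_nhds_unique (h0.inner tendsto_const_nhds) ?_
  refine ((h1.inner tendsto_const_nhds).add (h2.inner tendsto_const_nhds)).congr fun n => ?_
  have h3 := hasWeakLaplacian_iff.1 (hasWeakLaplacian_neg u) _ (hφ n)
  rw [hu.inner_laplacian (hφ n), inner_neg_right, neg_inj] at h3
  exact h3

theorem IsGrad.quad_eq {u : (dirichletLaplacian Ω).domain} {g₁ g₂ : L2 Ω}
    (hu : IsGrad (u : L2 Ω) g₁ g₂) :
    quad (dirichletLaplacian Ω) u = ‖g₁‖ ^ 2 + ‖g₂‖ ^ 2 := by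
  rw [quad, ← inner_conj_symm, Complex.conj_re, hu.inner_apply hu, Complex.add_re, re_inner_self,
    re_inner_self]

theorem exists_isGrad (u : (dirichletLaplacian Ω).domain) :
    ∃ g₁ g₂, IsGrad (u : L2 Ω) g₁ g₂ := memH10_iff.1 u.2.1

theorem IsTest.toL2_congr (hφ : IsTest Ω φ) (hψ : IsTest Ω ψ) (h : φ = ψ) :
    hφ.toL2 = hψ.toL2 := by
  subst h
  rfl

/-- The vector `(φ, ∂₁ φ, ∂₂ φ)`, in the Hilbert space which carries the graph of the gradient. -/
def IsTest.jet (hφ : IsTest Ω φ) : PiLp 2 fun _ : Fin 3 => L2 Ω :=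
  WithLp.toLp 2 ![hφ.toL2, (hφ.dirDeriv (1, 0)).toL2, (hφ.dirDeriv (0, 1)).toL2]

theorem IsTest.jet_add (hφ : IsTest Ω φ) (hψ : IsTest Ω ψ) :
    (hφ.add hψ).jet = hφ.jet + hψ.jet := by
  have hd (v : ℝ × ℝ) : ((hφ.add hψ).dirDeriv v).toL2 =
      (hφ.dirDeriv v).toL2 + (hψ.dirDeriv v).toL2 :=
    (IsTest.toL2_congr _ ((hφ.dirDeriv v).add (hψ.dirDeriv v)) (dirDeriv_add hφ hψ v)).trans
      (MemLp.toLp_add _ _)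
  ext1 i
  fin_cases i
  exacts [MemLp.toLp_add (hφ.memLp 2) (hψ.memLp 2), hd _, hd _]

theorem IsTest.jet_const_mul (hφ : IsTest Ω φ) (c : ℂ) : (hφ.const_mul c).jet = c • hφ.jet := by
  have hd (v : ℝ × ℝ) : ((hφ.const_mul c).dirDeriv v).toL2 = c • (hφ.dirDeriv v).toL2 :=
    (IsTest.toL2_congr _ ((hφ.dirDeriv v).const_mul c) (dirDeriv_const_mul hφ c v)).trans
      (MemLp.toLp_const_smul c _)
  ext1 i
  fin_cases i
  exacts [MemLp.toLp_const_smul c (hφ.memLp 2), hd _, hd _]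

/-- The graph of the gradient on the test functions. -/
def testGraph (Ω : TopologicalSpace.Opens (ℝ × ℝ)) :
    Submodule ℂ (PiLp 2 fun _ : Fin 3 => L2 Ω) where
  carrier := {p | ∃ φ, ∃ hφ : IsTest Ω φ, hφ.jet = p}
  add_mem' := by
    rintro _ _ ⟨φ, hφ, rfl⟩ ⟨ψ, hψ, rfl⟩
    exact ⟨_, hφ.add hψ, hφ.jet_add hψ⟩
  zero_mem' := ⟨_, IsTest.zero.const_mul 0, by rw [IsTest.zero.jet_const_mul, zero_smul]⟩
  smul_mem' := by
    rintro c _ ⟨φ, hφ, rfl⟩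
    exact ⟨_, hφ.const_mul c, hφ.jet_const_mul c⟩

theorem isGrad_of_mem_closure {p : PiLp 2 fun _ : Fin 3 => L2 Ω}
    (hp : p ∈ (testGraph Ω).topologicalClosure) : IsGrad (p 0) (p 1) (p 2) := by
  obtain ⟨q, hq, hqp⟩ := mem_closure_iff_seq_limit.1 hp
  choose φ hφ hφq using hq
  have hcoord (i : Fin 3) : Tendsto (fun n => (hφ n).jet i) atTop (𝓝 (p i)) :=
    ((PiLp.continuous_apply 2 (fun _ : Fin 3 => L2 Ω) i).tendsto p).comp (by simpa only [hφq])
  exact ⟨φ, hφ, hcoord 0, hcoord 1, hcoord 2⟩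

-- The projection `(u, ∂₁ u, ∂₂ u)` of `(f, 0, 0)` onto the closed graph solves `-Δ u + u = f`:
-- its residual is orthogonal to `(ψ, ∂₁ ψ, ∂₂ ψ)` for every test function `ψ`.
theorem exists_isGrad_hasWeakLaplacian (f : L2 Ω) :
    ∃ u g₁ g₂ : L2 Ω, IsGrad u g₁ g₂ ∧ HasWeakLaplacian u (u - f) := by
  set V := (testGraph Ω).topologicalClosure
  have : CompleteSpace V := (Submodule.isClosed_topologicalClosure _).completeSpace_coe
  set p := V.starProjection (WithLp.toLp 2 ![f, 0, 0]) with hp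
  have hgrad : IsGrad (p 0) (p 1) (p 2) := isGrad_of_mem_closure (V.starProjection_apply_mem _)
  refine ⟨p 0, p 1, p 2, hgrad, hasWeakLaplacian_iff.2 fun ψ hψ => ?_⟩
  have horth := V.starProjection_inner_eq_zero (WithLp.toLp 2 ![f, 0, 0]) hψ.jet
    (Submodule.le_topologicalClosure _ ⟨ψ, hψ, rfl⟩)
  rw [inner_eq_zero_symm, ← hp, PiLp.inner_apply, Fin.sum_univ_three] at horth
  change inner ℂ hψ.toL2 (f - p 0) + inner ℂ (hψ.dirDeriv (1, 0)).toL2 (0 - p 1) +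
    inner ℂ (hψ.dirDeriv (0, 1)).toL2 (0 - p 2) = 0 at horth
  rw [hgrad.inner_laplacian hψ]
  simp only [inner_sub_right, inner_zero_right] at horth ⊢
  linear_combination horth

theorem dirichletLaplacian_surj (f : L2 Ω) :
    ∃ u : (dirichletLaplacian Ω).domain, dirichletLaplacian Ω u + (u : L2 Ω) = f := by
  obtain ⟨u, g₁, g₂, hgrad, hlap⟩ := exists_isGrad_hasWeakLaplacian f
  let w : (dirichletLaplacian Ω).domain := ⟨u, memH10_iff.2 ⟨g₁, g₂, hgrad⟩, u - f, hlap⟩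
  exact ⟨w, by rw [apply_eq_of_hasWeakLaplacian (u := w) hlap, neg_sub, sub_add_cancel]⟩

theorem isNonnegSelfAdjoint_dirichletLaplacian (Ω : TopologicalSpace.Opens (ℝ × ℝ)) :
    IsNonnegSelfAdjoint (dirichletLaplacian Ω) where
  symm := fun u v => by
    obtain ⟨g₁, g₂, hu⟩ := exists_isGrad u
    obtain ⟨h₁, h₂, hv⟩ := exists_isGrad v
    rw [hv.inner_apply hu, ← inner_conj_symm, hu.inner_apply hv, map_add, inner_conj_symm,
      inner_conj_symm]
  surj := dirichletLaplacian_surj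
  nonneg := fun u => by
    obtain ⟨g₁, g₂, hu⟩ := exists_isGrad u
    exact (by positivity : 0 ≤ ‖g₁‖ ^ 2 + ‖g₂‖ ^ 2).trans_eq hu.quad_eq.symm

theorem boundedBelowOn_of_test {ι : Type*} [Fintype ι] {b : ℝ} (f : ι → L2 Ω)
    (h : ∀ φ, ∀ hφ : IsTest Ω φ, b * ‖hφ.toL2‖ ^ 2 ≤ ‖(hφ.dirDeriv (1, 0)).toL2‖ ^ 2 +
      ‖(hφ.dirDeriv (0, 1)).toL2‖ ^ 2 + ∑ i, ‖inner ℂ (f i) hφ.toL2‖ ^ 2) :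
    BoundedBelowOn (dirichletLaplacian Ω) b (Submodule.span ℂ (Set.range f)) := by
  intro u hu
  obtain ⟨g₁, g₂, hg⟩ := exists_isGrad u
  obtain ⟨φ, hφ, h0, h1, h2⟩ := id hg
  have hlim := le_of_tendsto_of_tendsto' ((h0.norm.pow 2).const_mul b)
    (((h1.norm.pow 2).add (h2.norm.pow 2)).add (tendsto_finsetSum Finset.univ fun i _ =>
      ((tendsto_const_nhds (x := f i)).inner (𝕜 := ℂ) h0).norm.pow 2)) (fun n => h _ (hφ n))
  have hz (i : ι) : inner ℂ (f i) (u : L2 Ω) = 0 :=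
    (Submodule.mem_orthogonal _ _).1 hu _ (Submodule.subset_span ⟨i, rfl⟩)
  rw [hg.quad_eq]
  simpa [hz] using hlim

theorem IsTest.isGrad (hφ : IsTest Ω φ) :
    IsGrad hφ.toL2 (hφ.dirDeriv (1, 0)).toL2 (hφ.dirDeriv (0, 1)).toL2 :=
  ⟨fun _ => φ, fun _ => hφ, tendsto_const_nhds, tendsto_const_nhds, tendsto_const_nhds⟩

theorem IsTest.hasWeakLaplacian (hφ : IsTest Ω φ) :
    HasWeakLaplacian hφ.toL2 hφ.laplacian.toL2 := by
  rw [hasWeakLaplacian_iff]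
  intro ψ hψ
  rw [hφ.isGrad.inner_laplacian hψ, hφ.toL2_laplacian, inner_add_right,
    (hφ.dirDeriv _).inner_dirDeriv hψ, (hφ.dirDeriv _).inner_dirDeriv hψ]
  ring

/-- A test function as an element of the domain of the Dirichlet Laplacian. -/
def IsTest.toDomain (hφ : IsTest Ω φ) : (dirichletLaplacian Ω).domain :=
  ⟨hφ.toL2, memH10_iff.2 ⟨_, _, hφ.isGrad⟩, _, hφ.hasWeakLaplacian⟩

theorem IsTest.quad_toDomain (hφ : IsTest Ω φ) :
    quad (dirichletLaplacian Ω) hφ.toDomain =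
      ‖(hφ.dirDeriv (1, 0)).toL2‖ ^ 2 + ‖(hφ.dirDeriv (0, 1)).toL2‖ ^ 2 :=
  IsGrad.quad_eq (u := hφ.toDomain) hφ.isGrad

theorem IsTest.apply_toDomain (hφ : IsTest Ω φ) :
    dirichletLaplacian Ω hφ.toDomain = -hφ.laplacian.toL2 :=
  apply_eq_of_hasWeakLaplacian (u := hφ.toDomain) hφ.hasWeakLaplacian

end Form

/-! ### Poincaré's inequality on convex sets -/

section Poincare

open Module (finrank)

variable {α E F : Type*} [MeasurableSpace α]
  [NormedAddCommGroup E] [NormedSpace ℝ E] [NormedAddCommGroup F]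

theorem enorm_integral_sq_le_lintegral [NormedSpace ℝ F] (μ : Measure α) [IsProbabilityMeasure μ]
    {f : α → F} (hf : AEStronglyMeasurable f μ) :
    ‖∫ x, f x ∂μ‖ₑ ^ 2 ≤ ∫⁻ x, ‖f x‖ₑ ^ 2 ∂μ := by
  have hmono : eLpNorm f 1 μ ≤ eLpNorm f 2 μ := eLpNorm_le_eLpNorm_of_exponent_le one_le_two hf
  have hsq := eLpNorm_nnreal_pow_eq_lintegral (f := f) (μ := μ) (p := 2) two_ne_zero
  simp only [NNReal.coe_ofNat, ENNReal.coe_ofNat, ENNReal.rpow_ofNat] at hsq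
  rw [← hsq]
  refine pow_le_pow_left' ((enorm_integral_le_lintegral_enorm f).trans ?_) 2
  rwa [← eLpNorm_one_eq_lintegral_enorm]

theorem enorm_sub_sq_le_lintegral_fderiv [NormedSpace ℝ F] [CompleteSpace F] {φ : E → F}
    (hφ : ContDiff ℝ 1 φ) (x y : E) :
    ‖φ x - φ y‖ₑ ^ 2 ≤
      edist x y ^ 2 * ∫⁻ τ in Set.Ioc (0 : ℝ) 1, ‖fderiv ℝ φ (x + τ • (y - x))‖ₑ ^ 2 := by
  have hline (τ : ℝ) : HasDerivAt (fun τ : ℝ => x + τ • (y - x)) (y - x) τ := by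
    simpa using ((hasDerivAt_id τ).smul_const (y - x)).const_add x
  have hderiv (τ : ℝ) : HasDerivAt (fun τ : ℝ => φ (x + τ • (y - x)))
      (fderiv ℝ φ (x + τ • (y - x)) (y - x)) τ :=
    (hφ.differentiable one_ne_zero _).hasFDerivAt.comp_hasDerivAt τ (hline τ)
  have hcont : Continuous fun τ : ℝ => fderiv ℝ φ (x + τ • (y - x)) (y - x) :=
    ((hφ.continuous_fderiv one_ne_zero).comp (by fun_prop)).clm_apply continuous_const
  have hftc := intervalIntegral.integral_eq_sub_of_hasDerivAt (a := 0) (b := 1)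
    (fun τ _ => hderiv τ) (hcont.intervalIntegrable _ _)
  simp only [intervalIntegral.integral_of_le zero_le_one, one_smul, zero_smul, add_zero,
    add_sub_cancel] at hftc
  have : IsProbabilityMeasure (volume.restrict (Set.Ioc (0 : ℝ) 1)) := ⟨by simp⟩
  calc ‖φ x - φ y‖ₑ ^ 2
      = ‖∫ τ in Set.Ioc (0 : ℝ) 1, fderiv ℝ φ (x + τ • (y - x)) (y - x)‖ₑ ^ 2 := by
        rw [hftc, ← edist_eq_enorm_sub, ← edist_eq_enorm_sub, edist_comm]
    _ ≤ ∫⁻ τ in Set.Ioc (0 : ℝ) 1, ‖fderiv ℝ φ (x + τ • (y - x)) (y - x)‖ₑ ^ 2 :=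
        enorm_integral_sq_le_lintegral _ hcont.aestronglyMeasurable
    _ ≤ ∫⁻ τ in Set.Ioc (0 : ℝ) 1,
          edist x y ^ 2 * ‖fderiv ℝ φ (x + τ • (y - x))‖ₑ ^ 2 := by
        refine lintegral_mono fun τ => ?_
        rw [edist_comm, edist_eq_enorm_sub, ← mul_pow, mul_comm]
        exact pow_le_pow_left' (ContinuousLinearMap.le_opENorm _ _) 2
    _ = _ := lintegral_const_mul' _ _ (by finiteness)

section Convex

variable [FiniteDimensional ℝ E] [MeasurableSpace E] [BorelSpace E] (μ : Measure E)
  [μ.IsAddHaarMeasure] {Q : Set E}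

theorem setLIntegral_comp_homothety_le (hQ : Convex ℝ Q) (hQm : MeasurableSet Q) (G : E → ℝ≥0∞)
    {x : E} (hx : x ∈ Q) {τ : ℝ} (hτ : 1 / 2 ≤ τ) (hτ1 : τ ≤ 1) :
    ∫⁻ y in Q, G (x + τ • (y - x)) ∂μ ≤ 2 ^ finrank ℝ E * ∫⁻ z in Q, G z ∂μ := by
  have hτ0 : 0 < τ := by linarith
  have hder (y : E) (_ : y ∈ Q) : HasFDerivWithinAt (fun y => x + τ • (y - x))
      (τ • ContinuousLinearMap.id ℝ E) Q y :=
    (((hasFDerivAt_id y).sub_const x).const_smul τ |>.const_add x).hasFDerivWithinAt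
  have hinj : Set.InjOn (fun y => x + τ • (y - x)) Q := fun y _ z _ h =>
    sub_left_injective (smul_right_injective _ hτ0.ne' (add_left_cancel h))
  have hdet : (τ • ContinuousLinearMap.id ℝ E).det = τ ^ finrank ℝ E := by
    rw [ContinuousLinearMap.det, ContinuousLinearMap.toLinearMap_smul, LinearMap.det_smul,
      ContinuousLinearMap.coe_id, LinearMap.det_id, mul_one]
  have hsub : (fun y => x + τ • (y - x)) '' Q ⊆ Q := by
    rintro _ ⟨y, hy, rfl⟩
    exact hQ.add_smul_sub_mem hx hy ⟨hτ0.le, hτ1⟩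
  have hone : (1 : ℝ≥0∞) ≤ 2 ^ finrank ℝ E * ENNReal.ofReal |τ ^ finrank ℝ E| := by
    rw [abs_of_pos (by positivity), ENNReal.ofReal_pow hτ0.le, ← mul_pow]
    refine one_le_pow_of_one_le' ?_ _
    rw [← ENNReal.ofReal_ofNat, ← ENNReal.ofReal_mul zero_le_two, ENNReal.one_le_ofReal]
    linarith
  calc ∫⁻ y in Q, G (x + τ • (y - x)) ∂μ
      ≤ ∫⁻ y in Q, 2 ^ finrank ℝ E *
          (ENNReal.ofReal |τ ^ finrank ℝ E| * G (x + τ • (y - x))) ∂μ := by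
        refine lintegral_mono fun y => ?_
        rw [← mul_assoc]
        exact le_mul_of_one_le_left bot_le hone
    _ = 2 ^ finrank ℝ E * ∫⁻ z in (fun y => x + τ • (y - x)) '' Q, G z ∂μ := by
        rw [lintegral_const_mul' _ _ (by finiteness),
          lintegral_image_eq_lintegral_abs_det_fderiv_mul μ hQm hder hinj G, hdet]
    _ ≤ 2 ^ finrank ℝ E * ∫⁻ z in Q, G z ∂μ := by gcongr

-- Swapping `x` and `y` exchanges `τ` and `1 - τ`, so that one may assume `1 / 2 ≤ τ`.
theorem setLIntegral_setLIntegral_comp_segment_le (hQ : Convex ℝ Q) (hQm : MeasurableSet Q)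
    {G : E → ℝ≥0∞} (hG : Measurable G) {τ : ℝ} (hτ : τ ∈ Set.Icc (0 : ℝ) 1) :
    ∫⁻ x in Q, ∫⁻ y in Q, G (x + τ • (y - x)) ∂μ ∂μ ≤
      2 ^ finrank ℝ E * μ Q * ∫⁻ z in Q, G z ∂μ := by
  have hhalf (τ : ℝ) (h0 : 1 / 2 ≤ τ) (h1 : τ ≤ 1) :
      ∫⁻ x in Q, ∫⁻ y in Q, G (x + τ • (y - x)) ∂μ ∂μ ≤
        2 ^ finrank ℝ E * μ Q * ∫⁻ z in Q, G z ∂μ :=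
    calc ∫⁻ x in Q, ∫⁻ y in Q, G (x + τ • (y - x)) ∂μ ∂μ
        ≤ ∫⁻ _ in Q, 2 ^ finrank ℝ E * ∫⁻ z in Q, G z ∂μ ∂μ :=
          setLIntegral_mono measurable_const fun x hx =>
            setLIntegral_comp_homothety_le μ hQ hQm G hx h0 h1
      _ = 2 ^ finrank ℝ E * μ Q * ∫⁻ z in Q, G z ∂μ := by
          rw [setLIntegral_const, mul_right_comm]
  rcases le_total (1 / 2) τ with h | h
  · exact hhalf τ h hτ.2
  · have hGxy : Measurable fun p : E × E => G (p.1 + τ • (p.2 - p.1)) := hG.comp (by fun_prop)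
    rw [lintegral_lintegral_swap hGxy.aemeasurable]
    have hswap (x y : E) : y + τ • (x - y) = x + (1 - τ) • (y - x) := by module
    simp only [hswap]
    exact hhalf (1 - τ) (by linarith) (by linarith [hτ.1])

theorem setLIntegral_setLIntegral_enorm_sub_sq_le [NormedSpace ℝ F] [CompleteSpace F] {φ : E → F}
    (hφ : ContDiff ℝ 1 φ) (hQ : Convex ℝ Q) (hQm : MeasurableSet Q) :
    ∫⁻ x in Q, ∫⁻ y in Q, ‖φ x - φ y‖ₑ ^ 2 ∂μ ∂μ ≤
      Metric.ediam Q ^ 2 * (2 ^ finrank ℝ E * μ Q * ∫⁻ z in Q, ‖fderiv ℝ φ z‖ₑ ^ 2 ∂μ) := by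
  set G : E → ℝ≥0∞ := fun z => Metric.ediam Q ^ 2 * ‖fderiv ℝ φ z‖ₑ ^ 2
  have hfderiv : Measurable fun z => ‖fderiv ℝ φ z‖ₑ ^ 2 :=
    (hφ.continuous_fderiv one_ne_zero).enorm.measurable.pow_const 2
  have hG : Measurable G := hfderiv.const_mul _
  have hGxτy : Measurable fun p : (E × ℝ) × E => G (p.1.1 + p.1.2 • (p.2 - p.1.1)) :=
    hG.comp (by fun_prop)
  have hGτy (x : E) : Measurable fun p : E × ℝ => G (x + p.2 • (p.1 - x)) :=
    hG.comp (by fun_prop)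
  calc ∫⁻ x in Q, ∫⁻ y in Q, ‖φ x - φ y‖ₑ ^ 2 ∂μ ∂μ
      ≤ ∫⁻ x in Q, ∫⁻ y in Q, (∫⁻ τ in Set.Ioc (0 : ℝ) 1, G (x + τ • (y - x))) ∂μ ∂μ := by
        refine setLIntegral_mono' hQm fun x hx => setLIntegral_mono' hQm fun y hy => ?_
        have hsegment : Measurable fun τ : ℝ => ‖fderiv ℝ φ (x + τ • (y - x))‖ₑ ^ 2 :=
          hfderiv.comp (by fun_prop)
        refine (enorm_sub_sq_le_lintegral_fderiv hφ x y).trans ?_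
        refine le_of_le_of_eq ?_ (lintegral_const_mul _ hsegment).symm
        gcongr
        exact Metric.edist_le_ediam_of_mem hx hy
    _ = ∫⁻ x in Q, (∫⁻ τ in Set.Ioc (0 : ℝ) 1, ∫⁻ y in Q, G (x + τ • (y - x)) ∂μ) ∂μ :=
        lintegral_congr fun x => lintegral_lintegral_swap (hGτy x).aemeasurable
    _ = ∫⁻ τ in Set.Ioc (0 : ℝ) 1, ∫⁻ x in Q, ∫⁻ y in Q, G (x + τ • (y - x)) ∂μ ∂μ :=
        lintegral_lintegral_swap hGxτy.lintegral_prod_right'.aemeasurable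
    _ ≤ ∫⁻ _ in Set.Ioc (0 : ℝ) 1, 2 ^ finrank ℝ E * μ Q * ∫⁻ z in Q, G z ∂μ :=
        setLIntegral_mono measurable_const fun τ hτ =>
          setLIntegral_setLIntegral_comp_segment_le μ hQ hQm hG ⟨hτ.1.le, hτ.2⟩
    _ = Metric.ediam Q ^ 2 * (2 ^ finrank ℝ E * μ Q * ∫⁻ z in Q, ‖fderiv ℝ φ z‖ₑ ^ 2 ∂μ) := by
        rw [setLIntegral_const, Real.volume_Ioc, sub_zero, ENNReal.ofReal_one, mul_one,
          lintegral_const_mul _ hfderiv, mul_left_comm]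

end Convex

section InnerProduct

variable [InnerProductSpace ℝ F] [CompleteSpace F]

theorem integral_integral_norm_sub_sq (μ : Measure α) [IsFiniteMeasure μ] {f : α → F}
    (hf : MemLp f 2 μ) :
    ∫ x, ∫ y, ‖f x - f y‖ ^ 2 ∂μ ∂μ =
      2 * (μ.real Set.univ * ∫ x, ‖f x‖ ^ 2 ∂μ - ‖∫ x, f x ∂μ‖ ^ 2) := by
  have hint : Integrable f μ := hf.integrable one_le_two
  have hsq : Integrable (fun x => ‖f x‖ ^ 2) μ := hf.integrable_norm_pow two_ne_zero
  have hcross (v : F) : Integrable (fun y => 2 * inner ℝ v (f y)) μ :=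
    (hint.const_inner v).const_mul 2
  have hinner (x : α) : ∫ y, ‖f x - f y‖ ^ 2 ∂μ = μ.real Set.univ * ‖f x‖ ^ 2 -
      2 * inner ℝ (∫ y, f y ∂μ) (f x) + ∫ y, ‖f y‖ ^ 2 ∂μ := by
    have hsub : Integrable (fun y => ‖f x‖ ^ 2 - 2 * inner ℝ (f x) (f y)) μ :=
      (integrable_const _).sub (hcross _)
    simp only [norm_sub_sq_real]
    rw [integral_add hsub hsq, integral_sub (integrable_const _) (hcross _), integral_const,
      integral_const_mul, integral_inner hint, real_inner_comm, smul_eq_mul]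
  have hsub : Integrable (fun x => μ.real Set.univ * ‖f x‖ ^ 2 -
      2 * inner ℝ (∫ y, f y ∂μ) (f x)) μ := (hsq.const_mul _).sub (hcross _)
  simp only [hinner]
  rw [integral_add hsub (integrable_const _), integral_sub (hsq.const_mul _) (hcross _),
    integral_const, integral_const_mul, integral_const_mul, integral_inner hint,
    real_inner_self_eq_norm_sq, smul_eq_mul]
  ring

theorem poincare_convex [FiniteDimensional ℝ E] [MeasurableSpace E] [BorelSpace E]
    (μ : Measure E) [μ.IsAddHaarMeasure] {φ : E → F} (hφ : ContDiff ℝ 1 φ) {Q : Set E}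
    (hQ : Convex ℝ Q) (hQm : MeasurableSet Q) (hQb : Bornology.IsBounded Q) :
    2 * (μ.real Q * ∫ x in Q, ‖φ x‖ ^ 2 ∂μ - ‖∫ x in Q, φ x ∂μ‖ ^ 2) ≤
      Metric.diam Q ^ 2 * (2 ^ finrank ℝ E * μ.real Q * ∫ x in Q, ‖fderiv ℝ φ x‖ ^ 2 ∂μ) := by
  have hfin : μ Q < ⊤ := hQb.measure_lt_top
  have : IsFiniteMeasure (μ.restrict Q) := ⟨by rwa [Measure.restrict_apply_univ]⟩
  have hmemLp : MemLp φ 2 (μ.restrict Q) := by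
    have hcont := hφ.continuous.continuousOn (s := closure Q)
    obtain ⟨C, hC⟩ := hQb.isCompact_closure.exists_bound_of_continuousOn hcont
    exact .of_bound ((hcont.mono subset_closure).aestronglyMeasurable hQm) C
      ((ae_restrict_iff' hQm).2 (ae_of_all _ fun x hx => hC x (subset_closure hx)))
  have hfderiv : IntegrableOn (fun x => ‖fderiv ℝ φ x‖ ^ 2) Q μ :=
    (((hφ.continuous_fderiv one_ne_zero).norm.pow 2).continuousOn.integrableOn_compact
      hQb.isCompact_closure).mono_set subset_closure
  have hlintegral : ∫⁻ x in Q, ‖fderiv ℝ φ x‖ₑ ^ 2 ∂μ =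
      ENNReal.ofReal (∫ x in Q, ‖fderiv ℝ φ x‖ ^ 2 ∂μ) := by
    rw [ofReal_integral_eq_lintegral_ofReal hfderiv (ae_of_all _ fun x => sq_nonneg _)]
    simp only [ENNReal.ofReal_pow (norm_nonneg _), ofReal_norm]
  have henorm : ENNReal.ofReal (∫ x in Q, ∫ y in Q, ‖φ x - φ y‖ ^ 2 ∂μ ∂μ) ≤
      ∫⁻ x in Q, ∫⁻ y in Q, ‖φ x - φ y‖ₑ ^ 2 ∂μ ∂μ := by
    refine (Real.ofReal_le_enorm _).trans ((enorm_integral_le_lintegral_enorm _).trans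
      (lintegral_mono fun x => (enorm_integral_le_lintegral_enorm _).trans_eq ?_))
    simp only [enorm_pow, enorm_norm]
  have hle := henorm.trans (setLIntegral_setLIntegral_enorm_sub_sq_le μ hφ hQ hQm)
  rw [hlintegral,
    ← ENNReal.ofReal_toReal (hQb.ediam_ne_top : Metric.ediam Q ≠ ⊤)] at hle
  have hreal := (ENNReal.ofReal_le_iff_le_toReal (by finiteness)).1 hle
  rw [integral_integral_norm_sub_sq _ hmemLp, measureReal_restrict_apply_univ] at hreal
  have hnonneg : 0 ≤ ∫ x in Q, ‖fderiv ℝ φ x‖ ^ 2 ∂μ := integral_nonneg fun x => sq_nonneg _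
  simpa [Metric.diam, measureReal_def, ENNReal.toReal_ofReal hnonneg] using hreal

end InnerProduct

section Plane

variable {φ : ℝ × ℝ → ℂ}

/-- The squared length of the gradient. -/
def gradSq (φ : ℝ × ℝ → ℂ) (x : ℝ × ℝ) : ℝ :=
  ‖dirDeriv (1, 0) φ x‖ ^ 2 + ‖dirDeriv (0, 1) φ x‖ ^ 2

theorem gradSq_nonneg (φ : ℝ × ℝ → ℂ) (x : ℝ × ℝ) : 0 ≤ gradSq φ x :=
  add_nonneg (sq_nonneg _) (sq_nonneg _)

theorem continuous_gradSq (hφ : ContDiff ℝ 1 φ) : Continuous (gradSq φ) := by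
  have hdir (v : ℝ × ℝ) : Continuous (dirDeriv v φ) :=
    (hφ.continuous_fderiv one_ne_zero).clm_apply continuous_const
  exact ((hdir _).norm.pow 2).add ((hdir _).norm.pow 2)

theorem hasCompactSupport_gradSq (hφ : HasCompactSupport φ) : HasCompactSupport (gradSq φ) := by
  have hdir (v : ℝ × ℝ) : HasCompactSupport fun x => ‖dirDeriv v φ x‖ ^ 2 :=
    (hφ.fderiv_apply ℝ v).comp_left (g := fun z : ℂ => ‖z‖ ^ 2) (by simp)
  exact (hdir _).add (hdir _)

theorem norm_sq_fderiv_le (φ : ℝ × ℝ → ℂ) (x v : ℝ × ℝ) :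
    ‖fderiv ℝ φ x v‖ ^ 2 ≤ (v.1 ^ 2 + v.2 ^ 2) * gradSq φ x := by
  have hv : v = v.1 • ((1, 0) : ℝ × ℝ) + v.2 • ((0, 1) : ℝ × ℝ) := by ext <;> simp
  have hle : ‖fderiv ℝ φ x v‖ ≤ |v.1| * ‖dirDeriv (1, 0) φ x‖ + |v.2| * ‖dirDeriv (0, 1) φ x‖ := by
    conv_lhs => rw [hv, map_add, map_smul, map_smul]
    refine (norm_add_le _ _).trans_eq ?_
    rw [norm_smul, norm_smul]
    rfl
  refine (pow_le_pow_left₀ (norm_nonneg _) hle 2).trans ?_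
  rw [gradSq, ← sq_abs v.1, ← sq_abs v.2]
  nlinarith [sq_nonneg (|v.1| * ‖dirDeriv (0, 1) φ x‖ - |v.2| * ‖dirDeriv (1, 0) φ x‖)]

theorem norm_fderiv_sq_le (φ : ℝ × ℝ → ℂ) (x : ℝ × ℝ) :
    ‖fderiv ℝ φ x‖ ^ 2 ≤ 2 * gradSq φ x := by
  have hgradSq := gradSq_nonneg φ x
  rw [← Real.le_sqrt (norm_nonneg _) (by positivity)]
  refine ContinuousLinearMap.opNorm_le_bound _ (Real.sqrt_nonneg _) fun v => ?_
  rw [← Real.sqrt_sq (norm_nonneg v), ← Real.sqrt_mul (by positivity)]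
  refine Real.le_sqrt_of_sq_le ((norm_sq_fderiv_le φ x v).trans ?_)
  have hfst : v.1 ^ 2 ≤ ‖v‖ ^ 2 := by
    rw [← sq_abs]
    exact pow_le_pow_left₀ (abs_nonneg _) (norm_fst_le v) 2
  have hsnd : v.2 ^ 2 ≤ ‖v‖ ^ 2 := by
    rw [← sq_abs]
    exact pow_le_pow_left₀ (abs_nonneg _) (norm_snd_le v) 2
  nlinarith

theorem setIntegral_norm_sq_le_gradSq_add (hφ : ContDiff ℝ 1 φ) {Q : Set (ℝ × ℝ)}
    (hQ : Convex ℝ Q) (hQm : MeasurableSet Q) (hQb : Bornology.IsBounded Q)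
    (hd : Metric.diam Q ≤ 1 / 2) :
    ∫ x in Q, ‖φ x‖ ^ 2 ≤
      (∫ x in Q, gradSq φ x) + (volume.real Q)⁻¹ * ‖∫ x in Q, φ x‖ ^ 2 := by
  rcases eq_or_ne (volume Q) 0 with h0 | h0
  · simp [Measure.restrict_eq_zero.2 h0]
  have hV : 0 < volume.real Q := ENNReal.toReal_pos h0 hQb.measure_lt_top.ne
  have hcompact := hQb.isCompact_closure
  have hintegrable {f : ℝ × ℝ → ℝ} (hf : Continuous f) : IntegrableOn f Q :=
    (hf.continuousOn.integrableOn_compact hcompact).mono_set subset_closure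
  have hfderiv : ∫ x in Q, ‖fderiv ℝ φ x‖ ^ 2 ≤ 2 * ∫ x in Q, gradSq φ x := by
    rw [← integral_const_mul]
    exact integral_mono (hintegrable ((hφ.continuous_fderiv one_ne_zero).norm.pow 2))
      ((hintegrable (continuous_gradSq hφ)).const_mul 2) (norm_fderiv_sq_le φ)
  have hpoincare := calc
    2 * (volume.real Q * (∫ x in Q, ‖φ x‖ ^ 2) - ‖∫ x in Q, φ x‖ ^ 2)
      ≤ Metric.diam Q ^ 2 *
          (2 ^ finrank ℝ (ℝ × ℝ) * volume.real Q * ∫ x in Q, ‖fderiv ℝ φ x‖ ^ 2) :=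
        poincare_convex volume hφ hQ hQm hQb
    _ ≤ (1 / 2) ^ 2 * (2 ^ 2 * volume.real Q * (2 * ∫ x in Q, gradSq φ x)) := by
        rw [Module.finrank_prod, Module.finrank_self]
        gcongr
  refine le_of_mul_le_mul_left ?_ hV
  rw [mul_add, mul_inv_cancel_left₀ hV.ne']
  linarith

end Plane

end Poincare

section Grid

/-- The cell with index `p` of the square grid of mesh `1 / 2`. -/
def gridCell (p : ℤ × ℤ) : Set (ℝ × ℝ) :=
  {x | ⌊2 * x.1⌋ = p.1 ∧ ⌊2 * x.2⌋ = p.2}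

theorem gridCell_eq_prod (p : ℤ × ℤ) : gridCell p =
    Set.Ico ((p.1 : ℝ) / 2) ((p.1 + 1) / 2) ×ˢ Set.Ico ((p.2 : ℝ) / 2) ((p.2 + 1) / 2) := by
  ext x
  simp only [gridCell, Set.mem_ofPred_eq, Set.mem_prod, Set.mem_Ico, Int.floor_eq_iff,
    div_le_iff₀ (zero_lt_two' ℝ), lt_div_iff₀ (zero_lt_two' ℝ), mul_comm (2 : ℝ)]

theorem convex_gridCell (p : ℤ × ℤ) : Convex ℝ (gridCell p) := by
  rw [gridCell_eq_prod]
  exact (convex_Ico _ _).prod (convex_Ico _ _)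

theorem measurableSet_gridCell (p : ℤ × ℤ) : MeasurableSet (gridCell p) := by
  rw [gridCell_eq_prod]
  exact measurableSet_Ico.prod measurableSet_Ico

theorem pairwise_disjoint_gridCell : Pairwise (Function.onFun Disjoint gridCell) :=
  fun _ _ hpq => Set.disjoint_left.2 fun _ hp hq =>
    hpq (Prod.ext (hp.1.symm.trans hq.1) (hp.2.symm.trans hq.2))

theorem diam_gridCell_le (p : ℤ × ℤ) : Metric.diam (gridCell p) ≤ 1 / 2 := by
  refine Metric.diam_le_of_forall_dist_le (by norm_num) fun x hx y hy => ?_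
  have hlt {k : ℤ} {a b : ℝ} (ha : ⌊2 * a⌋ = k) (hb : ⌊2 * b⌋ = k) : |a - b| ≤ 1 / 2 := by
    rw [Int.floor_eq_iff] at ha hb
    exact abs_le.2 ⟨by linarith, by linarith⟩
  exact max_le (hlt hx.1 hy.1) (hlt hx.2 hy.2)

theorem isBounded_gridCell (p : ℤ × ℤ) : Bornology.IsBounded (gridCell p) := by
  rw [gridCell_eq_prod]
  exact (Metric.isBounded_Ico _ _).prod (Metric.isBounded_Ico _ _)

theorem exists_eq_biUnion_inter_gridCell {K : Set (ℝ × ℝ)} (hK : Bornology.IsBounded K) :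
    ∃ I : Finset (ℤ × ℤ), K = ⋃ p ∈ I, K ∩ gridCell p := by
  obtain ⟨B, hB⟩ := hK.exists_norm_le
  have hfloor {a : ℝ} (ha : |a| ≤ B) : ⌊2 * a⌋ ∈ Finset.Icc ⌊-(2 * B)⌋ ⌊2 * B⌋ := by
    obtain ⟨hl, hr⟩ := abs_le.1 ha
    exact Finset.mem_Icc.2 ⟨Int.floor_le_floor (by linarith), Int.floor_le_floor (by linarith)⟩
  refine ⟨Finset.Icc ⌊-(2 * B)⌋ ⌊2 * B⌋ ×ˢ Finset.Icc ⌊-(2 * B)⌋ ⌊2 * B⌋, Set.Subset.antisymm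
    (fun x hx => Set.mem_iUnion₂.2 ⟨(⌊2 * x.1⌋, ⌊2 * x.2⌋), Finset.mem_product.2 ⟨?_, ?_⟩,
      hx, rfl, rfl⟩) (Set.iUnion₂_subset fun p _ => Set.inter_subset_left)⟩
  · exact hfloor ((norm_fst_le x).trans (hB x hx))
  · exact hfloor ((norm_snd_le x).trans (hB x hx))

variable {Ω : TopologicalSpace.Opens (ℝ × ℝ)} {φ : ℝ × ℝ → ℂ}

theorem IsTest.integrable_norm_sq (hφ : IsTest Ω φ) : Integrable fun x => ‖φ x‖ ^ 2 :=
  (hφ.smooth.continuous.memLp_of_hasCompactSupport hφ.compact (p := 2)).integrable_norm_pow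
    two_ne_zero

theorem IsTest.integrable_gradSq (hφ : IsTest Ω φ) : Integrable (gradSq φ) :=
  (continuous_gradSq (hφ.smooth.of_le (mod_cast le_top))).integrable_of_hasCompactSupport
    (hasCompactSupport_gradSq hφ.compact)

theorem IsTest.integral_gradSq (hφ : IsTest Ω φ) :
    ∫ x, gradSq φ x = ‖(hφ.dirDeriv (1, 0)).toL2‖ ^ 2 + ‖(hφ.dirDeriv (0, 1)).toL2‖ ^ 2 := by
  rw [(hφ.dirDeriv _).norm_toL2_sq, (hφ.dirDeriv _).norm_toL2_sq,
    ← integral_add (hφ.dirDeriv _).integrable_norm_sq (hφ.dirDeriv _).integrable_norm_sq]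
  rfl

theorem setIntegral_norm_sq_le_gradSq_add_sum_gridCell (hφ : IsTest Ω φ) {K : Set (ℝ × ℝ)}
    (hK : Convex ℝ K) (hKm : MeasurableSet K) {I : Finset (ℤ × ℤ)}
    (hI : K = ⋃ p ∈ I, K ∩ gridCell p) :
    ∫ x in K, ‖φ x‖ ^ 2 ≤ (∫ x in K, gradSq φ x) +
      ∑ p ∈ I, (volume.real (K ∩ gridCell p))⁻¹ * ‖∫ x in K ∩ gridCell p, φ x‖ ^ 2 := by
  have hmeas (p : ℤ × ℤ) : MeasurableSet (K ∩ gridCell p) := hKm.inter (measurableSet_gridCell p)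
  have hsplit {f : ℝ × ℝ → ℝ} (hf : Integrable f) :
      ∫ x in K, f x = ∑ p ∈ I, ∫ x in K ∩ gridCell p, f x := by
    conv_lhs => rw [hI]
    exact integral_biUnion_finset I (fun p _ => hmeas p)
      (fun p _ q _ hpq => (pairwise_disjoint_gridCell hpq).mono Set.inter_subset_right
        Set.inter_subset_right) fun p _ => hf.integrableOn
  rw [hsplit hφ.integrable_norm_sq, hsplit hφ.integrable_gradSq, ← Finset.sum_add_distrib]
  refine Finset.sum_le_sum fun p _ => setIntegral_norm_sq_le_gradSq_add
    (hφ.smooth.of_le (mod_cast le_top)) (hK.inter (convex_gridCell p)) (hmeas p)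
    ((isBounded_gridCell p).subset Set.inter_subset_right) ?_
  exact (Metric.diam_mono Set.inter_subset_right (isBounded_gridCell p)).trans (diam_gridCell_le p)

end Grid

section Wirtinger

open Real

variable {F : Type*} [NormedAddCommGroup F] [InnerProductSpace ℝ F] {ψ ψ' : ℝ → F}

theorem continuousAt_cos_div_sin_mul_norm_sq {ψ' : F} {a : ℝ} (hψ : HasDerivAt ψ ψ' a)
    (ha : ψ a = 0) (hsin : sin a = 0) :
    ContinuousAt (fun t => cos t / sin t * ‖ψ t‖ ^ 2) a := by
  have hcos : cos a ≠ 0 := fun hcos => by simpa [hsin, hcos] using sin_sq_add_cos_sq a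
  have hψsin : ψ =O[𝓝 a] sin := by
    have hsub : (fun t => t - a) =O[𝓝 a] fun t => sin t - sin a := by
      simpa [prod_pure, Function.comp_def] using
        ((hasDerivAt_sin a).isTheta_sub hcos).isBigO_symm.comp_tendsto prod_pure.ge
    simpa [ha, hsin] using hψ.isBigO_sub.trans hsub
  have hO : (fun t => cos t / sin t * ‖ψ t‖ ^ 2) =O[𝓝 a] fun t => cos t / sin t * sin t ^ 2 :=
    (Asymptotics.isBigO_refl _ _).mul (hψsin.norm_left.pow 2)
  have hcancel (t : ℝ) : cos t / sin t * sin t ^ 2 = cos t * sin t := by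
    rcases eq_or_ne (sin t) 0 with h | h
    · simp [h]
    · field_simp
  simp only [hcancel] at hO
  have htendsto : Tendsto (fun t => cos t * sin t) (𝓝 a) (𝓝 0) := by
    simpa [hsin] using ((continuous_cos.tendsto a).mul (continuous_sin.tendsto a))
  simpa [ContinuousAt, ha] using hO.trans_tendsto htendsto

-- Expand `0 ≤ ‖ψ' - cot t • ψ‖ ^ 2` and integrate: the cross term is the derivative of
-- `cot t * ‖ψ‖ ^ 2` plus `(1 + cot t ^ 2) * ‖ψ‖ ^ 2`.
theorem wirtinger (hψ : ∀ t, HasDerivAt ψ (ψ' t) t) (hψ' : Continuous ψ')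
    (h0 : ψ 0 = 0) (hπ : ψ π = 0) :
    ∫ t in Set.Ioo 0 π, ‖ψ t‖ ^ 2 ≤ ∫ t in Set.Ioo 0 π, ‖ψ' t‖ ^ 2 := by
  set g : ℝ → ℝ := fun t => cos t / sin t * ‖ψ t‖ ^ 2
  have hder (t : ℝ) (ht : t ∈ Set.Ioo 0 π) :
      HasDerivAt g ((-sin t * sin t - cos t * cos t) / sin t ^ 2 * ‖ψ t‖ ^ 2 +
        cos t / sin t * (2 * inner ℝ (ψ t) (ψ' t))) t :=
    ((hasDerivAt_cos t).div (hasDerivAt_sin t) (sin_pos_of_mem_Ioo ht).ne').mul (hψ t).norm_sq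
  have hcont : ContinuousOn g (Set.Icc 0 π) := by
    rintro t ht
    rcases eq_or_lt_of_le ht.1 with rfl | ht0
    · exact (continuousAt_cos_div_sin_mul_norm_sq (hψ 0) h0 sin_zero).continuousWithinAt
    rcases eq_or_lt_of_le ht.2 with rfl | htπ
    · exact (continuousAt_cos_div_sin_mul_norm_sq (hψ _) hπ sin_pi).continuousWithinAt
    · exact (hder t ⟨ht0, htπ⟩).continuousAt.continuousWithinAt
  have hint' : IntegrableOn (fun t => ‖ψ' t‖ ^ 2) (Set.Icc 0 π) :=
    (hψ'.norm.pow 2).integrableOn_Icc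
  have hint : IntegrableOn (fun t => ‖ψ t‖ ^ 2) (Set.Icc 0 π) :=
    ((continuous_iff_continuousAt.2 fun t => (hψ t).continuousAt).norm.pow 2).integrableOn_Icc
  have hle (t : ℝ) (ht : t ∈ Set.Ioo 0 π) :
      (-sin t * sin t - cos t * cos t) / sin t ^ 2 * ‖ψ t‖ ^ 2 +
        cos t / sin t * (2 * inner ℝ (ψ t) (ψ' t)) ≤ ‖ψ' t‖ ^ 2 - ‖ψ t‖ ^ 2 := by
    have hsin := (sin_pos_of_mem_Ioo ht).ne'
    have hcot : (-sin t * sin t - cos t * cos t) / sin t ^ 2 = -1 - (cos t / sin t) ^ 2 := by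
      field_simp
    have hexpand := norm_sub_sq_real (ψ' t) ((cos t / sin t) • ψ t)
    rw [inner_smul_right, norm_smul, mul_pow, norm_eq_abs, sq_abs, real_inner_comm] at hexpand
    rw [hcot]
    nlinarith [sq_nonneg ‖ψ' t - (cos t / sin t) • ψ t‖]
  have hmain := intervalIntegral.sub_le_integral_of_hasDeriv_right_of_le pi_pos.le hcont
    (fun t ht => (hder t ht).hasDerivWithinAt) (hint'.sub hint) hle
  rw [intervalIntegral.integral_of_le pi_pos.le, ← integral_Icc_eq_integral_Ioc,
    integral_sub' hint' hint, integral_Icc_eq_integral_Ioo, integral_Icc_eq_integral_Ioo] at hmain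
  simp only [g, h0, hπ, norm_zero, ne_eq, OfNat.ofNat_ne_zero, not_false_eq_true, zero_pow,
    mul_zero, sub_zero] at hmain
  exact sub_nonneg.1 hmain

end Wirtinger

/-! ### Lower bound for the form on the guide -/

section Guide

variable {θ : ℝ}

theorem cos_pos_of_mem (hθ : θ ∈ Set.Ioo 0 (Real.pi / 2)) : 0 < Real.cos θ :=
  Real.cos_pos_of_mem_Ioo ⟨by linarith [hθ.1, Real.pi_pos], hθ.2⟩

theorem sin_pos_of_mem (hθ : θ ∈ Set.Ioo 0 (Real.pi / 2)) : 0 < Real.sin θ :=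
  Real.sin_pos_of_mem_Ioo ⟨hθ.1, by linarith [hθ.2, Real.pi_pos]⟩

/-- The distance to the inner boundary line, in the arms. -/
def transverse (θ : ℝ) (x : ℝ × ℝ) : ℝ := |x.2| * Real.cos θ - x.1 * Real.sin θ

theorem mem_brokenGuide_iff (hθ : θ ∈ Set.Ioo 0 (Real.pi / 2)) {x : ℝ × ℝ} :
    x ∈ (brokenGuide θ : Set (ℝ × ℝ)) ↔ 0 < transverse θ x ∧ transverse θ x < Real.pi := by
  have hc := cos_pos_of_mem hθ
  have hs := sin_pos_of_mem hθ
  have hinner : x.1 * Real.tan θ < |x.2| ↔ 0 < transverse θ x := by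
    rw [Real.tan_eq_sin_div_cos, ← mul_div_assoc, div_lt_iff₀ hc, transverse, sub_pos]
  have houter : |x.2| < (x.1 + Real.pi / Real.sin θ) * Real.tan θ ↔ transverse θ x < Real.pi := by
    have htan : (x.1 + Real.pi / Real.sin θ) * Real.tan θ =
        (x.1 * Real.sin θ + Real.pi) / Real.cos θ := by
      rw [Real.tan_eq_sin_div_cos]
      field_simp
    rw [htan, lt_div_iff₀ hc, transverse, sub_lt_iff_lt_add']
  exact and_congr hinner houter

/-- Orthonormal coordinates along (`σ = 1`: upper, `σ = -1`: lower) an arm of the guide. -/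
def armEquiv (θ σ : ℝ) (hσ : σ ^ 2 = 1) : (ℝ × ℝ) ≃ₗ[ℝ] (ℝ × ℝ) where
  toFun p := (p.1 * Real.cos θ - p.2 * Real.sin θ, σ * (p.1 * Real.sin θ + p.2 * Real.cos θ))
  invFun x := (x.1 * Real.cos θ + σ * x.2 * Real.sin θ, σ * x.2 * Real.cos θ - x.1 * Real.sin θ)
  map_add' p q := by ext <;> simp <;> ring
  map_smul' a p := by ext <;> simp <;> ring
  left_inv p := by
    have h := Real.sin_sq_add_cos_sq θ
    ext <;> simp only []
    · linear_combination p.1 * h + Real.sin θ * (p.1 * Real.sin θ + p.2 * Real.cos θ) * hσ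
    · linear_combination p.2 * h + Real.cos θ * (p.1 * Real.sin θ + p.2 * Real.cos θ) * hσ
  right_inv x := by
    have h := Real.sin_sq_add_cos_sq θ
    ext <;> simp only []
    · linear_combination x.1 * h
    · linear_combination σ ^ 2 * x.2 * h + x.2 * hσ

section ArmEquiv

variable (θ) {σ : ℝ} (hσ : σ ^ 2 = 1)

theorem armEquiv_apply (p : ℝ × ℝ) : armEquiv θ σ hσ p =
    (p.1 * Real.cos θ - p.2 * Real.sin θ, σ * (p.1 * Real.sin θ + p.2 * Real.cos θ)) := rfl

theorem armEquiv_fst_sq_add_snd_sq (p : ℝ × ℝ) :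
    (armEquiv θ σ hσ p).1 ^ 2 + (armEquiv θ σ hσ p).2 ^ 2 = p.1 ^ 2 + p.2 ^ 2 := by
  rw [armEquiv_apply]
  linear_combination (p.1 ^ 2 + p.2 ^ 2) * Real.sin_sq_add_cos_sq θ +
    (p.1 * Real.sin θ + p.2 * Real.cos θ) ^ 2 * hσ

theorem det_armEquiv : LinearMap.det (armEquiv θ σ hσ : (ℝ × ℝ) →ₗ[ℝ] (ℝ × ℝ)) = σ := by
  rw [← LinearMap.det_toMatrix (Module.Basis.finTwoProd ℝ), Matrix.det_fin_two]
  simp only [LinearMap.toMatrix_apply, LinearEquiv.coe_coe, armEquiv_apply,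
    Module.Basis.finTwoProd_zero, Module.Basis.finTwoProd_one, Module.Basis.coe_finTwoProd_repr]
  simp only [Matrix.cons_val_zero, Matrix.cons_val_one]
  linear_combination σ * Real.sin_sq_add_cos_sq θ

theorem measurePreserving_armEquiv : MeasurePreserving (armEquiv θ σ hσ) := by
  have hσ1 : |σ| = 1 := (abs_pow_eq_one σ two_ne_zero).1 (by rw [hσ, abs_one])
  refine ⟨(armEquiv θ σ hσ).toContinuousLinearEquiv.continuous.measurable, ?_⟩
  have hmap := Measure.map_linearMap_addHaar_eq_smul_addHaar (volume : Measure (ℝ × ℝ))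
    (f := (armEquiv θ σ hσ : (ℝ × ℝ) →ₗ[ℝ] (ℝ × ℝ)))
    (by rw [det_armEquiv]; exact fun h => by simp [h] at hσ)
  rw [abs_inv, det_armEquiv, hσ1] at hmap
  simpa using hmap

theorem measurableEmbedding_armEquiv : MeasurableEmbedding (armEquiv θ σ hσ) :=
  (armEquiv θ σ hσ).toContinuousLinearEquiv.toHomeomorph.measurableEmbedding

theorem transverse_armEquiv (hθ : θ ∈ Set.Ioo 0 (Real.pi / 2)) {s t : ℝ} (hs : 0 ≤ s)
    (ht : 0 ≤ t) : transverse θ (armEquiv θ σ hσ (s, t)) = t := by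
  have hσ1 : |σ| = 1 := (abs_pow_eq_one σ two_ne_zero).1 (by rw [hσ, abs_one])
  rw [armEquiv_apply, transverse, abs_mul, hσ1, one_mul, abs_of_nonneg (add_nonneg
    (mul_nonneg hs (sin_pos_of_mem hθ).le) (mul_nonneg ht (cos_pos_of_mem hθ).le))]
  linear_combination t * Real.sin_sq_add_cos_sq θ

end ArmEquiv

/-- The half-strip which forms an arm of the guide. -/
def arm (θ σ : ℝ) : Set (ℝ × ℝ) :=
  {x | 0 ≤ x.1 * Real.cos θ + σ * x.2 * Real.sin θ ∧
    σ * x.2 * Real.cos θ - x.1 * Real.sin θ ∈ Set.Ioo 0 Real.pi}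

theorem armEquiv_preimage_arm (θ : ℝ) {σ : ℝ} (hσ : σ ^ 2 = 1) :
    armEquiv θ σ hσ ⁻¹' arm θ σ = Set.Ici 0 ×ˢ Set.Ioo 0 Real.pi := by
  have harm : arm θ σ = (armEquiv θ σ hσ).symm ⁻¹' Set.Ici 0 ×ˢ Set.Ioo 0 Real.pi := rfl
  exact harm ▸ (armEquiv θ σ hσ).toEquiv.preimage_symm_preimage _

theorem measurableSet_arm (θ σ : ℝ) : MeasurableSet (arm θ σ) := by
  unfold arm
  measurability

variable {φ : ℝ × ℝ → ℂ}

theorem setIntegral_norm_sq_armEquiv_le (hθ : θ ∈ Set.Ioo 0 (Real.pi / 2))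
    (hφ : IsTest (brokenGuide θ) φ) {σ : ℝ} (hσ : σ ^ 2 = 1) {s : ℝ} (hs : 0 ≤ s) :
    ∫ t in Set.Ioo 0 Real.pi, ‖φ (armEquiv θ σ hσ (s, t))‖ ^ 2 ≤
      ∫ t in Set.Ioo 0 Real.pi, gradSq φ (armEquiv θ σ hσ (s, t)) := by
  set L := (armEquiv θ σ hσ).toContinuousLinearEquiv
  have hφ1 : ContDiff ℝ 1 φ := hφ.smooth.of_le (mod_cast le_top)
  have hline : Continuous fun t : ℝ => L (s, t) := L.continuous.comp (by fun_prop)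
  have hderiv (t : ℝ) :
      HasDerivAt (fun t => φ (L (s, t))) (fderiv ℝ φ (L (s, t)) (L (0, 1))) t :=
    (hφ1.differentiable one_ne_zero _).hasFDerivAt.comp_hasDerivAt t
      ((L : (ℝ × ℝ) →L[ℝ] (ℝ × ℝ)).hasFDerivAt.comp_hasDerivAt t
        ((hasDerivAt_const t s).prodMk (hasDerivAt_id t)))
  have hderiv_cont : Continuous fun t => fderiv ℝ φ (L (s, t)) (L (0, 1)) :=
    ((hφ1.continuous_fderiv one_ne_zero).comp hline).clm_apply continuous_const
  have hzero {t : ℝ} (ht : 0 ≤ t) (hnot : ¬(0 < t ∧ t < Real.pi)) : φ (L (s, t)) = 0 := by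
    refine hφ.eq_zero_of_notMem fun hmem => hnot ?_
    rw [← transverse_armEquiv θ hσ hθ hs ht]
    exact (mem_brokenGuide_iff hθ).1 hmem
  have hle (t : ℝ) : ‖fderiv ℝ φ (L (s, t)) (L (0, 1))‖ ^ 2 ≤ gradSq φ (L (s, t)) := by
    have hunit : (L (0, 1)).1 ^ 2 + (L (0, 1)).2 ^ 2 = 1 :=
      (armEquiv_fst_sq_add_snd_sq θ hσ (0, 1)).trans (by norm_num)
    simpa only [hunit, one_mul] using norm_sq_fderiv_le φ (L (s, t)) (L (0, 1))
  refine (wirtinger hderiv hderiv_cont (hzero le_rfl (by simp))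
    (hzero Real.pi_pos.le (by simp))).trans (integral_mono ?_ ?_ hle)
  · exact (hderiv_cont.norm.pow 2).integrableOn_Icc.mono_set Set.Ioo_subset_Icc_self
  · exact ((continuous_gradSq hφ1).comp hline).integrableOn_Icc.mono_set Set.Ioo_subset_Icc_self

theorem setIntegral_arm_norm_sq_le (hθ : θ ∈ Set.Ioo 0 (Real.pi / 2))
    (hφ : IsTest (brokenGuide θ) φ) {σ : ℝ} (hσ : σ ^ 2 = 1) :
    ∫ x in arm θ σ, ‖φ x‖ ^ 2 ≤ ∫ x in arm θ σ, gradSq φ x := by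
  have hcoord {f : ℝ × ℝ → ℝ} (hf : Integrable f) :
      ∫ x in arm θ σ, f x =
          ∫ s in Set.Ici 0, ∫ t in Set.Ioo 0 Real.pi, f (armEquiv θ σ hσ (s, t)) ∧
        IntegrableOn (fun s => ∫ t in Set.Ioo 0 Real.pi, f (armEquiv θ σ hσ (s, t)))
          (Set.Ici 0) := by
    have hmp := measurePreserving_armEquiv θ hσ
    have hme := measurableEmbedding_armEquiv θ hσ
    have hint : IntegrableOn (fun p => f (armEquiv θ σ hσ p))
        (Set.Ici (0 : ℝ) ×ˢ Set.Ioo 0 Real.pi) (volume.prod volume) :=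
      ((hmp.integrable_comp_emb hme).2 hf).integrableOn
    rw [← hmp.setIntegral_preimage_emb hme f, armEquiv_preimage_arm, Measure.volume_eq_prod,
      setIntegral_prod _ hint]
    rw [IntegrableOn, ← Measure.prod_restrict] at hint
    exact ⟨rfl, hint.integral_prod_left⟩
  obtain ⟨hnorm, hnorm_int⟩ := hcoord hφ.integrable_norm_sq
  obtain ⟨hgrad, hgrad_int⟩ := hcoord hφ.integrable_gradSq
  rw [hnorm, hgrad]
  exact setIntegral_mono_on hnorm_int hgrad_int measurableSet_Ici fun s hs =>
    setIntegral_norm_sq_armEquiv_le hθ hφ hσ hs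

/-- The part of the guide which is left when the arms are removed. -/
def kite (θ : ℝ) : Set (ℝ × ℝ) :=
  {x | x.1 * Real.cos θ + |x.2| * Real.sin θ < 0 ∧ transverse θ x < Real.pi}

theorem convex_kite (hθ : θ ∈ Set.Ioo 0 (Real.pi / 2)) : Convex ℝ (kite θ) := by
  have habs : ConvexOn ℝ Set.univ fun x : ℝ × ℝ => |x.2| :=
    convexOn_univ_norm.comp_linearMap (LinearMap.snd ℝ ℝ ℝ)
  have hfst (c : ℝ) : ConvexOn ℝ Set.univ fun x : ℝ × ℝ => c * x.1 :=
    (c • LinearMap.fst ℝ ℝ ℝ).convexOn convex_univ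
  have haxial := ((hfst (Real.cos θ)).add (habs.smul (sin_pos_of_mem hθ).le)).convex_lt 0
  have htransverse :=
    ((habs.smul (cos_pos_of_mem hθ).le).add (hfst (-Real.sin θ))).convex_lt Real.pi
  refine (Set.ext fun x => ?_ : kite θ = _) ▸ haxial.inter htransverse
  simp [kite, transverse, mul_comm, sub_eq_add_neg]

theorem measurableSet_kite (θ : ℝ) : MeasurableSet (kite θ) := by
  unfold kite transverse
  measurability

theorem fst_neg_of_mem_kite (hθ : θ ∈ Set.Ioo 0 (Real.pi / 2)) {x : ℝ × ℝ} (hx : x ∈ kite θ) :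
    x.1 < 0 := by
  have hnonneg := mul_nonneg (abs_nonneg x.2) (sin_pos_of_mem hθ).le
  exact neg_of_mul_neg_left (by linarith [hx.1]) (cos_pos_of_mem hθ).le

theorem isBounded_kite (hθ : θ ∈ Set.Ioo 0 (Real.pi / 2)) : Bornology.IsBounded (kite θ) := by
  have hc := cos_pos_of_mem hθ
  have hs := sin_pos_of_mem hθ
  refine (Metric.isBounded_Icc ((-(Real.pi / Real.sin θ), -(Real.pi / Real.cos θ)) : ℝ × ℝ)
    (0, Real.pi / Real.cos θ)).subset fun x hx => ?_
  have hx1 := fst_neg_of_mem_kite hθ hx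
  obtain ⟨-, hlt⟩ := hx
  rw [transverse] at hlt
  have hfst : -(Real.pi / Real.sin θ) ≤ x.1 := by
    rw [← neg_div, div_le_iff₀ hs]
    linarith [mul_nonneg (abs_nonneg x.2) hc.le]
  have hsnd : |x.2| ≤ Real.pi / Real.cos θ := by
    rw [le_div_iff₀ hc]
    nlinarith
  exact ⟨⟨hfst, (abs_le.1 hsnd).1⟩, hx1.le, (abs_le.1 hsnd).2⟩

theorem kite_subset_brokenGuide (hθ : θ ∈ Set.Ioo 0 (Real.pi / 2)) :
    kite θ ⊆ (brokenGuide θ : Set (ℝ × ℝ)) := fun x hx => by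
  refine (mem_brokenGuide_iff hθ).2 ⟨?_, hx.2⟩
  have hsnd := mul_nonneg (abs_nonneg x.2) (cos_pos_of_mem hθ).le
  have hfst := mul_neg_of_neg_of_pos (fst_neg_of_mem_kite hθ hx) (sin_pos_of_mem hθ)
  rw [transverse]
  linarith

theorem mul_snd_pos_of_mem_arm (hθ : θ ∈ Set.Ioo 0 (Real.pi / 2)) {σ : ℝ} {x : ℝ × ℝ}
    (hx : x ∈ arm θ σ) : 0 < σ * x.2 := by
  have hrotate : σ * x.2 = (x.1 * Real.cos θ + σ * x.2 * Real.sin θ) * Real.sin θ +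
      (σ * x.2 * Real.cos θ - x.1 * Real.sin θ) * Real.cos θ := by
    linear_combination (-σ * x.2) * Real.sin_sq_add_cos_sq θ
  rw [hrotate]
  exact add_pos_of_nonneg_of_pos (mul_nonneg hx.1 (sin_pos_of_mem hθ).le)
    (mul_pos hx.2.1 (cos_pos_of_mem hθ))

theorem disjoint_arm (hθ : θ ∈ Set.Ioo 0 (Real.pi / 2)) : Disjoint (arm θ 1) (arm θ (-1)) :=
  Set.disjoint_left.2 fun _ hupper hlower => by
    linarith [mul_snd_pos_of_mem_arm hθ hupper, mul_snd_pos_of_mem_arm hθ hlower]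

theorem disjoint_arm_kite (hθ : θ ∈ Set.Ioo 0 (Real.pi / 2)) {σ : ℝ} (hσ : |σ| = 1) :
    Disjoint (arm θ σ) (kite θ) :=
  Set.disjoint_left.2 fun x harm hkite => by
    have hle : σ * x.2 ≤ |x.2| := (le_abs_self _).trans_eq (by rw [abs_mul, hσ, one_mul])
    linarith [mul_le_mul_of_nonneg_right hle (sin_pos_of_mem hθ).le, harm.1, hkite.1]

theorem brokenGuide_subset_arm_union_kite (hθ : θ ∈ Set.Ioo 0 (Real.pi / 2)) :
    (brokenGuide θ : Set (ℝ × ℝ)) ⊆ (arm θ 1 ∪ arm θ (-1)) ∪ kite θ := by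
  intro x hx
  rw [mem_brokenGuide_iff hθ] at hx
  rcases lt_or_ge (x.1 * Real.cos θ + |x.2| * Real.sin θ) 0 with haxial | haxial
  · exact Or.inr ⟨haxial, hx.2⟩
  rw [transverse] at hx
  refine Or.inl ((le_total 0 x.2).imp (fun hsnd => ?_) fun hsnd => ?_)
  · rw [abs_of_nonneg hsnd] at haxial hx
    exact ⟨by linarith, by linarith, by linarith⟩
  · rw [abs_of_nonpos hsnd] at haxial hx
    exact ⟨by linarith, by linarith, by linarith⟩

theorem integral_norm_sq_le_gradSq_add_kite (hθ : θ ∈ Set.Ioo 0 (Real.pi / 2))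
    (hφ : IsTest (brokenGuide θ) φ) :
    (∫ x, ‖φ x‖ ^ 2) + ∫ x in kite θ, gradSq φ x ≤
      (∫ x, gradSq φ x) + ∫ x in kite θ, ‖φ x‖ ^ 2 := by
  have hguide : ∫ x, ‖φ x‖ ^ 2 = ∫ x in (arm θ 1 ∪ arm θ (-1)) ∪ kite θ, ‖φ x‖ ^ 2 :=
    (setIntegral_eq_integral_of_forall_compl_eq_zero fun x hx => by
      rw [hφ.eq_zero_of_notMem fun h => hx (brokenGuide_subset_arm_union_kite hθ h)]
      simp).symm
  have hdisj : Disjoint (arm θ 1 ∪ arm θ (-1)) (kite θ) :=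
    (disjoint_arm_kite hθ (by simp)).union_left (disjoint_arm_kite hθ (by simp))
  have hsplit {f : ℝ × ℝ → ℝ} (hf : Integrable f) :
      ∫ x in (arm θ 1 ∪ arm θ (-1)) ∪ kite θ, f x =
        (∫ x in arm θ 1, f x) + (∫ x in arm θ (-1), f x) + ∫ x in kite θ, f x := by
    rw [setIntegral_union hdisj (measurableSet_kite θ) hf.integrableOn hf.integrableOn,
      setIntegral_union (disjoint_arm hθ) (measurableSet_arm θ _) hf.integrableOn hf.integrableOn]
  have hle : ∫ x in (arm θ 1 ∪ arm θ (-1)) ∪ kite θ, gradSq φ x ≤ ∫ x, gradSq φ x :=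
    setIntegral_le_integral hφ.integrable_gradSq (ae_of_all _ fun x => gradSq_nonneg φ x)
  rw [hguide, hsplit hφ.integrable_norm_sq]
  rw [hsplit hφ.integrable_gradSq] at hle
  linarith [setIntegral_arm_norm_sq_le hθ hφ (σ := 1) (by norm_num),
    setIntegral_arm_norm_sq_le hθ hφ (σ := -1) (by norm_num)]

variable {Ω : TopologicalSpace.Opens (ℝ × ℝ)}

theorem IsTest.norm_inner_indicatorConstLp_sq (hφ : IsTest Ω φ) {S : Set (ℝ × ℝ)}
    (hS : MeasurableSet S) (hSΩ : S ⊆ Ω)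
    (hfin : volume.restrict (Ω : Set (ℝ × ℝ)) S ≠ ⊤) (c : ℂ) :
    ‖inner ℂ (indicatorConstLp 2 hS hfin c) hφ.toL2‖ ^ 2 = ‖c‖ ^ 2 * ‖∫ x in S, φ x‖ ^ 2 := by
  have hint : ∫ x in S, hφ.toL2 x ∂(volume.restrict (Ω : Set (ℝ × ℝ))) = ∫ x in S, φ x := by
    rw [integral_congr_ae (ae_restrict_of_ae hφ.coeFn_toL2), Measure.restrict_restrict hS,
      Set.inter_eq_left.2 hSΩ]
  rw [L2.inner_indicatorConstLp_eq_inner_setIntegral, hint, RCLike.inner_apply, norm_mul,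
    mul_pow, RCLike.norm_conj, mul_comm]

theorem exists_boundedBelowOn (hθ : θ ∈ Set.Ioo 0 (Real.pi / 2)) :
    ∃ F : Submodule ℂ (L2 (brokenGuide θ)), FiniteDimensional ℂ F ∧
      BoundedBelowOn (dirichletLaplacian (brokenGuide θ)) 1 F := by
  obtain ⟨I, hI⟩ := exists_eq_biUnion_inter_gridCell (isBounded_kite hθ)
  have hmeas (p : ℤ × ℤ) : MeasurableSet (kite θ ∩ gridCell p) :=
    (measurableSet_kite θ).inter (measurableSet_gridCell p)
  have hfin (p : ℤ × ℤ) :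
      volume.restrict (brokenGuide θ : Set (ℝ × ℝ)) (kite θ ∩ gridCell p) ≠ ⊤ :=
    ((Measure.restrict_apply_le _ _).trans_lt
      ((isBounded_kite hθ).subset Set.inter_subset_left).measure_lt_top).ne
  let f : I → L2 (brokenGuide θ) := fun p => indicatorConstLp 2 (hmeas p) (hfin p)
    (Real.sqrt (volume.real (kite θ ∩ gridCell p))⁻¹ : ℂ)
  refine ⟨Submodule.span ℂ (Set.range f), FiniteDimensional.span_of_finite ℂ (Set.finite_range f),
    boundedBelowOn_of_test f fun φ hφ => ?_⟩
  have hf (p : I) : ‖inner ℂ (f p) hφ.toL2‖ ^ 2 =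
      (volume.real (kite θ ∩ gridCell p))⁻¹ * ‖∫ x in kite θ ∩ gridCell p, φ x‖ ^ 2 := by
    rw [hφ.norm_inner_indicatorConstLp_sq _
      (Set.inter_subset_left.trans (kite_subset_brokenGuide hθ)), Complex.norm_real,
      Real.norm_eq_abs, sq_abs, Real.sq_sqrt (by positivity)]
  rw [one_mul, hφ.norm_toL2_sq, ← hφ.integral_gradSq, Finset.sum_congr rfl fun p _ => hf p,
    Finset.sum_coe_sort I fun p => (volume.real (kite θ ∩ gridCell p))⁻¹ *
      ‖∫ x in kite θ ∩ gridCell p, φ x‖ ^ 2]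
  linarith [integral_norm_sq_le_gradSq_add_kite hθ hφ,
    setIntegral_norm_sq_le_gradSq_add_sum_gridCell hφ (convex_kite hθ) (measurableSet_kite θ) hI]

end Guide

/-! ### Trial functions -/

section Cutoff

open Real

theorem deriv_smoothTransition_eq_zero {x : ℝ} (hx : x ∉ Set.Icc (0 : ℝ) 1) :
    deriv smoothTransition x = 0 := by
  rw [Set.mem_Icc, not_and_or, not_le, not_le] at hx
  rcases hx with hneg | hone
  · have hev : smoothTransition =ᶠ[𝓝 x] fun _ => 0 :=
      Filter.mem_of_superset (Iio_mem_nhds hneg) fun _ hy =>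
        smoothTransition.zero_of_nonpos (le_of_lt hy)
    rw [hev.deriv_eq, deriv_const]
  · have hev : smoothTransition =ᶠ[𝓝 x] fun _ => 1 :=
      Filter.mem_of_superset (Ioi_mem_nhds hone) fun _ hy =>
        smoothTransition.one_of_one_le (le_of_lt hy)
    rw [hev.deriv_eq, deriv_const]

theorem hasDerivAt_smoothTransition (x : ℝ) :
    HasDerivAt smoothTransition (deriv smoothTransition x) x :=
  (smoothTransition.contDiff.differentiable one_ne_zero x).hasDerivAt

theorem exists_abs_deriv_smoothTransition_le : ∃ M, ∀ x, |deriv smoothTransition x| ≤ M :=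
  (smoothTransition.contDiff.continuous_deriv le_rfl).bounded_above_of_compact_support
    (HasCompactSupport.intro isCompact_Icc fun _ => deriv_smoothTransition_eq_zero)

/-- A smooth step from `0` to `1` on the scale `ε`, which vanishes up to `ε` and equals `1` from
`2 * ε` on. -/
def cutoff (ε t : ℝ) : ℝ := smoothTransition (t / ε - 1)

variable {ε : ℝ}

theorem abs_cutoff_le_one (ε t : ℝ) : |cutoff ε t| ≤ 1 :=
  (abs_of_nonneg (smoothTransition.nonneg _)).trans_le (smoothTransition.le_one _)

theorem cutoff_eq_zero (hε : 0 < ε) {t : ℝ} (ht : t ≤ ε) : cutoff ε t = 0 :=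
  smoothTransition.zero_of_nonpos (sub_nonpos.2 ((div_le_one hε).2 ht))

theorem cutoff_eq_one (hε : 0 < ε) {t : ℝ} (ht : 2 * ε ≤ t) : cutoff ε t = 1 :=
  smoothTransition.one_of_one_le (by linarith [(le_div_iff₀ hε).2 ht])

theorem contDiff_cutoff (ε : ℝ) : ContDiff ℝ ∞ (cutoff ε) :=
  smoothTransition.contDiff.comp (by fun_prop)

theorem hasDerivAt_cutoff (ε t : ℝ) :
    HasDerivAt (cutoff ε) (deriv smoothTransition (t / ε - 1) * (1 / ε)) t :=
  (hasDerivAt_smoothTransition _).comp t (((hasDerivAt_id t).div_const ε).sub_const 1)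

/-- The slope of the cutoff is of order `1 / ε`, but it is supported where `|u| ≤ 2 * ε`. -/
theorem exists_abs_deriv_cutoff_mul_le :
    ∃ M, ∀ ε > 0, ∀ u v : ℝ, |v| ≤ |u| → |deriv (cutoff ε) u * v| ≤ M := by
  obtain ⟨M, hM⟩ := exists_abs_deriv_smoothTransition_le
  have hM0 : 0 ≤ M := (abs_nonneg _).trans (hM 0)
  refine ⟨M * 2, fun ε hε u v huv => ?_⟩
  rw [(hasDerivAt_cutoff ε u).deriv]
  by_cases hu : u / ε - 1 ∈ Set.Icc (0 : ℝ) 1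
  · have hv : |1 / ε * v| ≤ 2 := by
      rw [one_div_mul_eq_div, abs_div, abs_of_pos hε]
      calc |v| / ε ≤ |u| / ε := div_le_div_of_nonneg_right huv hε.le
        _ = |u / ε| := by rw [abs_div, abs_of_pos hε]
        _ ≤ 2 := abs_le.2 ⟨by linarith [hu.1], by linarith [hu.2]⟩
    rw [mul_assoc, abs_mul]
    exact mul_le_mul (hM _) hv (abs_nonneg _) hM0
  · rw [deriv_smoothTransition_eq_zero hu, zero_mul, zero_mul, abs_zero]
    positivity

/-- The function `sin` on `[0, π]`, smoothly cut off near both end points. -/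
def cutSin (ε t : ℝ) : ℝ := cutoff ε t * cutoff ε (π - t) * sin t

theorem contDiff_cutSin (ε : ℝ) : ContDiff ℝ ∞ (cutSin ε) :=
  ((contDiff_cutoff ε).mul ((contDiff_cutoff ε).comp (contDiff_const.sub contDiff_id))).mul
    contDiff_sin

theorem abs_cutSin_le_one (ε t : ℝ) : |cutSin ε t| ≤ 1 := by
  rw [cutSin, abs_mul, abs_mul]
  exact mul_le_one₀ (mul_le_one₀ (abs_cutoff_le_one _ _) (abs_nonneg _) (abs_cutoff_le_one _ _))
    (abs_nonneg _) (abs_sin_le_one _)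

theorem mem_Icc_of_cutSin_ne_zero (hε : 0 < ε) {t : ℝ} (h : cutSin ε t ≠ 0) :
    t ∈ Set.Icc ε (π - ε) := by
  contrapose! h
  rw [Set.mem_Icc, not_and_or, not_le, not_le] at h
  rcases h with hlow | hhigh
  · rw [cutSin, cutoff_eq_zero hε hlow.le, zero_mul, zero_mul]
  · rw [cutSin, cutoff_eq_zero hε (by linarith : π - t ≤ ε), mul_zero, zero_mul]

theorem exists_abs_deriv_cutSin_le : ∃ B, ∀ ε > 0, ∀ t, |deriv (cutSin ε) t| ≤ B := by
  obtain ⟨M, hM⟩ := exists_abs_deriv_cutoff_mul_le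
  refine ⟨M + M + 1, fun ε hε t => ?_⟩
  have hcut (t : ℝ) : HasDerivAt (cutoff ε) (deriv (cutoff ε) t) t :=
    ((contDiff_cutoff ε).differentiable (by simp) t).hasDerivAt
  have hderiv : deriv (cutSin ε) t = deriv (cutoff ε) t * sin t * cutoff ε (π - t) -
      deriv (cutoff ε) (π - t) * sin t * cutoff ε t + cutoff ε t * cutoff ε (π - t) * cos t := by
    refine ((((hcut t).mul ((hcut (π - t)).comp_const_sub π t)).mul (hasDerivAt_sin t)).congr_deriv
      ?_).deriv
    simp only [Pi.mul_apply]
    ring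
  have hleft : |deriv (cutoff ε) t * sin t * cutoff ε (π - t)| ≤ M := by
    rw [abs_mul]
    exact (mul_le_of_le_one_right (abs_nonneg _) (abs_cutoff_le_one _ _)).trans
      (hM ε hε _ _ abs_sin_le_abs)
  have hright : |deriv (cutoff ε) (π - t) * sin t * cutoff ε t| ≤ M := by
    rw [abs_mul, ← sin_pi_sub]
    exact (mul_le_of_le_one_right (abs_nonneg _) (abs_cutoff_le_one _ _)).trans
      (hM ε hε _ _ abs_sin_le_abs)
  have hcos : |cutoff ε t * cutoff ε (π - t) * cos t| ≤ 1 := by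
    rw [abs_mul, abs_mul]
    exact mul_le_one₀ (mul_le_one₀ (abs_cutoff_le_one _ _) (abs_nonneg _)
      (abs_cutoff_le_one _ _)) (abs_nonneg _) (abs_cos_le_one _)
  rw [hderiv]
  exact (abs_add_le _ _).trans (add_le_add ((abs_sub _ _).trans (add_le_add hleft hright)) hcos)

theorem eventually_cutSin_eventuallyEq_sin {t : ℝ} (ht : t ∈ Set.Ioo 0 π) {T : ℝ → ℝ}
    (hT : Tendsto T (𝓝[>] 0) (𝓝 t)) : ∀ᶠ ε in 𝓝[>] 0, cutSin ε =ᶠ[𝓝 (T ε)] sin := by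
  obtain ⟨δ, hδ, hδt⟩ := exists_between (lt_min ht.1 (sub_pos.2 ht.2))
  rw [lt_min_iff] at hδt
  filter_upwards [Ioo_mem_nhdsGT (half_pos hδ),
    hT.eventually (Ioo_mem_nhds hδt.1 (by linarith : t < π - δ))] with ε hε hTε
  filter_upwards [Ioo_mem_nhds hTε.1 hTε.2] with u hu
  rw [cutSin, cutoff_eq_one hε.1 (by linarith [hu.1, hε.2]),
    cutoff_eq_one hε.1 (by linarith [hu.2, hε.2]), one_mul, one_mul]

theorem tendsto_cutSin {t : ℝ} (ht : t ∈ Set.Ioo 0 π) {T : ℝ → ℝ}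
    (hT : Tendsto T (𝓝[>] 0) (𝓝 t)) :
    Tendsto (fun ε => cutSin ε (T ε)) (𝓝[>] 0) (𝓝 (sin t)) :=
  ((continuous_sin.tendsto t).comp hT).congr'
    ((eventually_cutSin_eventuallyEq_sin ht hT).mono fun _ h => h.eq_of_nhds.symm)

theorem tendsto_deriv_cutSin {t : ℝ} (ht : t ∈ Set.Ioo 0 π) {T : ℝ → ℝ}
    (hT : Tendsto T (𝓝[>] 0) (𝓝 t)) :
    Tendsto (fun ε => deriv (cutSin ε) (T ε)) (𝓝[>] 0) (𝓝 (cos t)) :=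
  ((continuous_cos.tendsto t).comp hT).congr'
    ((eventually_cutSin_eventuallyEq_sin ht hT).mono fun ε h =>
      (h.deriv_eq.trans (congrFun Real.deriv_sin (T ε))).symm)

end Cutoff

section TrialFunction

open Real

/-- A smooth approximation of the absolute value. -/
def smoothAbs (ε y : ℝ) : ℝ := √(y ^ 2 + ε ^ 2)

section SmoothAbs

variable {ε : ℝ}

theorem sq_add_sq_pos (hε : 0 < ε) (y : ℝ) : 0 < y ^ 2 + ε ^ 2 := by positivity

theorem contDiff_smoothAbs (hε : 0 < ε) : ContDiff ℝ ∞ (smoothAbs ε) :=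
  ContDiff.sqrt (by fun_prop) fun y => (sq_add_sq_pos hε y).ne'

theorem hasDerivAt_smoothAbs (hε : 0 < ε) (y : ℝ) :
    HasDerivAt (smoothAbs ε) (y / smoothAbs ε y) y := by
  have h := ((hasDerivAt_pow 2 y).add_const (ε ^ 2)).sqrt (sq_add_sq_pos hε y).ne'
  refine h.congr_deriv ?_
  rw [Nat.cast_ofNat, pow_one, mul_div_mul_left _ _ two_ne_zero, smoothAbs]

theorem abs_le_smoothAbs (ε y : ℝ) : |y| ≤ smoothAbs ε y :=
  abs_le_sqrt (le_add_of_nonneg_right (sq_nonneg ε))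

theorem smoothAbs_le (hε : 0 < ε) (y : ℝ) : smoothAbs ε y ≤ |y| + ε := by
  rw [smoothAbs, sqrt_le_left (by positivity), ← sq_abs y]
  nlinarith [mul_nonneg (abs_nonneg y) hε.le]

theorem tendsto_smoothAbs (y : ℝ) : Tendsto (fun ε => smoothAbs ε y) (𝓝[>] 0) (𝓝 |y|) := by
  have hcont : Continuous fun ε => smoothAbs ε y := by
    unfold smoothAbs
    fun_prop
  have hzero : smoothAbs 0 y = |y| := by
    rw [smoothAbs, zero_pow two_ne_zero, add_zero, sqrt_sq_eq_abs]
  exact hzero ▸ (hcont.tendsto 0).mono_left nhdsWithin_le_nhds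

theorem abs_div_smoothAbs_le_one (ε y : ℝ) : |y / smoothAbs ε y| ≤ 1 := by
  have hnonneg : 0 ≤ smoothAbs ε y := sqrt_nonneg _
  rw [abs_div, abs_of_nonneg hnonneg]
  exact div_le_one_of_le₀ (abs_le_smoothAbs ε y) hnonneg

theorem tendsto_div_smoothAbs_sq {y : ℝ} (hy : y ≠ 0) :
    Tendsto (fun ε => (y / smoothAbs ε y) ^ 2) (𝓝[>] 0) (𝓝 1) := by
  have h := (tendsto_const_nhds.div (tendsto_smoothAbs y) (abs_ne_zero.2 hy) :
    Tendsto (fun ε => y / smoothAbs ε y) (𝓝[>] 0) (𝓝 (y / |y|))).pow 2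
  rwa [div_pow, sq_abs, div_self (pow_ne_zero 2 hy)] at h

end SmoothAbs

variable {θ R ε : ℝ} {κ : ℝ → ℝ}

/-- A smooth approximation of `transverse`. -/
def smoothTransverse (θ ε : ℝ) (x : ℝ × ℝ) : ℝ := smoothAbs ε x.2 * cos θ - x.1 * sin θ

theorem contDiff_smoothTransverse (θ : ℝ) (hε : 0 < ε) : ContDiff ℝ ∞ (smoothTransverse θ ε) :=
  (((contDiff_smoothAbs hε).comp contDiff_snd).mul contDiff_const).sub
    (contDiff_fst.mul contDiff_const)

theorem hasFDerivAt_smoothTransverse (θ : ℝ) (hε : 0 < ε) (x : ℝ × ℝ) :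
    HasFDerivAt (smoothTransverse θ ε)
      ((x.2 / smoothAbs ε x.2 * cos θ) • ContinuousLinearMap.snd ℝ ℝ ℝ -
        sin θ • ContinuousLinearMap.fst ℝ ℝ ℝ) x :=
  (((hasDerivAt_smoothAbs hε x.2).mul_const (cos θ)).comp_hasFDerivAt x hasFDerivAt_snd).sub
    ((hasDerivAt_mul_const (sin θ)).comp_hasFDerivAt x hasFDerivAt_fst)

theorem transverse_le_smoothTransverse (hθ : θ ∈ Set.Ioo 0 (π / 2)) (ε : ℝ) (x : ℝ × ℝ) :
    transverse θ x ≤ smoothTransverse θ ε x :=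
  sub_le_sub_right (mul_le_mul_of_nonneg_right (abs_le_smoothAbs ε x.2) (cos_pos_of_mem hθ).le) _

theorem smoothTransverse_lt (hθ : θ ∈ Set.Ioo 0 (π / 2)) (hε : 0 < ε) (x : ℝ × ℝ) :
    smoothTransverse θ ε x < transverse θ x + ε := by
  have hcos : cos θ < 1 :=
    cos_zero ▸ cos_lt_cos_of_nonneg_of_le_pi_div_two le_rfl hθ.2.le hθ.1
  have hle := mul_le_mul_of_nonneg_right (smoothAbs_le hε x.2) (cos_pos_of_mem hθ).le
  rw [smoothTransverse, transverse]
  nlinarith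

theorem tendsto_smoothTransverse (θ : ℝ) (x : ℝ × ℝ) :
    Tendsto (fun ε => smoothTransverse θ ε x) (𝓝[>] 0) (𝓝 (transverse θ x)) :=
  ((tendsto_smoothAbs x.2).mul_const (cos θ)).sub_const (x.1 * sin θ)

theorem mem_brokenGuide_of_smoothTransverse_mem_Icc (hθ : θ ∈ Set.Ioo 0 (π / 2)) (hε : 0 < ε)
    {x : ℝ × ℝ} (hx : smoothTransverse θ ε x ∈ Set.Icc ε (π - ε)) :
    x ∈ (brokenGuide θ : Set (ℝ × ℝ)) :=
  (mem_brokenGuide_iff hθ).2 ⟨by linarith [smoothTransverse_lt hθ hε x, hx.1],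
    by linarith [transverse_le_smoothTransverse hθ ε x, hx.2]⟩

/-- The bounded part of the guide on which the first coordinate is at most `R`. -/
def truncatedGuide (θ R : ℝ) : Set (ℝ × ℝ) := {x | x ∈ brokenGuide θ ∧ x.1 ≤ R}

theorem measurableSet_truncatedGuide (θ R : ℝ) : MeasurableSet (truncatedGuide θ R) :=
  (brokenGuide θ).isOpen.measurableSet.inter (measurableSet_Iic.preimage measurable_fst)

theorem fst_mem_Ioc_of_mem_truncatedGuide (hθ : θ ∈ Set.Ioo 0 (π / 2)) {x : ℝ × ℝ}
    (hx : x ∈ truncatedGuide θ R) : x.1 ∈ Set.Ioc (-(π / sin θ)) R := by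
  have hlt := ((mem_brokenGuide_iff hθ).1 hx.1).2
  have hnonneg := mul_nonneg (abs_nonneg x.2) (cos_pos_of_mem hθ).le
  rw [transverse] at hlt
  refine ⟨?_, hx.2⟩
  rw [← neg_div, div_lt_iff₀ (sin_pos_of_mem hθ)]
  linarith

theorem isBounded_truncatedGuide (hθ : θ ∈ Set.Ioo 0 (π / 2)) (R : ℝ) :
    Bornology.IsBounded (truncatedGuide θ R) := by
  refine ((Metric.isBounded_Icc (-(π / sin θ)) R).prod
    (Metric.isBounded_Icc (-((π + R * sin θ) / cos θ)) ((π + R * sin θ) / cos θ))).subset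
    fun x hx => ⟨Set.Ioc_subset_Icc_self (fst_mem_Ioc_of_mem_truncatedGuide hθ hx), abs_le.1 ?_⟩
  have hlt := ((mem_brokenGuide_iff hθ).1 hx.1).2
  rw [transverse] at hlt
  rw [le_div_iff₀ (cos_pos_of_mem hθ)]
  linarith [mul_le_mul_of_nonneg_right hx.2 (sin_pos_of_mem hθ).le]

/-- Test functions approximating `κ x.1 * sin (transverse θ x)`. -/
def trialFun (θ : ℝ) (κ : ℝ → ℝ) (ε : ℝ) (x : ℝ × ℝ) : ℂ :=
  (κ x.1 * cutSin ε (smoothTransverse θ ε x) : ℝ)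

theorem contDiff_trialFun (hκ : ContDiff ℝ ∞ κ) (hε : 0 < ε) : ContDiff ℝ ∞ (trialFun θ κ ε) :=
  Complex.ofRealCLM.contDiff.comp
    ((hκ.comp contDiff_fst).mul ((contDiff_cutSin ε).comp (contDiff_smoothTransverse θ hε)))

theorem norm_sq_trialFun (θ : ℝ) (κ : ℝ → ℝ) (ε : ℝ) (x : ℝ × ℝ) :
    ‖trialFun θ κ ε x‖ ^ 2 = (κ x.1 * cutSin ε (smoothTransverse θ ε x)) ^ 2 := by
  rw [trialFun, Complex.norm_real, norm_eq_abs, sq_abs]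

theorem tsupport_trialFun_subset (hR : ∀ y, R ≤ y → κ y = 0) (hε : 0 < ε) :
    tsupport (trialFun θ κ ε) ⊆ {x | x.1 ∈ tsupport κ} ∩
      ({x | x.1 ≤ R} ∩ {x | smoothTransverse θ ε x ∈ Set.Icc ε (π - ε)}) := by
  refine closure_minimal (fun x hx => ?_) (((isClosed_tsupport κ).preimage continuous_fst).inter
    ((isClosed_Iic.preimage continuous_fst).inter
      (isClosed_Icc.preimage (contDiff_smoothTransverse θ hε).continuous)))
  obtain ⟨hκx, hsin⟩ := mul_ne_zero_iff.1 (Complex.ofReal_ne_zero.1 hx)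
  exact ⟨subset_tsupport κ hκx, le_of_not_ge fun h => hκx (hR _ h),
    mem_Icc_of_cutSin_ne_zero hε hsin⟩

theorem tsupport_trialFun_subset_truncatedGuide (hθ : θ ∈ Set.Ioo 0 (π / 2))
    (hR : ∀ y, R ≤ y → κ y = 0) (hε : 0 < ε) :
    tsupport (trialFun θ κ ε) ⊆ truncatedGuide θ R := fun _ hx =>
  have h := tsupport_trialFun_subset hR hε hx
  ⟨mem_brokenGuide_of_smoothTransverse_mem_Icc hθ hε h.2.2, h.2.1⟩

theorem isTest_trialFun (hθ : θ ∈ Set.Ioo 0 (π / 2)) (hκ : ContDiff ℝ ∞ κ)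
    (hR : ∀ y, R ≤ y → κ y = 0) (hε : 0 < ε) : IsTest (brokenGuide θ) (trialFun θ κ ε) where
  smooth := contDiff_trialFun hκ hε
  compact := Metric.isCompact_of_isClosed_isBounded (isClosed_tsupport _)
    ((isBounded_truncatedGuide hθ R).subset (tsupport_trialFun_subset_truncatedGuide hθ hR hε))
  support := fun _ hx => (tsupport_trialFun_subset_truncatedGuide hθ hR hε hx).1

theorem dirDeriv_trialFun (hκ : ContDiff ℝ ∞ κ) (hε : 0 < ε) (x v : ℝ × ℝ) :
    dirDeriv v (trialFun θ κ ε) x =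
      ((κ x.1 * (deriv (cutSin ε) (smoothTransverse θ ε x) *
          (x.2 / smoothAbs ε x.2 * cos θ * v.2 - sin θ * v.1)) +
        cutSin ε (smoothTransverse θ ε x) * (deriv κ x.1 * v.1) : ℝ) : ℂ) := by
  have hprofile : HasFDerivAt (fun z : ℝ × ℝ => κ z.1)
      (deriv κ x.1 • ContinuousLinearMap.fst ℝ ℝ ℝ) x :=
    (hκ.differentiable (by simp) x.1).hasDerivAt.comp_hasFDerivAt x hasFDerivAt_fst
  have hsin := ((contDiff_cutSin ε).differentiable (by simp)
    (smoothTransverse θ ε x)).hasDerivAt.comp_hasFDerivAt x (hasFDerivAt_smoothTransverse θ hε x)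
  have htrial : HasFDerivAt (trialFun θ κ ε) _ x :=
    Complex.ofRealCLM.hasFDerivAt.comp x (hprofile.mul hsin)
  rw [dirDeriv, htrial.fderiv]
  simp

theorem gradSq_trialFun (hκ : ContDiff ℝ ∞ κ) (hε : 0 < ε) (x : ℝ × ℝ) :
    gradSq (trialFun θ κ ε) x =
      (deriv κ x.1 * cutSin ε (smoothTransverse θ ε x) -
        sin θ * κ x.1 * deriv (cutSin ε) (smoothTransverse θ ε x)) ^ 2 +
      (κ x.1 * deriv (cutSin ε) (smoothTransverse θ ε x)) ^ 2 *
        ((x.2 / smoothAbs ε x.2) ^ 2 * cos θ ^ 2) := by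
  rw [gradSq, dirDeriv_trialFun hκ hε, dirDeriv_trialFun hκ hε, Complex.norm_real,
    Complex.norm_real, norm_eq_abs, norm_eq_abs, sq_abs, sq_abs]
  ring

/-- The squared gradient of `κ x.1 * sin (transverse θ x)`, at `x.1 = y` and
`transverse θ x = t`. -/
def limitDensity (θ : ℝ) (κ : ℝ → ℝ) (y t : ℝ) : ℝ :=
  (deriv κ y * sin t - sin θ * κ y * cos t) ^ 2 + (κ y * cos t) ^ 2 * cos θ ^ 2

theorem continuous_limitDensity (θ : ℝ) (hκ : ContDiff ℝ ∞ κ) :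
    Continuous (Function.uncurry (limitDensity θ κ)) := by
  have hκ0 := hκ.continuous
  have hκ1 : Continuous (deriv κ) := hκ.continuous_deriv (by simp)
  unfold limitDensity Function.uncurry
  fun_prop

theorem tendsto_norm_sq_trialFun (hθ : θ ∈ Set.Ioo 0 (π / 2)) {x : ℝ × ℝ}
    (hx : x ∈ (brokenGuide θ : Set (ℝ × ℝ))) :
    Tendsto (fun ε => ‖trialFun θ κ ε x‖ ^ 2) (𝓝[>] 0)
      (𝓝 ((κ x.1 * sin (transverse θ x)) ^ 2)) := by
  simp only [norm_sq_trialFun]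
  exact ((tendsto_cutSin ((mem_brokenGuide_iff hθ).1 hx)
    (tendsto_smoothTransverse θ x)).const_mul (κ x.1)).pow 2

theorem tendsto_gradSq_trialFun (hθ : θ ∈ Set.Ioo 0 (π / 2)) (hκ : ContDiff ℝ ∞ κ) {x : ℝ × ℝ}
    (hx : x ∈ (brokenGuide θ : Set (ℝ × ℝ))) (hx2 : x.2 ≠ 0) :
    Tendsto (fun ε => gradSq (trialFun θ κ ε) x) (𝓝[>] 0)
      (𝓝 (limitDensity θ κ x.1 (transverse θ x))) := by
  have hmem : transverse θ x ∈ Set.Ioo 0 π := (mem_brokenGuide_iff hθ).1 hx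
  have hsin := tendsto_cutSin hmem (tendsto_smoothTransverse θ x)
  have hcos := tendsto_deriv_cutSin hmem (tendsto_smoothTransverse θ x)
  have h := (((hsin.const_mul (deriv κ x.1)).sub (hcos.const_mul (sin θ * κ x.1))).pow 2).add
    (((hcos.const_mul (κ x.1)).pow 2).mul
      ((tendsto_div_smoothAbs_sq hx2).mul_const (cos θ ^ 2)))
  rw [one_mul] at h
  exact h.congr' (eventually_mem_nhdsWithin.mono fun ε hε => (gradSq_trialFun hκ hε x).symm)

theorem exists_abs_le_of_mem_truncatedGuide (hθ : θ ∈ Set.Ioo 0 (π / 2)) (R : ℝ) {g : ℝ → ℝ}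
    (hg : Continuous g) : ∃ K, ∀ x ∈ truncatedGuide θ R, |g x.1| ≤ K := by
  obtain ⟨K, hK⟩ := isCompact_Icc.exists_bound_of_continuousOn
    (s := Set.Icc (-(π / sin θ)) R) hg.continuousOn
  exact ⟨K, fun x hx => hK _ (Set.Ioc_subset_Icc_self (fst_mem_Ioc_of_mem_truncatedGuide hθ hx))⟩

theorem exists_norm_sq_trialFun_le (hθ : θ ∈ Set.Ioo 0 (π / 2)) (R : ℝ) (hκ : Continuous κ) :
    ∃ C, ∀ ε, ∀ x ∈ truncatedGuide θ R, ‖trialFun θ κ ε x‖ ^ 2 ≤ C := by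
  obtain ⟨K, hK⟩ := exists_abs_le_of_mem_truncatedGuide hθ R hκ
  refine ⟨K ^ 2, fun ε x hx => ?_⟩
  rw [norm_sq_trialFun, ← sq_abs, abs_mul]
  exact pow_le_pow_left₀ (by positivity)
    ((mul_le_of_le_one_right (abs_nonneg _) (abs_cutSin_le_one _ _)).trans (hK x hx)) 2

theorem exists_gradSq_trialFun_le (hθ : θ ∈ Set.Ioo 0 (π / 2)) (R : ℝ) (hκ : ContDiff ℝ ∞ κ) :
    ∃ C, ∀ ε > 0, ∀ x ∈ truncatedGuide θ R, gradSq (trialFun θ κ ε) x ≤ C := by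
  obtain ⟨B, hB⟩ := exists_abs_deriv_cutSin_le
  obtain ⟨K, hK⟩ := exists_abs_le_of_mem_truncatedGuide hθ R hκ.continuous
  obtain ⟨K', hK'⟩ :=
    exists_abs_le_of_mem_truncatedGuide hθ R (hκ.continuous_deriv (by simp) : Continuous (deriv κ))
  refine ⟨(K' * 1 + 1 * K * B) ^ 2 + (K * B) ^ 2 * (1 ^ 2 * 1 ^ 2), fun ε hε x hx => ?_⟩
  specialize hK x hx
  specialize hK' x hx
  have hK0 : 0 ≤ K := (abs_nonneg _).trans hK
  have hK0' : 0 ≤ K' := (abs_nonneg _).trans hK'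
  have hderiv := hB ε hε (smoothTransverse θ ε x)
  have : 0 ≤ B := (abs_nonneg _).trans hderiv
  have habs {a b : ℝ} (h : |a| ≤ b) : a ^ 2 ≤ b ^ 2 :=
    sq_le_sq' (neg_le_of_abs_le h) (le_of_abs_le h)
  have hfst : (deriv κ x.1 * cutSin ε (smoothTransverse θ ε x) -
      sin θ * κ x.1 * deriv (cutSin ε) (smoothTransverse θ ε x)) ^ 2 ≤
      (K' * 1 + 1 * K * B) ^ 2 := by
    refine habs ((abs_sub _ _).trans ?_)
    rw [abs_mul, abs_mul, abs_mul]
    gcongr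
    exacts [abs_cutSin_le_one _ _, abs_sin_le_one θ]
  have hsnd : (κ x.1 * deriv (cutSin ε) (smoothTransverse θ ε x)) ^ 2 ≤ (K * B) ^ 2 := by
    refine habs ?_
    rw [abs_mul]
    gcongr
  rw [gradSq_trialFun hκ hε]
  exact add_le_add hfst (mul_le_mul hsnd
    (mul_le_mul (habs (abs_div_smoothAbs_le_one ε x.2)) (habs (abs_cos_le_one θ)) (sq_nonneg _)
      (sq_nonneg _)) (by positivity) (sq_nonneg _))

end TrialFunction

section IntegralLimit

theorem tendsto_integral_of_bounded_on {α ι E : Type*} [MeasurableSpace α] [NormedAddCommGroup E]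
    [NormedSpace ℝ E] {μ : Measure α} {l : Filter ι} [l.IsCountablyGenerated] {S : Set α}
    (hS : MeasurableSet S) (hμ : μ S ≠ ⊤) {f : ι → α → E} {F : α → E} {C : ℝ}
    (hmeas : ∀ᶠ i in l, AEStronglyMeasurable (f i) μ) (hzero : ∀ᶠ i in l, ∀ x ∉ S, f i x = 0)
    (hC : ∀ᶠ i in l, ∀ x ∈ S, ‖f i x‖ ≤ C)
    (hlim : ∀ᵐ x ∂μ, x ∈ S → Tendsto (fun i => f i x) l (𝓝 (F x))) :
    Tendsto (fun i => ∫ x, f i x ∂μ) l (𝓝 (∫ x in S, F x ∂μ)) := by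
  refine (tendsto_integral_filter_of_dominated_convergence (fun _ => C)
    (hmeas.mono fun _ h => h.restrict) (hC.mono fun i h => ?_) (integrableOn_const hμ)
    ((ae_restrict_iff' hS).2 hlim)).congr' (hzero.mono fun i h => ?_)
  · exact (ae_restrict_iff' hS).2 (ae_of_all _ h)
  · exact setIntegral_eq_integral_of_forall_compl_eq_zero h

theorem ae_snd_ne_zero : ∀ᵐ x : ℝ × ℝ, x.2 ≠ 0 :=
  Measure.quasiMeasurePreserving_snd.ae (Measure.ae_ne volume 0)

theorem integral_Ioi_indicator_comp {a b c d : ℝ} (hc : 0 < c) (hab : max a (-d) ≤ b)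
    (h : ℝ → ℝ) :
    ∫ z in Set.Ioi 0, (Set.Ioo a b).indicator h (z * c - d) =
      c⁻¹ * ∫ t in (max a (-d))..b, h t := by
  have hmem (z : ℝ) : z ∈ Set.Ioi 0 ∧ z * c - d ∈ Set.Ioo a b ↔
      z * c - d ∈ Set.Ioo (max a (-d)) b := by
    have hz : 0 < z ↔ -d < z * c - d := by
      rw [neg_lt_sub_iff_lt_add, lt_add_iff_pos_right, mul_pos_iff_of_pos_right hc]
    rw [Set.mem_Ioi, Set.mem_Ioo, Set.mem_Ioo, max_lt_iff, hz]
    tauto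
  have hind (z : ℝ) : (Set.Ioi 0).indicator (fun z => (Set.Ioo a b).indicator h (z * c - d)) z =
      (Set.Ioo (max a (-d)) b).indicator h (z * c - d) := by
    simp only [Set.indicator_apply, ← ite_and, hmem]
  rw [← integral_indicator measurableSet_Ioi, funext hind,
    Measure.integral_comp_mul_right (fun t => (Set.Ioo (max a (-d)) b).indicator h (t - d)),
    integral_sub_right_eq_self, integral_indicator measurableSet_Ioo,
    intervalIntegral.integral_of_le hab, integral_Ioc_eq_integral_Ioo, abs_of_pos (inv_pos.2 hc),
    smul_eq_mul]

end IntegralLimit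

section Slice

open Real

variable {θ R C : ℝ} {κ : ℝ → ℝ}

/-- The infimum of the transverse coordinates of the points of the guide with first coordinate
`y`. -/
def lowestTransverse (θ y : ℝ) : ℝ := max 0 (-(y * sin θ))

theorem continuous_lowestTransverse (θ : ℝ) : Continuous (lowestTransverse θ) := by
  unfold lowestTransverse
  fun_prop

theorem lowestTransverse_le_pi (hθ : θ ∈ Set.Ioo 0 (π / 2)) {y : ℝ} (hy : -(π / sin θ) ≤ y) :
    lowestTransverse θ y ≤ π := by
  rw [← neg_div, div_le_iff₀ (sin_pos_of_mem hθ)] at hy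
  exact max_le pi_pos.le (by linarith)

theorem continuous_transverse (θ : ℝ) : Continuous (transverse θ) := by
  unfold transverse
  fun_prop

theorem measure_truncatedGuide_ne_top (hθ : θ ∈ Set.Ioo 0 (π / 2)) (R : ℝ) :
    volume (truncatedGuide θ R) ≠ ⊤ :=
  (isBounded_truncatedGuide hθ R).measure_lt_top.ne

theorem indicator_truncatedGuide (hθ : θ ∈ Set.Ioo 0 (π / 2)) (h : ℝ → ℝ → ℝ) (y z : ℝ) :
    (truncatedGuide θ R).indicator (fun x => h x.1 (transverse θ x)) (y, z) =
      (Set.Ioc (-(π / sin θ)) R).indicator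
        (fun y => (Set.Ioo 0 π).indicator (h y) (|z| * cos θ - y * sin θ)) y := by
  have hmem : (y, z) ∈ truncatedGuide θ R ↔
      y ∈ Set.Ioc (-(π / sin θ)) R ∧ |z| * cos θ - y * sin θ ∈ Set.Ioo 0 π :=
    ⟨fun hx => ⟨fst_mem_Ioc_of_mem_truncatedGuide hθ hx, (mem_brokenGuide_iff hθ).1 hx.1⟩,
      fun hx => ⟨(mem_brokenGuide_iff hθ).2 hx.2, hx.1.2⟩⟩
  by_cases hx : (y, z) ∈ truncatedGuide θ R
  · rw [Set.indicator_of_mem hx, Set.indicator_of_mem (hmem.1 hx).1,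
      Set.indicator_of_mem (hmem.1 hx).2, transverse]
  · rw [Set.indicator_of_notMem hx]
    by_cases hy : y ∈ Set.Ioc (-(π / sin θ)) R
    · rw [Set.indicator_of_mem hy, Set.indicator_of_notMem fun ht => hx (hmem.2 ⟨hy, ht⟩)]
    · rw [Set.indicator_of_notMem hy]

theorem setIntegral_truncatedGuide (hθ : θ ∈ Set.Ioo 0 (π / 2)) (R : ℝ) {h : ℝ → ℝ → ℝ}
    (hh : Continuous (Function.uncurry h)) :
    ∫ x in truncatedGuide θ R, h x.1 (transverse θ x) =
      2 / cos θ * ∫ y in Set.Ioc (-(π / sin θ)) R, ∫ t in (lowestTransverse θ y)..π, h y t := by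
  have hint : Integrable ((truncatedGuide θ R).indicator fun x => h x.1 (transverse θ x)) := by
    have hcont : Continuous fun x : ℝ × ℝ => h x.1 (transverse θ x) :=
      hh.comp (continuous_fst.prodMk (continuous_transverse θ))
    refine IntegrableOn.integrable_indicator ?_ (measurableSet_truncatedGuide θ R)
    exact (hcont.continuousOn.integrableOn_compact
      (isBounded_truncatedGuide hθ R).isCompact_closure).mono_set subset_closure
  have hslice {y : ℝ} (hy : y ∈ Set.Ioc (-(π / sin θ)) R) :
      ∫ z, (Set.Ioo 0 π).indicator (h y) (|z| * cos θ - y * sin θ) =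
        2 / cos θ * ∫ t in (lowestTransverse θ y)..π, h y t := by
    rw [integral_comp_abs (f := fun z => (Set.Ioo 0 π).indicator (h y) (z * cos θ - y * sin θ)),
      integral_Ioi_indicator_comp (cos_pos_of_mem hθ) (lowestTransverse_le_pi hθ hy.1.le),
      div_eq_mul_inv, mul_assoc, lowestTransverse]
  rw [← integral_indicator (measurableSet_truncatedGuide θ R), Measure.volume_eq_prod,
    integral_prod _ hint, ← integral_const_mul, ← integral_indicator measurableSet_Ioc]
  simp only [indicator_truncatedGuide hθ]
  refine integral_congr_ae (ae_of_all _ fun y => ?_)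
  by_cases hy : y ∈ Set.Ioc (-(π / sin θ)) R
  · simp only [Set.indicator_of_mem hy, hslice hy]
  · simp only [Set.indicator_of_notMem hy, integral_zero]

/-- The integral of `sin ^ 2` over the transverse coordinates above `lowestTransverse θ y`. -/
def sliceMass (θ y : ℝ) : ℝ :=
  (π - lowestTransverse θ y + sin (lowestTransverse θ y) * cos (lowestTransverse θ y)) / 2

/-- The integral of `limitDensity θ κ y` over the transverse coordinates above
`lowestTransverse θ y`. -/
def sliceEnergy (θ : ℝ) (κ : ℝ → ℝ) (y : ℝ) : ℝ :=
  deriv κ y ^ 2 * sliceMass θ y +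
    sin θ * (κ y * deriv κ y) * sin (lowestTransverse θ y) ^ 2 +
    κ y ^ 2 * (sliceMass θ y - sin (lowestTransverse θ y) * cos (lowestTransverse θ y))

theorem continuous_sliceMass (θ : ℝ) : Continuous (sliceMass θ) := by
  have := continuous_lowestTransverse θ
  unfold sliceMass
  fun_prop

theorem continuous_sliceEnergy (θ : ℝ) (hκ : ContDiff ℝ 1 κ) : Continuous (sliceEnergy θ κ) := by
  have := continuous_lowestTransverse θ
  have := continuous_sliceMass θ
  have := hκ.continuous
  have := hκ.continuous_deriv_one
  unfold sliceEnergy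
  fun_prop

theorem integral_limitDensity (θ : ℝ) (κ : ℝ → ℝ) (y : ℝ) :
    ∫ t in (lowestTransverse θ y)..π, limitDensity θ κ y t = sliceEnergy θ κ y := by
  have hexpand (t : ℝ) : limitDensity θ κ y t = deriv κ y ^ 2 * sin t ^ 2 +
      -2 * sin θ * (κ y * deriv κ y) * (sin t * cos t) + κ y ^ 2 * cos t ^ 2 := by
    rw [limitDensity]
    linear_combination κ y ^ 2 * cos t ^ 2 * sin_sq_add_cos_sq θ
  simp only [hexpand]
  rw [intervalIntegral.integral_add, intervalIntegral.integral_add,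
    intervalIntegral.integral_const_mul, intervalIntegral.integral_const_mul,
    intervalIntegral.integral_const_mul, integral_sin_sq, integral_cos_sq,
    integral_sin_mul_cos₁, sliceEnergy, sliceMass, sin_pi]
  · ring
  all_goals exact Continuous.intervalIntegrable (by fun_prop) _ _

theorem integral_sq_mul_sin (θ : ℝ) (κ : ℝ → ℝ) (y : ℝ) :
    ∫ t in (lowestTransverse θ y)..π, (κ y * sin t) ^ 2 = κ y ^ 2 * sliceMass θ y := by
  simp only [mul_pow]
  rw [intervalIntegral.integral_const_mul, integral_sin_sq, sliceMass, sin_pi]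
  ring

theorem gradSq_eq_zero_of_notMem {φ : ℝ × ℝ → ℂ} {x : ℝ × ℝ} (hx : x ∉ tsupport φ) :
    gradSq φ x = 0 := by
  have hzero (v : ℝ × ℝ) : dirDeriv v φ x = 0 :=
    image_eq_zero_of_notMem_tsupport fun h => hx (tsupport_fderiv_apply_subset ℝ v h)
  rw [gradSq, hzero, hzero, norm_zero, zero_pow two_ne_zero, add_zero]

theorem tendsto_integral_gradSq_trialFun (hθ : θ ∈ Set.Ioo 0 (π / 2)) (hκ : ContDiff ℝ ∞ κ)
    (hR : ∀ y, R ≤ y → κ y = 0) :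
    Tendsto (fun ε => ∫ x, gradSq (trialFun θ κ ε) x) (𝓝[>] 0)
      (𝓝 (2 / cos θ * ∫ y in Set.Ioc (-(π / sin θ)) R, sliceEnergy θ κ y)) := by
  obtain ⟨C, hC⟩ := exists_gradSq_trialFun_le hθ R hκ
  simp only [← integral_limitDensity]
  rw [← setIntegral_truncatedGuide hθ R (continuous_limitDensity θ hκ)]
  refine tendsto_integral_of_bounded_on (C := C) (measurableSet_truncatedGuide θ R)
    (measure_truncatedGuide_ne_top hθ R) ?_ ?_ ?_ ?_
  · exact eventually_mem_nhdsWithin.mono fun ε hε =>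
      (continuous_gradSq ((contDiff_trialFun hκ hε).of_le (by simp))).aestronglyMeasurable
  · exact eventually_mem_nhdsWithin.mono fun ε hε x hx => gradSq_eq_zero_of_notMem fun h =>
      hx (tsupport_trialFun_subset_truncatedGuide hθ hR hε h)
  · refine eventually_mem_nhdsWithin.mono fun ε hε x hx => ?_
    rw [norm_eq_abs, abs_of_nonneg (gradSq_nonneg _ _)]
    exact hC ε hε x hx
  · exact ae_snd_ne_zero.mono fun x hx2 hx => tendsto_gradSq_trialFun hθ hκ hx.1 hx2

theorem tendsto_integral_norm_sq_trialFun (hθ : θ ∈ Set.Ioo 0 (π / 2)) (hκ : ContDiff ℝ ∞ κ)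
    (hR : ∀ y, R ≤ y → κ y = 0) :
    Tendsto (fun ε => ∫ x, ‖trialFun θ κ ε x‖ ^ 2) (𝓝[>] 0)
      (𝓝 (2 / cos θ * ∫ y in Set.Ioc (-(π / sin θ)) R, κ y ^ 2 * sliceMass θ y)) := by
  obtain ⟨C, hC⟩ := exists_norm_sq_trialFun_le hθ R hκ.continuous
  have hcont : Continuous (Function.uncurry fun y t : ℝ => (κ y * sin t) ^ 2) := by
    have := hκ.continuous
    unfold Function.uncurry
    fun_prop
  simp only [← integral_sq_mul_sin]
  rw [← setIntegral_truncatedGuide hθ R hcont]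
  refine tendsto_integral_of_bounded_on (C := C) (measurableSet_truncatedGuide θ R)
    (measure_truncatedGuide_ne_top hθ R) ?_ ?_ ?_ ?_
  · exact eventually_mem_nhdsWithin.mono fun ε hε =>
      ((contDiff_trialFun hκ hε).continuous.norm.pow 2).aestronglyMeasurable
  · refine eventually_mem_nhdsWithin.mono fun ε hε x hx => ?_
    rw [image_eq_zero_of_notMem_tsupport fun h =>
      hx (tsupport_trialFun_subset_truncatedGuide hθ hR hε h), norm_zero, zero_pow two_ne_zero]
  · refine Eventually.of_forall fun ε x hx => ?_
    rw [norm_eq_abs, abs_of_nonneg (sq_nonneg _)]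
    exact hC ε x hx
  · exact ae_of_all _ fun x hx => tendsto_norm_sq_trialFun hθ hx.1

theorem exists_test_of_integral_sliceEnergy_lt (hθ : θ ∈ Set.Ioo 0 (π / 2))
    (hκ : ContDiff ℝ ∞ κ) (hR : ∀ y, R ≤ y → κ y = 0)
    (hlt : ∫ y in Set.Ioc (-(π / sin θ)) R, sliceEnergy θ κ y <
      C * ∫ y in Set.Ioc (-(π / sin θ)) R, κ y ^ 2 * sliceMass θ y) :
    ∃ φ, ∃ hφ : IsTest (brokenGuide θ) φ, tsupport φ ⊆ {x | x.1 ∈ tsupport κ} ∧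
      quad (dirichletLaplacian (brokenGuide θ)) hφ.toDomain < C * ‖hφ.toL2‖ ^ 2 := by
  have hcos : 0 < 2 / cos θ := div_pos two_pos (cos_pos_of_mem hθ)
  have hlim := (mul_lt_mul_of_pos_left hlt hcos).trans_eq (mul_left_comm _ C _)
  obtain ⟨ε, hquad, hε⟩ := (((tendsto_integral_gradSq_trialFun hθ hκ hR).eventually_lt
    ((tendsto_integral_norm_sq_trialFun hθ hκ hR).const_mul C) hlim).and
      eventually_mem_nhdsWithin).exists
  have htest := isTest_trialFun hθ hκ hR hε
  refine ⟨_, htest, fun x hx => (tsupport_trialFun_subset hR hε hx).1, ?_⟩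
  rwa [IsTest.quad_toDomain, ← htest.integral_gradSq, IsTest.norm_toL2_sq]

end Slice

section Arm

open Real

variable {θ R C : ℝ} {κ : ℝ → ℝ}

theorem lowestTransverse_of_nonneg (hθ : θ ∈ Set.Ioo 0 (π / 2)) {y : ℝ} (hy : 0 ≤ y) :
    lowestTransverse θ y = 0 :=
  max_eq_left (neg_nonpos.2 (mul_nonneg hy (sin_pos_of_mem hθ).le))

theorem sliceMass_of_nonneg (hθ : θ ∈ Set.Ioo 0 (π / 2)) {y : ℝ} (hy : 0 ≤ y) :
    sliceMass θ y = π / 2 := by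
  rw [sliceMass, lowestTransverse_of_nonneg hθ hy, sin_zero, zero_mul, sub_zero, add_zero]

theorem sliceEnergy_of_nonneg (hθ : θ ∈ Set.Ioo 0 (π / 2)) (κ : ℝ → ℝ) {y : ℝ} (hy : 0 ≤ y) :
    sliceEnergy θ κ y = (deriv κ y ^ 2 + κ y ^ 2) * (π / 2) := by
  rw [sliceEnergy, sliceMass_of_nonneg hθ hy, lowestTransverse_of_nonneg hθ hy, sin_zero]
  ring

theorem sliceEnergy_eq_zero_of_notMem (θ : ℝ) {y : ℝ} (hy : y ∉ tsupport κ) :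
    sliceEnergy θ κ y = 0 := by
  rw [sliceEnergy, image_eq_zero_of_notMem_tsupport hy, deriv_of_notMem_tsupport hy]
  ring

theorem setIntegral_Ioc_eq_integral_mul {a c : ℝ} (ha : a ≤ 0) {f g : ℝ → ℝ}
    (hf : ∀ y ∉ Set.Ioo 0 R, f y = 0) (hg : ∀ y ∉ Set.Ioo 0 R, g y = 0)
    (hfg : ∀ y, 0 ≤ y → f y = g y * c) :
    ∫ y in Set.Ioc a R, f y = (∫ y, g y) * c := by
  have hIoc (y : ℝ) (hy : y ∉ Set.Ioc a R) : f y = 0 :=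
    hf y fun h => hy ⟨ha.trans_lt h.1, h.2.le⟩
  rw [setIntegral_eq_integral_of_forall_compl_eq_zero hIoc, ← integral_mul_const]
  congr 1
  ext y
  by_cases hy : y ∈ Set.Ioo 0 R
  · exact hfg y hy.1.le
  · rw [hf y hy, hg y hy, zero_mul]

theorem hasCompactSupport_sq {f : ℝ → ℝ} (hf : HasCompactSupport f) :
    HasCompactSupport fun y => f y ^ 2 :=
  hf.comp_left (g := fun r : ℝ => r ^ 2) (zero_pow two_ne_zero)

theorem integrable_sq_of_hasCompactSupport {f : ℝ → ℝ} (hf : Continuous f)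
    (hsupp : HasCompactSupport f) : Integrable fun y => f y ^ 2 :=
  (hf.pow 2).integrable_of_hasCompactSupport (hasCompactSupport_sq hsupp)

theorem exists_test_of_integral_deriv_sq_lt (hθ : θ ∈ Set.Ioo 0 (π / 2)) (hκ : ContDiff ℝ ∞ κ)
    (hsupp : tsupport κ ⊆ Set.Ioo 0 R) (hlt : ∫ y, deriv κ y ^ 2 < (C - 1) * ∫ y, κ y ^ 2) :
    ∃ φ, ∃ hφ : IsTest (brokenGuide θ) φ, tsupport φ ⊆ {x | x.1 ∈ tsupport κ} ∧
      quad (dirichletLaplacian (brokenGuide θ)) hφ.toDomain < C * ‖hφ.toL2‖ ^ 2 := by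
  have hcompact : HasCompactSupport κ := HasCompactSupport.of_support_subset_isCompact
    isCompact_Icc ((subset_tsupport κ).trans (hsupp.trans Set.Ioo_subset_Icc_self))
  have hstart : -(π / sin θ) ≤ 0 := neg_nonpos.2 (div_pos pi_pos (sin_pos_of_mem hθ)).le
  have hnotMem {y : ℝ} (hy : y ∉ Set.Ioo 0 R) : y ∉ tsupport κ := fun h => hy (hsupp h)
  have hzero {y : ℝ} (hy : y ∉ Set.Ioo 0 R) : κ y = 0 :=
    image_eq_zero_of_notMem_tsupport (hnotMem hy)
  have henergy : ∫ y in Set.Ioc (-(π / sin θ)) R, sliceEnergy θ κ y =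
      (∫ y, (deriv κ y ^ 2 + κ y ^ 2)) * (π / 2) :=
    setIntegral_Ioc_eq_integral_mul hstart
      (fun y hy => sliceEnergy_eq_zero_of_notMem θ (hnotMem hy))
      (fun y hy => by rw [hzero hy, deriv_of_notMem_tsupport (hnotMem hy)]; ring)
      fun _ hy => sliceEnergy_of_nonneg hθ κ hy
  have hmass : ∫ y in Set.Ioc (-(π / sin θ)) R, κ y ^ 2 * sliceMass θ y =
      (∫ y, κ y ^ 2) * (π / 2) :=
    setIntegral_Ioc_eq_integral_mul hstart (fun y hy => by rw [hzero hy]; ring)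
      (fun y hy => by rw [hzero hy]; ring) fun _ hy => by rw [sliceMass_of_nonneg hθ hy]
  refine exists_test_of_integral_sliceEnergy_lt hθ hκ
    (fun y hy => hzero fun h => h.2.not_ge hy) ?_
  rw [henergy, hmass, ← mul_assoc, integral_add
    (integrable_sq_of_hasCompactSupport (hκ.continuous_deriv (by simp)) hcompact.deriv)
    (integrable_sq_of_hasCompactSupport hκ.continuous hcompact)]
  exact mul_lt_mul_of_pos_right (by linarith) (by positivity)

theorem integral_comp_div_sub {L : ℝ} (hL : 0 < L) (a : ℝ) (g : ℝ → ℝ) :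
    ∫ y, g (y / L - a) = L * ∫ u, g u := by
  rw [Measure.integral_comp_div (fun u => g (u - a)) L, integral_sub_right_eq_self g a,
    abs_of_pos hL, smul_eq_mul]

theorem deriv_comp_div_sub {k : ℝ → ℝ} (hk : Differentiable ℝ k) (L a y : ℝ) :
    deriv (fun y => k (y / L - a)) y = deriv k (y / L - a) * (1 / L) :=
  ((hk _).hasDerivAt.comp y (((hasDerivAt_id y).div_const L).sub_const a)).deriv

theorem integral_deriv_comp_div_sub_sq {k : ℝ → ℝ} (hk : Differentiable ℝ k) {L : ℝ} (hL : 0 < L)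
    (a : ℝ) : ∫ y, deriv (fun y => k (y / L - a)) y ^ 2 = L⁻¹ * ∫ u, deriv k u ^ 2 := by
  simp only [deriv_comp_div_sub hk, mul_pow]
  rw [integral_mul_const, integral_comp_div_sub hL a fun u => deriv k u ^ 2]
  field_simp

theorem exists_inv_mul_lt {K₀ K₁ D : ℝ} (hK₀ : 0 < K₀) (hK₁ : 0 ≤ K₁) (hD : 0 < D) :
    ∃ L > 0, L⁻¹ * K₁ < D * (L * K₀) := by
  obtain ⟨L, hL⟩ := exists_gt (max 1 (K₁ / (D * K₀)))
  obtain ⟨hone, hlarge⟩ := max_lt_iff.1 hL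
  refine ⟨L, one_pos.trans hone, ?_⟩
  calc L⁻¹ * K₁ ≤ K₁ := mul_le_of_le_one_left hK₁ (inv_le_one_of_one_le₀ hone.le)
    _ < L * (D * K₀) := (div_lt_iff₀ (mul_pos hD hK₀)).1 hlarge
    _ = D * (L * K₀) := mul_left_comm _ _ _

/-- A smooth bump supported in the open unit interval. -/
def unitBump : ContDiffBump (1 / 2 : ℝ) := ⟨1 / 8, 1 / 4, by norm_num, by norm_num⟩

theorem tsupport_unitBump_subset : tsupport unitBump ⊆ Set.Ioo (0 : ℝ) 1 := by
  rw [unitBump.tsupport_eq, closedBall_eq_Icc]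
  exact Set.Icc_subset_Ioo (by norm_num [unitBump]) (by norm_num [unitBump])

theorem integral_unitBump_sq_pos : 0 < ∫ u, unitBump u ^ 2 := by
  have hone : unitBump (1 / 2) = 1 :=
    unitBump.one_of_mem_closedBall (Metric.mem_closedBall_self unitBump.rIn_pos.le)
  exact (unitBump.continuous.pow 2).integral_pos_of_hasCompactSupport_nonneg_nonzero
    (hasCompactSupport_sq unitBump.hasCompactSupport) (fun _ => sq_nonneg _) (x := 1 / 2)
    (by rw [hone]; norm_num)

theorem exists_test_in_arm (hθ : θ ∈ Set.Ioo 0 (π / 2)) (hC : 1 < C) :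
    ∃ L : ℝ, ∀ i : ℕ, ∃ φ, ∃ hφ : IsTest (brokenGuide θ) φ,
      tsupport φ ⊆ {x | ⌊x.1 / L⌋ = i} ∧
      quad (dirichletLaplacian (brokenGuide θ)) hφ.toDomain < C * ‖hφ.toL2‖ ^ 2 := by
  obtain ⟨L, hL, hlt⟩ := exists_inv_mul_lt integral_unitBump_sq_pos
    (integral_nonneg fun u => sq_nonneg (deriv unitBump u)) (sub_pos.2 hC)
  refine ⟨L, fun i => ?_⟩
  have hsupp {y : ℝ} (hy : y ∈ tsupport fun y => unitBump (y / L - i)) :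
      y / L - i ∈ Set.Ioo (0 : ℝ) 1 := tsupport_unitBump_subset
    (tsupport_comp_subset_preimage (f := fun y : ℝ => y / L - i) unitBump (by fun_prop) hy)
  have hIoo : (tsupport fun y => unitBump (y / L - i)) ⊆ Set.Ioo 0 ((i + 1) * L) := fun y hy =>
    ⟨(div_pos_iff_of_pos_right hL).1 ((Nat.cast_nonneg i).trans_lt (sub_pos.1 (hsupp hy).1)),
      (div_lt_iff₀ hL).1 (sub_lt_iff_lt_add'.1 (hsupp hy).2)⟩
  obtain ⟨φ, hφ, hsub, hquad⟩ := exists_test_of_integral_deriv_sq_lt (C := C) hθ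
    (κ := fun y => unitBump (y / L - i)) (unitBump.contDiff.comp (by fun_prop)) hIoo (by
      rwa [integral_deriv_comp_div_sub_sq (unitBump.contDiff.differentiable one_ne_zero) hL,
        integral_comp_div_sub hL i fun u => unitBump u ^ 2])
  refine ⟨φ, hφ, fun x hx => Int.floor_eq_iff.2 ?_, hquad⟩
  have hmem := hsupp (hsub hx)
  rw [Int.cast_natCast]
  exact ⟨(sub_pos.1 hmem.1).le, sub_lt_iff_lt_add'.1 hmem.2⟩

theorem laplacian_eq_zero_of_notMem {φ : ℝ × ℝ → ℂ} {x : ℝ × ℝ} (hx : x ∉ tsupport φ) :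
    laplacian φ x = 0 := by
  have hzero (v : ℝ × ℝ) : dirDeriv v (dirDeriv v φ) x = 0 :=
    image_eq_zero_of_notMem_tsupport fun h =>
      hx (tsupport_fderiv_apply_subset ℝ v (tsupport_fderiv_apply_subset ℝ v h))
  rw [laplacian, hzero, hzero, add_zero]

theorem rayleighQuotient_le_one (hθ : θ ∈ Set.Ioo 0 (π / 2)) (N : ℕ) :
    rayleighQuotient (dirichletLaplacian (brokenGuide θ)) N ≤ 1 := by
  refine EReal.le_of_forall_lt_iff_le.1 fun C hC => ?_
  obtain ⟨L, hL⟩ := exists_test_in_arm hθ (EReal.coe_lt_coe_iff.1 hC)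
  choose φ hφ hsupp hquad using hL
  have hdisj {i k : Fin N} (hik : i ≠ k) (x : ℝ × ℝ) :
      x ∉ tsupport (φ i) ∨ x ∉ tsupport (φ k) := by
    by_contra! hx
    exact hik (Fin.ext (Nat.cast_injective ((hsupp i hx.1).symm.trans (hsupp k hx.2))))
  refine rayleighQuotient_le_of_orthogonal (u := fun i : Fin N => (hφ i).toDomain)
    (fun i hi => ?_) (fun i k hik => ?_) (fun i k hik => ?_) fun i => (hquad i).le
  · have hnorm : (hφ i).toL2 = 0 := congrArg Subtype.val hi
    exact (hquad i).ne (by rw [hi, hnorm]; simp [quad])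
  · exact (hφ i).inner_toL2_eq_zero (hφ k) fun x => (hdisj hik x).imp
      image_eq_zero_of_notMem_tsupport image_eq_zero_of_notMem_tsupport
  · rw [(hφ i).apply_toDomain, inner_neg_left, neg_eq_zero]
    exact (hφ i).laplacian.inner_toL2_eq_zero (hφ k) fun x => (hdisj hik x).imp
      laplacian_eq_zero_of_notMem image_eq_zero_of_notMem_tsupport

end Arm

section Corner

open Real

variable {θ s τ r y : ℝ} {κ η : ℝ → ℝ}

/-- The energy of a slice above the threshold `1` of the essential spectrum. -/
def sliceExcess (θ : ℝ) (κ : ℝ → ℝ) (y : ℝ) : ℝ :=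
  sliceEnergy θ κ y - κ y ^ 2 * sliceMass θ y

theorem continuous_sq_mul_sliceMass (θ : ℝ) (hκ : Continuous κ) :
    Continuous fun y => κ y ^ 2 * sliceMass θ y :=
  (hκ.pow 2).mul (continuous_sliceMass θ)

theorem continuous_sliceExcess (θ : ℝ) (hκ : ContDiff ℝ 1 κ) : Continuous (sliceExcess θ κ) :=
  (continuous_sliceEnergy θ hκ).sub (continuous_sq_mul_sliceMass θ hκ.continuous)

theorem sliceExcess_of_nonpos (hθ : θ ∈ Set.Ioo 0 (π / 2)) (κ : ℝ → ℝ) (hy : y ≤ 0) :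
    sliceExcess θ κ y = deriv κ y ^ 2 * sliceMass θ y +
      sin θ * (κ y * deriv κ y) * sin (y * sin θ) ^ 2 +
      κ y ^ 2 * (sin (y * sin θ) * cos (y * sin θ)) := by
  have hlow : lowestTransverse θ y = -(y * sin θ) :=
    max_eq_right (neg_nonneg.2 (mul_nonpos_of_nonpos_of_nonneg hy (sin_pos_of_mem hθ).le))
  rw [sliceExcess, sliceEnergy, hlow, sin_neg, cos_neg]
  ring

theorem sliceExcess_of_nonneg (hθ : θ ∈ Set.Ioo 0 (π / 2)) (κ : ℝ → ℝ) (hy : 0 ≤ y) :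
    sliceExcess θ κ y = deriv κ y ^ 2 * (π / 2) := by
  rw [sliceExcess, sliceEnergy_of_nonneg hθ κ hy, sliceMass_of_nonneg hθ hy]
  ring

theorem hasDerivAt_sin_mul_sq (s y : ℝ) :
    HasDerivAt (fun y => sin (y * s) ^ 2) (2 * s * (sin (y * s) * cos (y * s))) y := by
  refine ((hasDerivAt_mul_const s).sin.fun_pow 2).congr_deriv ?_
  push_cast
  ring

theorem integral_deriv_mul_sin_sq (hs : s ≠ 0) (hη : ContDiff ℝ 1 η) :
    ∫ y in -(π / s)..0, (deriv η y * sin (y * s) ^ 2 +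
      η y * (2 * s * (sin (y * s) * cos (y * s)))) = 0 := by
  have := hη.continuous
  have := hη.continuous_deriv_one
  rw [intervalIntegral.integral_eq_sub_of_hasDerivAt (f := fun y => η y * sin (y * s) ^ 2)
    (fun y _ => (hη.differentiable one_ne_zero y).hasDerivAt.fun_mul (hasDerivAt_sin_mul_sq s y))
    (Continuous.intervalIntegrable (by fun_prop) _ _), neg_mul, div_mul_cancel₀ _ hs, zero_mul,
    sin_neg, sin_pi, sin_zero]
  ring

theorem integral_sin_mul_cos_corner (hs : s ≠ 0) :
    ∫ y in -(π / s)..0, sin (y * s) * cos (y * s) = 0 := by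
  have h := integral_deriv_mul_sin_sq hs (contDiff_const (c := (1 : ℝ)))
  simp only [deriv_const, zero_mul, zero_add, one_mul, intervalIntegral.integral_const_mul] at h
  exact (mul_eq_zero.1 h).resolve_left (mul_ne_zero two_ne_zero hs)

theorem integral_linear_corner (hs : s ≠ 0) (hη : ContDiff ℝ 1 η) :
    ∫ y in -(π / s)..0, (s * deriv η y * sin (y * s) ^ 2 +
        2 * η y * (sin (y * s) * cos (y * s))) =
      2 * (1 - s ^ 2) * ∫ y in -(π / s)..0, η y * (sin (y * s) * cos (y * s)) := by
  have := hη.continuous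
  have := hη.continuous_deriv_one
  have hsplit (y : ℝ) : s * deriv η y * sin (y * s) ^ 2 + 2 * η y * (sin (y * s) * cos (y * s)) =
      s * (deriv η y * sin (y * s) ^ 2 + η y * (2 * s * (sin (y * s) * cos (y * s)))) +
        2 * (1 - s ^ 2) * (η y * (sin (y * s) * cos (y * s))) := by ring
  simp only [hsplit]
  rw [intervalIntegral.integral_add (Continuous.intervalIntegrable (by fun_prop) _ _)
    (Continuous.intervalIntegrable (by fun_prop) _ _), intervalIntegral.integral_const_mul,
    intervalIntegral.integral_const_mul, integral_deriv_mul_sin_sq hs hη, mul_zero, zero_add]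

/-- A plateau which ends between `r` and `2 * r`, perturbed by `τ * η`. -/
def plateau (η : ℝ → ℝ) (τ r y : ℝ) : ℝ := smoothTransition (2 - y / r) + τ * η y

theorem contDiff_plateau {n : ℕ∞} (hη : ContDiff ℝ n η) (τ r : ℝ) :
    ContDiff ℝ n (plateau η τ r) :=
  (smoothTransition.contDiff.comp (contDiff_const.sub (contDiff_id.div_const r))).add
    (contDiff_const.mul hη)

theorem deriv_plateau (hη : Differentiable ℝ η) (τ r y : ℝ) : deriv (plateau η τ r) y =
    deriv smoothTransition (2 - y / r) * -(1 / r) + τ * deriv η y :=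
  (((hasDerivAt_smoothTransition _).comp y (((hasDerivAt_id y).div_const r).const_sub 2)).add
    ((hη y).hasDerivAt.const_mul τ)).deriv

theorem plateau_eq_zero (hη : ∀ y, 0 ≤ y → η y = 0) (τ : ℝ) (hr : 0 < r) (hy : 2 * r ≤ y) :
    plateau η τ r y = 0 := by
  have hend : 2 ≤ y / r := (le_div_iff₀ hr).2 hy
  rw [plateau, smoothTransition.zero_of_nonpos (by linarith), hη y (by linarith)]
  ring

theorem sliceExcess_plateau_of_nonpos (hθ : θ ∈ Set.Ioo 0 (π / 2)) (hη : Differentiable ℝ η)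
    (τ : ℝ) (hr : 0 < r) (hy : y ≤ 0) :
    sliceExcess θ (plateau η τ r) y = sin (y * sin θ) * cos (y * sin θ) +
      τ * (sin θ * deriv η y * sin (y * sin θ) ^ 2 +
        2 * η y * (sin (y * sin θ) * cos (y * sin θ))) +
      τ ^ 2 * sliceExcess θ η y := by
  have hflat : 2 ≤ 2 - y / r := by linarith [div_nonpos_of_nonpos_of_nonneg hy hr.le]
  have hderiv : deriv smoothTransition (2 - y / r) = 0 :=
    deriv_smoothTransition_eq_zero fun h => by linarith [h.2]
  rw [sliceExcess_of_nonpos hθ _ hy, sliceExcess_of_nonpos hθ _ hy, deriv_plateau hη, hderiv,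
    plateau, smoothTransition.one_of_one_le (by linarith)]
  ring

theorem sliceExcess_plateau_of_pos (hθ : θ ∈ Set.Ioo 0 (π / 2)) (hη : Differentiable ℝ η)
    (hη0 : ∀ y, 0 ≤ y → η y = 0) (τ r : ℝ) (hy : 0 < y) :
    sliceExcess θ (plateau η τ r) y =
      (deriv smoothTransition (2 - y / r) / r) ^ 2 * (π / 2) := by
  have hev : η =ᶠ[𝓝 y] fun _ => 0 :=
    Filter.mem_of_superset (Ioi_mem_nhds hy) fun x hx => hη0 x (le_of_lt hx)
  rw [sliceExcess_of_nonneg hθ _ hy.le, deriv_plateau hη, hev.deriv_eq, deriv_const]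
  ring

theorem integral_sliceExcess_plateau_corner (hθ : θ ∈ Set.Ioo 0 (π / 2)) (hη : ContDiff ℝ 1 η)
    (τ : ℝ) (hr : 0 < r) :
    ∫ y in -(π / sin θ)..0, sliceExcess θ (plateau η τ r) y =
      τ * (2 * cos θ ^ 2 *
        ∫ y in -(π / sin θ)..0, η y * (sin (y * sin θ) * cos (y * sin θ))) +
      τ ^ 2 * ∫ y in -(π / sin θ)..0, sliceExcess θ η y := by
  have := hη.continuous
  have := hη.continuous_deriv_one
  have := continuous_sliceExcess θ hη
  have hs := sin_pos_of_mem hθ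
  have hle : -(π / sin θ) ≤ 0 := neg_nonpos.2 (div_pos pi_pos hs).le
  rw [intervalIntegral.integral_congr fun y hy => sliceExcess_plateau_of_nonpos hθ
      (hη.differentiable one_ne_zero) τ hr (Set.uIcc_of_le hle ▸ hy).2,
    intervalIntegral.integral_add (Continuous.intervalIntegrable (by fun_prop) _ _)
      (Continuous.intervalIntegrable (by fun_prop) _ _),
    intervalIntegral.integral_add (Continuous.intervalIntegrable (by fun_prop) _ _)
      (Continuous.intervalIntegrable (by fun_prop) _ _),
    intervalIntegral.integral_const_mul, intervalIntegral.integral_const_mul,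
    integral_sin_mul_cos_corner hs.ne', integral_linear_corner hs.ne' hη, ← cos_sq' θ, zero_add]

theorem exists_integral_sliceExcess_plateau_tail_le (hθ : θ ∈ Set.Ioo 0 (π / 2))
    (hη : Differentiable ℝ η) (hη0 : ∀ y, 0 ≤ y → η y = 0) :
    ∃ D, ∀ τ, ∀ r > 0, ∫ y in 0..(2 * r), sliceExcess θ (plateau η τ r) y ≤ D / r := by
  obtain ⟨M, hM⟩ := exists_abs_deriv_smoothTransition_le
  refine ⟨π * M ^ 2, fun τ r hr => ?_⟩
  have hbound (y : ℝ) (hy : y ∈ Set.uIoc 0 (2 * r)) :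
      ‖sliceExcess θ (plateau η τ r) y‖ ≤ (M / r) ^ 2 * (π / 2) := by
    rw [Set.uIoc_of_le (by positivity)] at hy
    rw [sliceExcess_plateau_of_pos hθ hη hη0 τ r hy.1, norm_mul, norm_pow, norm_eq_abs, abs_div,
      abs_of_pos hr, norm_of_nonneg (by positivity : 0 ≤ π / 2)]
    gcongr
    exact hM _
  calc ∫ y in 0..(2 * r), sliceExcess θ (plateau η τ r) y
      ≤ (M / r) ^ 2 * (π / 2) * |2 * r - 0| :=
        (le_norm_self _).trans (intervalIntegral.norm_integral_le_of_norm_le_const hbound)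
    _ = π * M ^ 2 / r := by
        rw [sub_zero, abs_of_pos (by positivity)]
        field_simp

theorem exists_mul_add_sq_mul_add_div_neg {b : ℝ} (hb : b ≠ 0) (Γ D : ℝ) :
    ∃ τ, ∃ r > 0, τ * b + τ ^ 2 * Γ + D / r < 0 := by
  obtain ⟨τ, hτ⟩ : ∃ τ, τ * b + τ ^ 2 * Γ < 0 := by
    have : 0 < |Γ| + 1 := by positivity
    refine ⟨-b / (|Γ| + 1), ?_⟩
    have heq : -b / (|Γ| + 1) * b + (-b / (|Γ| + 1)) ^ 2 * Γ =
        (b / (|Γ| + 1)) ^ 2 * (Γ - (|Γ| + 1)) := by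
      field_simp
      ring
    rw [heq]
    exact mul_neg_of_pos_of_neg (by positivity) (by linarith [le_abs_self Γ])
  have hdiv : Tendsto (fun r => D / r) atTop (𝓝 0) := tendsto_const_nhds.div_atTop tendsto_id
  obtain ⟨r, hlt, hr⟩ :=
    ((hdiv.eventually_lt_const (neg_pos.2 hτ)).and (eventually_gt_atTop 0)).exists
  exact ⟨τ, r, hr, by linarith⟩

theorem exists_integral_sliceExcess_plateau_neg (hθ : θ ∈ Set.Ioo 0 (π / 2))
    (hη : ContDiff ℝ 1 η) (hη0 : ∀ y, 0 ≤ y → η y = 0)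
    (hint : ∫ y in -(π / sin θ)..0, η y * (sin (y * sin θ) * cos (y * sin θ)) ≠ 0) :
    ∃ τ, ∃ r > 0, ∫ y in -(π / sin θ)..(2 * r), sliceExcess θ (plateau η τ r) y < 0 := by
  obtain ⟨D, hD⟩ :=
    exists_integral_sliceExcess_plateau_tail_le hθ (hη.differentiable one_ne_zero) hη0
  have hcos : 2 * cos θ ^ 2 ≠ 0 := mul_ne_zero two_ne_zero (pow_ne_zero 2 (cos_pos_of_mem hθ).ne')
  obtain ⟨τ, r, hr, hneg⟩ := exists_mul_add_sq_mul_add_div_neg (mul_ne_zero hcos hint)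
    (∫ y in -(π / sin θ)..0, sliceExcess θ η y) D
  have hcont := continuous_sliceExcess θ (contDiff_plateau (n := 1) hη τ r)
  refine ⟨τ, r, hr, ?_⟩
  rw [← intervalIntegral.integral_add_adjacent_intervals (b := 0)
    (hcont.intervalIntegrable _ _) (hcont.intervalIntegrable _ _),
    integral_sliceExcess_plateau_corner hθ hη τ hr]
  linarith [hD τ r hr]

/-- A perturbation of the constant profile, supported in the corner of the guide, along which the
energy excess has nonzero first variation. -/
def cornerProfile (s y : ℝ) : ℝ := smoothTransition (-y) * cos (y * s)

theorem contDiff_cornerProfile (s : ℝ) : ContDiff ℝ ∞ (cornerProfile s) :=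
  (smoothTransition.contDiff.comp contDiff_neg).mul
    (contDiff_cos.comp (contDiff_id.mul contDiff_const))

theorem cornerProfile_eq_zero (s : ℝ) (hy : 0 ≤ y) : cornerProfile s y = 0 := by
  rw [cornerProfile, smoothTransition.zero_of_nonpos (neg_nonpos.2 hy), zero_mul]

theorem integral_cornerProfile_neg (hs : 0 < s) :
    ∫ y in -(π / s)..0, cornerProfile s y * (sin (y * s) * cos (y * s)) < 0 := by
  have := (contDiff_cornerProfile s).continuous
  have hpos : 0 < π / s := div_pos pi_pos hs
  have hneg (y : ℝ) : -(cornerProfile s y * (sin (y * s) * cos (y * s))) =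
      smoothTransition (-y) * cos (y * s) ^ 2 * sin (-(y * s)) := by
    rw [cornerProfile, sin_neg]
    ring
  rw [← neg_pos, ← intervalIntegral.integral_neg]
  refine intervalIntegral.integral_pos (by linarith) (by fun_prop) (fun y hy => ?_)
    ⟨-(π / (4 * s)), ⟨?_, ?_⟩, ?_⟩
  · have hangle : -(y * s) ≤ π := by
      rw [← neg_mul, ← le_div_iff₀ hs]
      linarith [hy.1]
    rw [hneg]
    exact mul_nonneg (mul_nonneg (smoothTransition.nonneg _) (sq_nonneg _))
      (sin_nonneg_of_nonneg_of_le_pi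
        (neg_nonneg.2 (mul_nonpos_of_nonpos_of_nonneg hy.2 hs.le)) hangle)
  · exact neg_le_neg (div_le_div_of_nonneg_left pi_pos.le hs (by linarith))
  · exact neg_nonpos.2 (by positivity)
  · have hangle : -(π / (4 * s)) * s = -(π / 4) := by field_simp
    rw [hneg, hangle, neg_neg, neg_neg, cos_neg, sin_pi_div_four, cos_pi_div_four]
    have := smoothTransition.pos_of_pos (x := π / (4 * s)) (by positivity)
    positivity

theorem exists_quad_lt (hθ : θ ∈ Set.Ioo 0 (π / 2)) :
    ∃ u : (dirichletLaplacian (brokenGuide θ)).domain,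
      quad (dirichletLaplacian (brokenGuide θ)) u < ‖(u : L2 (brokenGuide θ))‖ ^ 2 := by
  have hs := sin_pos_of_mem hθ
  have hη := contDiff_cornerProfile (sin θ)
  obtain ⟨τ, r, hr, hneg⟩ := exists_integral_sliceExcess_plateau_neg hθ (hη.of_le (by simp))
    (fun _ hy => cornerProfile_eq_zero _ hy) (integral_cornerProfile_neg hs).ne
  have hκ := contDiff_plateau hη τ r
  have henergy := continuous_sliceEnergy θ (hκ.of_le (by simp))
  have hmass := continuous_sq_mul_sliceMass θ hκ.continuous
  have hle : -(π / sin θ) ≤ 2 * r := by linarith [div_pos pi_pos hs]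
  simp only [sliceExcess] at hneg
  rw [intervalIntegral.integral_sub (henergy.intervalIntegrable _ _)
    (hmass.intervalIntegrable _ _), intervalIntegral.integral_of_le hle,
    intervalIntegral.integral_of_le hle, sub_neg, ← one_mul (∫ y in _, _ ^ 2 * _)] at hneg
  obtain ⟨φ, hφ, -, hquad⟩ := exists_test_of_integral_sliceEnergy_lt hθ hκ
    (fun y hy => plateau_eq_zero (fun _ hy => cornerProfile_eq_zero _ hy) τ hr hy) hneg
  exact ⟨hφ.toDomain, hquad.trans_eq (one_mul _)⟩

end Corner

end Waveguide

end

theorem proposition5p1 (θ : ℝ) (hθ : θ ∈ Set.Ioo 0 (Real.pi / 2)) :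
    let A := Waveguide.dirichletLaplacian (Waveguide.brokenGuide θ)
    (0 < Waveguide.countBelow A 1 ∧ Waveguide.countBelow A 1 < ⊤) ∧
    (Waveguide.eigenvaluesBelowEss A).Finite ∧
    (Waveguide.eigenvaluesBelowEss A).Nonempty ∧
    Waveguide.eigenvaluesBelowEss A =
      {r : ℝ | Waveguide.eigenspace A (r : ℂ) ≠ ⊥ ∧ r < 1} ∧
    (∀ r ∈ Waveguide.eigenvaluesBelowEss A,
      FiniteDimensional ℂ (Waveguide.eigenspace A (r : ℂ))) ∧
    Waveguide.countBelow A 1 =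
      ((∑ᶠ r ∈ Waveguide.eigenvaluesBelowEss A,
        Module.finrank ℂ (Waveguide.eigenspace A (r : ℂ)) : ℕ) : ℕ∞) := by
  intro A
  have hA := Waveguide.isNonnegSelfAdjoint_dirichletLaplacian (Waveguide.brokenGuide θ)
  obtain ⟨F, _, hF⟩ := Waveguide.exists_boundedBelowOn hθ
  obtain ⟨u, hu⟩ := Waveguide.exists_quad_lt hθ
  have hess : 1 ∈ Waveguide.essentialSpectrum A :=
    hF.mem_essentialSpectrum hA (Waveguide.rayleighQuotient_le_one hθ)
  have hcount : Waveguide.countBelow A 1 = Module.finrank ℂ (Waveguide.lowSpace A 1) :=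
    hF.countBelow_eq_finrank_lowSpace hA
  have hlow : Waveguide.lowSpace A 1 ≠ ⊥ := hF.lowSpace_ne_bot hA (by rwa [one_mul])
  have : FiniteDimensional ℂ (Waveguide.lowSpace A 1) := hF.finiteDimensional_lowSpace hA
  rw [hF.eigenvaluesBelowEss_eq hA hess, hcount]
  refine ⟨⟨?_, ENat.natCast_lt_top _⟩, hA.finite_eigenvalues_lt,
    Waveguide.nonempty_eigenvalues_lt hlow, rfl, fun r hr =>
      Submodule.finiteDimensional_of_le (Waveguide.eigenspace_le_lowSpace hr.2), ?_⟩
  · exact_mod_cast Nat.pos_of_ne_zero (mt Submodule.finrank_eq_zero.1 hlow)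
  · rw [hA.finrank_lowSpace]
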